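/- Let $q$ be a complex number with $0<|q|<1$. Write $(x;q)_n=\prod_{i=0}^{n-1}(1-q^ix)$, $(x;q)_\infty=\prod_{i\ge0}(1-q^ix)$, $j(x;q)=(x;q)_\infty(q/x;q)_\infty(q;q)_\infty$, $$J_{a,m}=j(q^a;q^m),\qquad J_m=J_{m,3m}=\prod_{i\ge1}(1-q^{mi}),\qquad g(x,q)=x^{-1}\Big(-1+\sum_{n\ge0}\frac{q^{n^2}}{(x;q)_{n+1}(q/x;q)_n}\Big).$$ The rank of a partition is its largest part minus its number of parts (the empty partition has rank $0$); $p(n)$ is the number of partitions of $n$, $N(a,M;n)$ the number of partitions of $n$ with rank congruent to $a$ modulo $M$, and $$D(a,M)=\sum_{n\ge0}\Big(N(a,M;n)-\frac{p(n)}M\Big)q^n,\qquad R(a,b,M,c,m)=\sum_{n\ge0}\big(N(a,M;mn+c)-N(b,M;mn+c)\big)q^n.$$ Then all the series involved converge, and the following hold. (1) The deviations modulo $7$ are $$\begin{aligned} D(0,7)&=2+2q^7g(q^7,q^{49})-\tfrac87\tfrac{J_{21,49}^2}{J_7}+\tfrac67q\tfrac{J_{49}^2}{J_{7,49}}-\tfrac27q^2\tfrac{J_{14,49}^2}{J_7}+\tfrac47q^3\tfrac{J_{49}^2}{J_{14,49}}+\tfrac27q^4\tfrac{J_{49}^2}{J_{21,49}}-\tfrac47q^6\tfrac{J_{7,49}^2}{J_7},\\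 D(1,7)=D(6,7)&=-1-q^7g(q^7,q^{49})+q^{16}g(q^{21},q^{49})+\tfrac67\tfrac{J_{21,49}^2}{J_7}-\tfrac17q\tfrac{J_{49}^2}{J_{7,49}}+\tfrac57q^2\tfrac{J_{14,49}^2}{J_7}-\tfrac37q^3\tfrac{J_{49}^2}{J_{14,49}}+\tfrac27q^4\tfrac{J_{49}^2}{J_{21,49}}+\tfrac37q^6\tfrac{J_{7,49}^2}{J_7},\\ D(2,7)=D(5,7)&=q^{13}g(q^{14},q^{49})-q^{16}g(q^{21},q^{49})-\tfrac17\tfrac{J_{21,49}^2}{J_7}-\tfrac17q\tfrac{J_{49}^2}{J_{7,49}}-\tfrac27q^2\tfrac{J_{14,49}^2}{J_7}+\tfrac47q^3\tfrac{J_{49}^2}{J_{14,49}}-\tfrac57q^4\tfrac{J_{49}^2}{J_{21,49}}+\tfrac37q^6\tfrac{J_{7,49}^2}{J_7},\\ D(3,7)=D(4,7)&=-q^{13}g(q^{14},q^{49})-\tfrac17\tfrac{J_{21,49}^2}{J_7}-\tfrac17q\tfrac{J_{49}^2}{J_{7,49}}-\tfrac27q^2\tfrac{J_{14,49}^2}{J_7}-\tfrac37q^3\tfrac{J_{49}^2}{J_{14,49}}+\tfrac27q^4\tfrac{J_{49}^2}{J_{21,49}}-\tfrac47q^6\tfrac{J_{7,49}^2}{J_7}.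 \end{aligned}$$ (2) (Dyson's conjectures modulo $7$.) For every $n\ge0$: $$\begin{aligned} &N(2,7;7n)=N(3,7;7n),\qquad N(1,7;7n+1)=N(2,7;7n+1)=N(3,7;7n+1),\\ &N(0,7;7n+2)=N(3,7;7n+2),\\ &N(0,7;7n+3)=N(2,7;7n+3),\qquad N(1,7;7n+3)=N(3,7;7n+3),\\ &N(0,7;7n+4)=N(1,7;7n+4)=N(3,7;7n+4),\\ &N(0,7;7n+5)=N(1,7;7n+5)=N(2,7;7n+5)=N(3,7;7n+5),\\ &N(0,7;7n+6)+N(1,7;7n+6)=N(2,7;7n+6)+N(3,7;7n+6). \end{aligned}$$ (3) (The Atkin–Swinnerton-Dyer evaluation of all rank-differences modulo $7$, in terms of $g$.) Writing $R_{ab}(c)=R(a,b,7,c,7)$, $$\begin{aligned} c=0:&\quad R_{23}(0)=0,\quad R_{02}(0)+R_{12}(0)=1+q\,g(q,q^7),\quad R_{02}(0)+2R_{12}(0)=J_{3,7}^2/J_1;\\ c=1:&\quad R_{12}(1)=R_{23}(1)=0,\quad R_{01}(1)=J_7^2/J_{1,7};\\ c=2:&\quad R_{03}(2)=0,\quad R_{23}(2)=-q^2g(q^3,q^7),\quad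 R_{13}(2)+R_{23}(2)=J_{2,7}^2/J_1;\\ c=3:&\quad R_{02}(3)=R_{13}(3)=0,\quad R_{01}(3)=J_7^2/J_{2,7};\\ c=4:&\quad R_{01}(4)=R_{03}(4)=0,\quad R_{02}(4)=J_7^2/J_{3,7};\\ c=5:&\quad R_{01}(5)=R_{02}(5)=R_{03}(5)=0;\\ c=6:&\quad R_{02}(6)+R_{13}(6)=0,\quad R_{03}(6)=q\,g(q^2,q^7),\quad R_{01}(6)=-J_{1,7}^2/J_1. \end{aligned}$$ -/

import Mathlib

open scoped BigOperators

noncomputable section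

/-- The rank of a partition: the largest part minus the number of parts
(the empty partition has rank `0`). -/
def partitionRank {n : ℕ} (p : n.Partition) : ℤ :=
  (p.parts.sup : ℤ) - (Multiset.card p.parts : ℤ)

/-- `p(n)`: the number of partitions of `n`. -/
def partitionCount (n : ℕ) : ℕ := Fintype.card n.Partition

/-- `N(a, M; n)`: the number of partitions of `n` with rank congruent to `a` modulo `M`. -/
def rankCount (a M n : ℕ) : ℕ :=
  (Finset.univ.filter fun p : n.Partition => partitionRank p ≡ (a : ℤ) [ZMOD (M : ℤ)]).card

/-- The coefficient `N(a, M; n) - p(n) / M` of the deviation `D(a, M)`. -/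
def deviationCoeff (a M n : ℕ) : ℂ := (rankCount a M n : ℂ) - (partitionCount n : ℂ) / (M : ℂ)

/-- The deviation `D(a, M) = D(a, M, q) = ∑_{n ≥ 0} (N(a, M; n) - p(n) / M) q ^ n`. -/
def rankDeviation (a M : ℕ) (q : ℂ) : ℂ := ∑' n : ℕ, deviationCoeff a M n * q ^ n

/-- The coefficient `N(a, M; m n + c) - N(b, M; m n + c)` of the rank-difference
`R(a, b, M, c, m)`. -/
def rankDifferenceCoeff (a b M c m n : ℕ) : ℂ :=
  (rankCount a M (m * n + c) : ℂ) - (rankCount b M (m * n + c) : ℂ)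

/-- The rank-difference
`R(a, b, M, c, m) = ∑_{n ≥ 0} (N(a, M; m n + c) - N(b, M; m n + c)) q ^ n`. -/
def rankDifference (a b M c m : ℕ) (q : ℂ) : ℂ :=
  ∑' n : ℕ, rankDifferenceCoeff a b M c m n * q ^ n

/-- The finite product `(x; q)_n = ∏_{i < n} (1 - q ^ i x)`. -/
def qPoch (x q : ℂ) (n : ℕ) : ℂ := ∏ i ∈ Finset.range n, (1 - q ^ i * x)

/-- The infinite product `(x; q)_∞ = ∏_{i ≥ 0} (1 - q ^ i x)`. -/
def qPochInf (x q : ℂ) : ℂ := ∏' i : ℕ, (1 - q ^ i * x)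

/-- For `|q| < 1` the product that defines `(x; q)_∞` converges. -/
theorem multipliable_qPochInf (x q : ℂ) (hq : ‖q‖ < 1) :
    Multipliable fun i : ℕ => 1 - q ^ i * x := by
  have h : Summable fun i : ℕ => -(q ^ i * x) :=
    ((summable_geometric_of_norm_lt_one hq).mul_right x).neg
  simpa [sub_eq_add_neg] using Complex.multipliable_one_add_of_summable h

/-- The theta function `j(x; q) = (x; q)_∞ (q / x; q)_∞ (q; q)_∞`. -/
def jTheta (x q : ℂ) : ℂ := qPochInf x q * qPochInf (q / x) q * qPochInf q q

/-- `J_{a, m} = j(q ^ a; q ^ m)`. -/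
def J₂ (a m : ℕ) (q : ℂ) : ℂ := jTheta (q ^ a) (q ^ m)

/-- `J_m = ∏_{i ≥ 1} (1 - q ^ (m i))`; it equals `J_{m, 3 m}`, see `J₁_eq_J₂`. -/
def J₁ (m : ℕ) (q : ℂ) : ℂ := qPochInf (q ^ m) (q ^ m)

theorem J₁_eq_J₂ (m : ℕ) (hm : 0 < m) (q : ℂ) (hq0 : q ≠ 0) (hq : ‖q‖ < 1) :
    J₁ m q = J₂ m (3 * m) q := by
  have hx : ‖q ^ m‖ < 1 := by
    rw [norm_pow]; exact pow_lt_one₀ (norm_nonneg _) hq hm.ne'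
  have hx3 : ‖(q ^ m) ^ 3‖ < 1 := by
    rw [norm_pow]; exact pow_lt_one₀ (norm_nonneg _) hx (by norm_num)
  have hx0 : q ^ m ≠ 0 := pow_ne_zero _ hq0
  unfold J₁ J₂ jTheta
  rw [show q ^ (3 * m) = (q ^ m) ^ 3 by rw [← pow_mul, mul_comm]]
  generalize q ^ m = x at *
  rw [show x ^ 3 / x = x ^ 2 by field_simp]
  unfold qPochInf
  have hmul := multipliable_qPochInf x x hx
  rw [← (Nat.divModEquiv 3).symm.tprod_eq (fun i : ℕ => 1 - x ^ i * x)]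
  have hmul' : Multipliable fun p : ℕ × Fin 3 => 1 - x ^ ((Nat.divModEquiv 3).symm p) * x :=
    (Nat.divModEquiv 3).symm.multipliable_iff.2 hmul
  rw [hmul'.tprod_prod' (fun b => Multipliable.of_finite)]
  rw [← Multipliable.tprod_mul (multipliable_qPochInf _ _ hx3) (multipliable_qPochInf _ _ hx3),
    ← Multipliable.tprod_mul ((multipliable_qPochInf _ _ hx3).mul
      (multipliable_qPochInf _ _ hx3)) (multipliable_qPochInf _ _ hx3)]
  refine tprod_congr fun n => ?_
  rw [tprod_fintype, Fin.prod_univ_three]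
  simp [Nat.divModEquiv]
  ring

/-- The `n`-th term `q ^ (n²) / ((x; q)_{n+1} (q / x; q)_n)` of the series in `g(x, q)`. -/
def gTerm (x q : ℂ) (n : ℕ) : ℂ := q ^ (n ^ 2) / (qPoch x q (n + 1) * qPoch (q / x) q n)

/-- The universal mock theta function
`g(x, q) = x⁻¹ (-1 + ∑_{n ≥ 0} q ^ (n²) / ((x; q)_{n+1} (q / x; q)_n))`. -/
def gMock (x q : ℂ) : ℂ := x⁻¹ * (-1 + ∑' n : ℕ, gTerm x q n)

end

open scoped BigOperators
open Filter Topology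

noncomputable section

/-! Write E for (q;q)_∞. Sorting partitions by their largest part and applying the Rogers–Fine
transformation turns the generating function of z^rank into Σ q^(n²)/((zq;q)_n (q/z;q)_n). Partial
fractions and Cauchy's Durfee rectangle identity turn this into E⁻¹ (1 - z) Σ_k (-1)^k
q^(k(3k+1)/2)/(1 - z q^k). The same computation writes E·g(x,q) as an Appell sum of level three
(`appell_one_eq`), so ranks and g can be compared.

For z⁷ = 1 the fraction 1/(1 - z q^k) is expanded over the denominator 1 - q^(7k), and Fourier
inversion expresses E·Σ N(i,7;n) q^n through the sums `rankSum q b`. The symmetry k ↦ -k and one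
telescoping relation leave b = 7, 4, 1, that is b = 10 - 3t with t = 1, 2, 3. Splitting k modulo 7
turns such a sum into seven Appell sums in y = q⁷ with base y⁷ and arguments y^(t+k), -3 ≤ k ≤ 3.
The Atkin–Swinnerton-Dyer identity (`appell_three_term`) reduces each pair ±k to a multiple of the
central sum k = 0 plus a theta quotient; for the pair ±t one argument is 1, and a limit
(`appell_three_term_self`) produces logarithmic derivatives instead. The multipliers of the central
sum add up to the 7-dissection of E, so the central sum contributes exactly E·g times a power of q.

The Atkin–Swinnerton-Dyer identity itself, cleared of denominators, says that a function holomorphic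
on ℂˣ is constant: it is invariant under z ↦ qz because of the quintuple product identity, so
Liouville applies, and the value is read off at one zero of a theta factor.

The logarithmic derivatives are removed by the infinitesimal Weierstrass relation: at y, y², y³ it
gives three independent linear equations for three unknowns with theta quotients on the right.
Together with Klein's relation between J_{1,7}, J_{2,7}, J_{3,7} this yields the deviations. In
these formulas everything but the explicit powers of q depends on q⁷ only, so replacing q by zq with
z⁷ = 1 separates the residue classes and gives the rank differences; Dyson's equalities follow
because the relevant entries coincide and power series have unique coefficients. -/

/-! ### Triangular numbers -/

/-- The triangular number `k (k - 1) / 2` of an integer `k`. -/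
def tri (k : ℤ) : ℤ := k * (k - 1) / 2

theorem two_mul_tri (k : ℤ) : 2 * tri k = k * (k - 1) :=
  Int.mul_ediv_cancel' (Int.even_mul_pred_self k).two_dvd

@[simp] theorem tri_zero : tri 0 = 0 := by simp [tri]

@[simp] theorem tri_one : tri 1 = 0 := by simp [tri]

theorem tri_add (a b : ℤ) : tri (a + b) = tri a + tri b + a * b := by
  have h : 2 * tri (a + b) = 2 * (tri a + tri b + a * b) := by
    linear_combination two_mul_tri (a + b) - two_mul_tri a - two_mul_tri b
  omega

theorem tri_add_one (a : ℤ) : tri (a + 1) = tri a + a := by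
  simp [tri_add]

theorem tri_neg (a : ℤ) : tri (-a) = tri a + a := by
  have h : 2 * tri (-a) = 2 * (tri a + a) := by
    linear_combination two_mul_tri (-a) - two_mul_tri a
  omega

theorem tri_sub_one (a : ℤ) : tri (a - 1) = tri a - a + 1 := by
  have := tri_add_one (a - 1)
  rw [sub_add_cancel] at this
  omega

/-! ### Sums over the integers -/

theorem HasSum.of_eq {ι : Type*} {f g : ι → ℂ} {a b : ℂ} (h : HasSum f a) (hf : ∀ k, g k = f k)
    (hab : b = a) : HasSum g b := by
  rw [hab, funext hf]; exact h

theorem summable_nat_pow_mul_zpow_tri {q x : ℂ} (hq0 : q ≠ 0) (hq : ‖q‖ < 1) (hx : x ≠ 0) :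
    Summable fun n : ℕ => x ^ n * q ^ tri n := by
  refine summable_of_ratio_test_tendsto_lt_one (l := 0) one_pos
    (Eventually.of_forall fun n => by positivity) ?_
  have h : ∀ n : ℕ, ‖x ^ (n + 1) * q ^ tri ((n + 1 : ℕ) : ℤ)‖ / ‖x ^ n * q ^ tri n‖
      = ‖x‖ * ‖q‖ ^ n := by
    intro n
    push_cast
    rw [tri_add_one, zpow_add₀ hq0, zpow_natCast, ← norm_div, ← norm_pow, ← norm_mul]
    congr 1
    field_simp
    ring
  simp_rw [h]
  simpa using (tendsto_pow_atTop_nhds_zero_of_lt_one (norm_nonneg q) hq).const_mul ‖x‖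

theorem summable_zpow_mul_zpow_tri {q x : ℂ} (hq0 : q ≠ 0) (hq : ‖q‖ < 1) (hx : x ≠ 0) :
    Summable fun k : ℤ => x ^ k * q ^ tri k := by
  refine Summable.of_nat_of_neg ?_ ?_
  · simpa using summable_nat_pow_mul_zpow_tri hq0 hq hx
  · refine (summable_nat_pow_mul_zpow_tri hq0 hq (div_ne_zero hq0 hx)).congr fun n => ?_
    rw [tri_neg, zpow_add₀ hq0, zpow_neg, zpow_natCast, zpow_natCast, div_pow]
    field_simp

theorem summable_norm_zpow_mul_zpow_tri {q x : ℂ} (hq0 : q ≠ 0) (hq : ‖q‖ < 1) (hx : x ≠ 0) :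
    Summable fun k : ℤ => ‖x‖ ^ k * ‖q‖ ^ tri k := by
  simpa [norm_mul, norm_zpow] using (summable_zpow_mul_zpow_tri hq0 hq hx).norm

/-- A sum over the integers, split into residue classes. -/
theorem tsum_int_eq_sum_residues {f : ℤ → ℂ} (hf : Summable f) (m : ℕ) [NeZero m] (a : ℤ) :
    ∑' n, f n = ∑ i : Fin m, ∑' r : ℤ, f (m * r + i + a) := by
  let e : Fin m × ℤ ≃ ℤ :=
    ((Equiv.prodComm (Fin m) ℤ).trans (Int.divModEquiv m).symm).trans (Equiv.addRight a)
  have he : ∀ p, e p = m * p.2 + p.1 + a := fun p => by simp [e, mul_comm]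
  have h2 : Summable fun p : Fin m × ℤ => f (m * p.2 + p.1 + a) :=
    (e.summable_iff.2 hf).congr fun p => by rw [Function.comp, he]
  rw [← e.tsum_eq, ← tsum_fintype (L := .unconditional _)]
  simp_rw [he]
  exact h2.tsum_prod' fun i => h2.prod_factor i

/-! ### Finite and infinite products -/

theorem qPoch_zero (x q : ℂ) : qPoch x q 0 = 1 := by simp [qPoch]

theorem qPoch_succ (x q : ℂ) (n : ℕ) : qPoch x q (n + 1) = qPoch x q n * (1 - q ^ n * x) :=
  Finset.prod_range_succ _ _

theorem qPoch_succ' (x q : ℂ) (n : ℕ) : qPoch x q (n + 1) = (1 - x) * qPoch (q * x) q n := by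
  rw [qPoch, Finset.prod_range_succ', mul_comm, qPoch]
  simp [pow_succ, mul_assoc]

theorem tendsto_qPoch (x : ℂ) {q : ℂ} (hq : ‖q‖ < 1) :
    Tendsto (qPoch x q) atTop (𝓝 (qPochInf x q)) :=
  (multipliable_qPochInf x q hq).hasProd.tendsto_prod_nat

theorem qPochInf_eq_mul (x : ℂ) {q : ℂ} (hq : ‖q‖ < 1) :
    qPochInf x q = (1 - x) * qPochInf (q * x) q :=
  tendsto_nhds_unique ((tendsto_add_atTop_iff_nat 1).2 (tendsto_qPoch x hq))
    (by simpa [qPoch_succ'] using (tendsto_qPoch (q * x) hq).const_mul (1 - x))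

theorem qPochInf_ne_zero {x q : ℂ} (hq : ‖q‖ < 1) (h : ∀ i : ℕ, q ^ i * x ≠ 1) :
    qPochInf x q ≠ 0 := by
  have := tprod_one_add_ne_zero_of_summable (f := fun i : ℕ => -(q ^ i * x))
    (fun i => by rw [← sub_eq_add_neg]; exact sub_ne_zero.2 (h i).symm)
    (by simpa using (summable_geometric_of_norm_lt_one hq).norm.mul_right ‖x‖)
  simpa [qPochInf, sub_eq_add_neg] using this

theorem pow_mul_ne_one_of_norm_lt_one {x q : ℂ} (hq : ‖q‖ < 1) (hx : ‖x‖ < 1) (i : ℕ) :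
    q ^ i * x ≠ 1 := by
  intro h
  have h1 : ‖q ^ i * x‖ = 1 := by simp [h]
  rw [norm_mul, norm_pow] at h1
  have := pow_le_one₀ (n := i) (norm_nonneg q) hq.le
  nlinarith [norm_nonneg x]

theorem qPochInf_self_ne_zero {q : ℂ} (hq : ‖q‖ < 1) : qPochInf q q ≠ 0 :=
  qPochInf_ne_zero hq (pow_mul_ne_one_of_norm_lt_one hq hq)

theorem qPoch_ne_zero {x q : ℂ} (h : ∀ i : ℕ, q ^ i * x ≠ 1) (n : ℕ) : qPoch x q n ≠ 0 :=
  Finset.prod_ne_zero_iff.2 fun i _ => sub_ne_zero.2 (h i).symm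

/-- The inverses of the finite products are bounded. -/
theorem exists_norm_inv_qPoch_le {x q : ℂ} (hq : ‖q‖ < 1) (h : ∀ i : ℕ, q ^ i * x ≠ 1) :
    ∃ C : ℝ, 0 < C ∧ ∀ n, ‖(qPoch x q n)⁻¹‖ ≤ C := by
  obtain ⟨C, hC⟩ := (Metric.isBounded_range_of_tendsto _
    ((tendsto_qPoch x hq).inv₀ (qPochInf_ne_zero hq h))).exists_norm_le
  refine ⟨max C 1, by positivity, fun n => (hC _ ⟨n, rfl⟩).trans (le_max_left _ _)⟩

/-- `1 / (q; q)_m`, extended by `0` to negative `m`. -/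
def invQ (q : ℂ) (m : ℤ) : ℂ := if 0 ≤ m then (qPoch q q m.toNat)⁻¹ else 0

theorem invQ_natCast (q : ℂ) (n : ℕ) : invQ q n = (qPoch q q n)⁻¹ := by simp [invQ]

theorem invQ_of_neg (q : ℂ) {m : ℤ} (hm : m < 0) : invQ q m = 0 := by simp [invQ, hm]

/-- Extension by 0 makes the recurrence valid without boundary cases: at m = 0 the factor 1 - q^m
vanishes. -/
theorem invQ_sub_one {q : ℂ} (hq : ‖q‖ < 1) (m : ℤ) : invQ q (m - 1) = (1 - q ^ m) * invQ q m := by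
  rcases lt_trichotomy m 0 with h | rfl | h
  · rw [invQ_of_neg _ h, invQ_of_neg _ (by omega), mul_zero]
  · rw [invQ_of_neg _ (by omega)]; simp
  · obtain ⟨n, rfl⟩ : ∃ n : ℕ, m = n + 1 := ⟨(m - 1).toNat, by omega⟩
    have h1 := qPoch_ne_zero (pow_mul_ne_one_of_norm_lt_one hq hq) n
    have h2 : 1 - q ^ n * q ≠ 0 := sub_ne_zero.2 (pow_mul_ne_one_of_norm_lt_one hq hq n).symm
    rw [add_sub_cancel_right, invQ_natCast]
    have := invQ_natCast q (n + 1)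
    push_cast at this
    rw [this, qPoch_succ]
    have h3 : q ^ ((n : ℤ) + 1) = q ^ n * q := by
      exact_mod_cast pow_succ q n
    rw [h3]
    field_simp

theorem exists_norm_invQ_le {q : ℂ} (hq : ‖q‖ < 1) : ∃ C : ℝ, 0 < C ∧ ∀ m, ‖invQ q m‖ ≤ C := by
  obtain ⟨C, hC0, hC⟩ := exists_norm_inv_qPoch_le hq (pow_mul_ne_one_of_norm_lt_one hq hq)
  refine ⟨C, hC0, fun m => ?_⟩
  unfold invQ
  split_ifs
  · exact hC _
  · simpa using hC0.le

theorem tendsto_invQ {q : ℂ} (hq : ‖q‖ < 1) (k : ℤ) :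
    Tendsto (fun n : ℕ => invQ q (n + k)) atTop (𝓝 (qPochInf q q)⁻¹) := by
  have h1 := (tendsto_qPoch q hq).inv₀ (qPochInf_self_ne_zero hq)
  have h2 : Tendsto (fun n : ℕ => ((n : ℤ) + k).toNat) atTop atTop := by
    refine tendsto_atTop.2 fun b => ?_
    filter_upwards [eventually_ge_atTop (b + k.natAbs)] with n hn
    omega
  refine (h1.comp h2).congr' ?_
  filter_upwards [eventually_ge_atTop k.natAbs] with n hn
  simp only [Function.comp, invQ]
  rw [if_pos (by omega)]

/-- The finite form of the Jacobi triple product. -/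
theorem hasSum_finite_jacobi {q x : ℂ} (hq0 : q ≠ 0) (hq : ‖q‖ < 1) (hx : x ≠ 0) (n : ℕ) :
    HasSum (fun k : ℤ => (-1) ^ k * q ^ tri k * x ^ k * (invQ q (n - k) * invQ q (n + k)))
      (qPoch x q n * qPoch (q / x) q n / qPoch q q (2 * n)) := by
  induction n with
  | zero =>
    have := hasSum_single (f := fun k : ℤ => (-1) ^ k * q ^ tri k * x ^ k *
      (invQ q ((0 : ℕ) - k) * invQ q ((0 : ℕ) + k))) 0 (fun k hk => by
        rcases lt_or_gt_of_ne hk with h | h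
        · rw [invQ_of_neg q (m := (0 : ℕ) + k) (by push_cast; omega)]; simp
        · rw [invQ_of_neg q (m := (0 : ℕ) - k) (by push_cast; omega)]; simp)
    simpa [qPoch_zero, invQ] using this
  | succ n ih =>
    -- The product gains the factor (1 - q^n x)(1 - q^(n+1)/x); its constant term, its x term and
    -- its 1/x term give the three series, the last two with the index shifted by one.
    have h1 := ih.mul_left (1 + q ^ n * q ^ n * q)
    have h2 := ((Equiv.subRight (1 : ℤ)).hasSum_iff.2 ih).mul_left (-(q ^ n * x))
    have h3 := ((Equiv.addRight (1 : ℤ)).hasSum_iff.2 ih).mul_left (-(q ^ n * q / x))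
    have hne := pow_mul_ne_one_of_norm_lt_one hq hq
    have e1 : 1 - q ^ (2 * n) * q ≠ 0 := sub_ne_zero.2 (hne _).symm
    have e2 : 1 - q ^ (2 * n + 1) * q ≠ 0 := sub_ne_zero.2 (hne _).symm
    have h4 := ((h1.add h2).add h3).mul_left ((1 - q ^ (2 * n) * q) * (1 - q ^ (2 * n + 1) * q))⁻¹
    refine h4.of_eq (fun k => ?_) ?_
    · simp only [Function.comp, Equiv.subRight_apply, Equiv.coe_addRight]
      have i1 := invQ_sub_one hq (n + 1 - k)
      have i2 := invQ_sub_one hq (n + 1 + k)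
      have i3 := invQ_sub_one hq (n + k)
      have i4 := invQ_sub_one hq (n - k)
      have hK : q ^ k ≠ 0 := zpow_ne_zero _ hq0
      have z1 : q ^ ((n : ℤ) + 1 - k) = q ^ n * q / q ^ k := by
        rw [zpow_sub₀ hq0, zpow_add₀ hq0]; simp
      have z2 : q ^ ((n : ℤ) + 1 + k) = q ^ n * q * q ^ k := by
        rw [zpow_add₀ hq0, zpow_add₀ hq0]; simp
      have z3 : q ^ ((n : ℤ) + k) = q ^ n * q ^ k := by
        rw [zpow_add₀ hq0]; simp
      have z4 : q ^ ((n : ℤ) - k) = q ^ n / q ^ k := by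
        rw [zpow_sub₀ hq0]; simp
      rw [z1, show (n : ℤ) + 1 - k - 1 = n - k by ring] at i1
      rw [z2, show (n : ℤ) + 1 + k - 1 = n + k by ring] at i2
      rw [z3, i2] at i3
      rw [z4, i1] at i4
      rw [show (n : ℤ) - (k - 1) = n + 1 - k by ring, show (n : ℤ) + (k - 1) = n + k - 1 by ring,
        show (n : ℤ) - (k + 1) = n - k - 1 by ring, show (n : ℤ) + (k + 1) = n + 1 + k by ring,
        i3, i4, i1, i2, tri_add_one, tri_sub_one, zpow_add₀ hq0 (tri k) k,
        zpow_add₀ hq0 _ 1, zpow_sub₀ hq0, zpow_sub₀ hx, zpow_add₀ hx,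
        zpow_sub₀ (by norm_num : (-1 : ℂ) ≠ 0), zpow_add₀ (by norm_num : (-1 : ℂ) ≠ 0)]
      push_cast
      simp only [zpow_one]
      generalize invQ q (n + 1 - k) = u
      generalize invQ q (n + 1 + k) = v
      generalize (-1 : ℂ) ^ k = s
      generalize x ^ k = X
      generalize q ^ tri k = T
      have hp : q ^ (2 * n) = q ^ n * q ^ n := by rw [two_mul, pow_add]
      rw [hp] at e1
      rw [pow_succ, hp] at e2
      rw [pow_succ, hp, eq_inv_mul_iff_mul_eq₀ (mul_ne_zero e1 e2)]
      clear h1 h2 h3 h4 ih i1 i2 i3 i4 z1 z2 z3 z4 hp e1 e2 hne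
      generalize q ^ n = N
      generalize q ^ k = K at *
      field_simp
      ring
    · rw [qPoch_succ, qPoch_succ, show 2 * (n + 1) = 2 * n + 1 + 1 by ring, qPoch_succ, qPoch_succ]
      have := qPoch_ne_zero hne (2 * n)
      field_simp
      ring

/-! ### The theta function -/

/-- **Jacobi triple product identity.** -/
theorem hasSum_jTheta {q x : ℂ} (hq0 : q ≠ 0) (hq : ‖q‖ < 1) (hx : x ≠ 0) :
    HasSum (fun k : ℤ => (-1) ^ k * q ^ tri k * x ^ k) (jTheta x q) := by
  obtain ⟨C, hC0, hC⟩ := exists_norm_invQ_le hq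
  have hs := summable_norm_zpow_mul_zpow_tri hq0 hq hx
  have hE := qPochInf_self_ne_zero hq
  have hsum : Summable fun k : ℤ => (-1) ^ k * q ^ tri k * x ^ k := by
    refine Summable.of_norm (hs.congr fun k => ?_)
    simp [norm_zpow, mul_comm]
  -- Tannery's theorem: the factors `invQ` are uniformly bounded and tend to 1/(q;q)_∞, while the
  -- theta series converges absolutely.
  have h1 : Tendsto (fun n : ℕ => ∑' k : ℤ, (-1) ^ k * q ^ tri k * x ^ k *
      (invQ q (n - k) * invQ q (n + k))) atTop
      (𝓝 (∑' k : ℤ, (-1) ^ k * q ^ tri k * x ^ k * ((qPochInf q q)⁻¹ * (qPochInf q q)⁻¹))) := by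
    refine tendsto_tsum_of_dominated_convergence (hs.mul_right (C * C)) (fun k => ?_)
      (Eventually.of_forall fun n k => ?_)
    · simp_rw [sub_eq_add_neg]
      exact ((tendsto_invQ hq (-k)).mul (tendsto_invQ hq k)).const_mul _
    · rw [norm_mul, norm_mul (invQ q _)]
      refine mul_le_mul (le_of_eq ?_) (mul_le_mul (hC _) (hC _) (norm_nonneg _) hC0.le)
        (by positivity) (by positivity)
      simp [norm_zpow, mul_comm]
  simp_rw [(hasSum_finite_jacobi hq0 hq hx _).tsum_eq] at h1
  have h2 : Tendsto (fun n : ℕ => qPoch q q (2 * n)) atTop (𝓝 (qPochInf q q)) :=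
    (tendsto_qPoch q hq).comp (tendsto_id.const_mul_atTop' (by norm_num))
  have h3 := ((tendsto_qPoch x hq).mul (tendsto_qPoch (q / x) hq)).div h2 hE
  have h4 := tendsto_nhds_unique h1 h3
  rw [tsum_mul_right] at h4
  refine hsum.hasSum.of_eq (fun k => rfl) ?_
  rw [jTheta]
  field_simp at h4
  linear_combination -h4

theorem jTheta_mul_left {q x : ℂ} (hq0 : q ≠ 0) (hq : ‖q‖ < 1) (hx : x ≠ 0) :
    jTheta (q * x) q = -x⁻¹ * jTheta x q := by
  have h1 := (Equiv.addRight (1 : ℤ)).hasSum_iff.2 (hasSum_jTheta hq0 hq hx)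
  refine (hasSum_jTheta hq0 hq (mul_ne_zero hq0 hx)).unique ((h1.mul_left (-x⁻¹)).of_eq (fun k => ?_) rfl)
  simp only [Function.comp, Equiv.coe_addRight]
  rw [tri_add_one, zpow_add₀ hq0, zpow_add₀ hx, zpow_add₀ (by norm_num), mul_zpow]
  field_simp

theorem jTheta_div {q : ℂ} (hq0 : q ≠ 0) (x : ℂ) : jTheta (q / x) q = jTheta x q := by
  rw [jTheta, jTheta, div_div_cancel₀ hq0, mul_comm (qPochInf x q)]

theorem jTheta_inv {q x : ℂ} (hq0 : q ≠ 0) (hq : ‖q‖ < 1) (hx : x ≠ 0) :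
    jTheta x⁻¹ q = -x⁻¹ * jTheta x q := by
  have := jTheta_mul_left hq0 hq (inv_ne_zero hx)
  rw [← div_eq_mul_inv, jTheta_div hq0, inv_inv] at this
  rw [this]
  field_simp

/-- `jTheta x q` with the factor `1 - x` removed. -/
def jReg (x q : ℂ) : ℂ := qPochInf (q * x) q * qPochInf (q / x) q * qPochInf q q

theorem jTheta_eq_mul_jReg (x : ℂ) {q : ℂ} (hq : ‖q‖ < 1) :
    jTheta x q = (1 - x) * jReg x q := by
  rw [jTheta, jReg, qPochInf_eq_mul x hq]; ring

theorem jTheta_one {q : ℂ} (hq : ‖q‖ < 1) : jTheta 1 q = 0 := by simp [jTheta_eq_mul_jReg 1 hq]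

theorem jReg_one (q : ℂ) : jReg 1 q = qPochInf q q ^ 3 := by simp [jReg]; ring

theorem jReg_inv (x q : ℂ) : jReg x⁻¹ q = jReg x q := by
  simp only [jReg, div_eq_mul_inv, inv_inv]; ring

theorem jTheta_ne_zero {q x : ℂ} (hq0 : q ≠ 0) (hq : ‖q‖ < 1) (hx : x ≠ 0)
    (h : ∀ n : ℤ, x * q ^ n ≠ 1) : jTheta x q ≠ 0 := by
  refine mul_ne_zero (mul_ne_zero (qPochInf_ne_zero hq fun i => ?_)
    (qPochInf_ne_zero hq fun i hi => ?_)) (qPochInf_self_ne_zero hq)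
  · simpa [mul_comm] using h i
  · refine h (-(i + 1)) ?_
    rw [zpow_neg]
    have : q ^ ((i : ℤ) + 1) = x := by
      rw [zpow_add₀ hq0]
      field_simp at hi
      simpa using hi
    rw [this, mul_inv_cancel₀ hx]

theorem differentiable_qPochInf {q : ℂ} (hq : ‖q‖ < 1) : Differentiable ℂ fun x => qPochInf x q := by
  intro x
  have hU : IsOpen (Metric.ball (0 : ℂ) (‖x‖ + 1)) := Metric.isOpen_ball
  have hu : Summable fun i : ℕ => ‖q‖ ^ i * (‖x‖ + 1) :=
    (summable_geometric_of_lt_one (norm_nonneg q) hq).mul_right _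
  have h := Summable.hasProdLocallyUniformlyOn_nat_one_add (f := fun (i : ℕ) (x : ℂ) => -(q ^ i * x))
    hU hu (Eventually.of_forall fun n y hy => by
      rw [norm_neg, norm_mul, norm_pow]
      have := mem_ball_zero_iff.1 hy
      gcongr) (fun n => by fun_prop)
  have h2 := h.differentiableOn (Eventually.of_forall fun s => by fun_prop) hU
  have h3 := h2.differentiableAt (x := x) (hU.mem_nhds (by simp))
  refine h3.congr_of_eventuallyEq (Eventually.of_forall fun y => ?_)
  simp [qPochInf, sub_eq_add_neg]

theorem differentiableAt_jReg {q x : ℂ} (hq : ‖q‖ < 1) (hx : x ≠ 0) :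
    DifferentiableAt ℂ (fun x => jReg x q) x := by
  have h := differentiable_qPochInf hq
  unfold jReg
  refine DifferentiableAt.mul (DifferentiableAt.mul ?_ ?_) (by fun_prop)
  · exact (h (q * x)).comp x (by fun_prop)
  · exact (h (q / x)).comp x (by fun_prop (disch := assumption))

theorem differentiableAt_jTheta {q x : ℂ} (hq : ‖q‖ < 1) (hx : x ≠ 0) :
    DifferentiableAt ℂ (fun x => jTheta x q) x := by
  have h := differentiableAt_jReg hq hx
  simp_rw [jTheta_eq_mul_jReg _ hq]
  fun_prop

/-! ### Products of two theta functions -/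

theorem neg_one_zpow_mul_self (k : ℤ) : (-1 : ℂ) ^ k * (-1) ^ k = 1 := by
  rw [← mul_zpow]; simp

/-- A product of two sums over the integers, rearranged along the lattice direction
`(m - c, 1)` and the residues modulo `m`. -/
theorem tsum_mul_tsum_int {f g : ℤ → ℂ} (hf : Summable f) (hg : Summable g)
    (m : ℕ) [NeZero m] (c : ℤ) :
    (∑' n, f n) * (∑' n, g n) =
      ∑ i : Fin m, ∑' k : ℤ, ∑' n : ℤ, f (m * k + i - c * (n + k)) * g (n + k) := by
  rw [tsum_mul_tsum_of_summable_norm hf.norm hg.norm]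
  let e : ℤ × ℤ ≃ ℤ × ℤ :=
    { toFun := fun p => (p.1 - c * p.2, p.2)
      invFun := fun p => (p.1 + c * p.2, p.2)
      left_inv := fun p => by simp
      right_inv := fun p => by simp }
  have hs : Summable fun p : ℤ × ℤ => f (p.1 - c * p.2) * g p.2 :=
    e.summable_iff.2 (summable_mul_of_summable_norm hf.norm hg.norm)
  rw [← e.tsum_eq]
  change ∑' p : ℤ × ℤ, f (p.1 - c * p.2) * g p.2 = _
  rw [hs.tsum_prod' (fun i => hs.prod_factor i), tsum_int_eq_sum_residues hs.prod m 0]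
  refine Finset.sum_congr rfl fun i _ => tsum_congr fun k => ?_
  rw [← (Equiv.addRight k).tsum_eq]
  simp

theorem pow_zpow (q : ℂ) (m : ℕ) (k : ℤ) : (q ^ m) ^ k = q ^ ((m : ℤ) * k) := by
  rw [zpow_mul, zpow_natCast]

/-- Multiply the two theta series and split the pairs of indices by the parity of their sum. In the
new indices the x and y dependence separates, and the even and odd classes carry the same two
functions with the roles of x and y exchanged. The left side is thus a 2 × 2 determinant. -/
theorem exists_jTheta_mul_jTheta {q : ℂ} (hq0 : q ≠ 0) (hq : ‖q‖ < 1) :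
    ∃ p r : ℂ → ℂ, ∀ x y : ℂ, x ≠ 0 → y ≠ 0 →
      y * (jTheta (x * y) q * jTheta (x / y) q) = p x * r y - r x * p y := by
  refine ⟨fun x => ∑' s : ℤ, q ^ (2 * tri s) * x ^ (2 * s),
    fun y => y * ∑' d : ℤ, q ^ (2 * tri d + d) * y ^ (2 * d), fun x y hx hy => ?_⟩
  have h1 := hasSum_jTheta hq0 hq (mul_ne_zero hx hy)
  have h2 := hasSum_jTheta hq0 hq (div_ne_zero hx hy)
  rw [← h1.tsum_eq, ← h2.tsum_eq, tsum_mul_tsum_int h1.summable h2.summable 2 1]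
  simp only [Fin.sum_univ_two, Fin.val_zero, Fin.val_one]
  have hm : (-1 : ℂ) ≠ 0 := by norm_num
  have e0 : ∀ k n : ℤ, (-1) ^ ((2 : ℕ) * k + (0 : ℕ) - 1 * (n + k)) *
      q ^ tri ((2 : ℕ) * k + (0 : ℕ) - 1 * (n + k)) *
      (x * y) ^ ((2 : ℕ) * k + (0 : ℕ) - 1 * (n + k)) *
      ((-1) ^ (n + k) * q ^ tri (n + k) * (x / y) ^ (n + k)) =
      (q ^ (2 * tri k) * x ^ (2 * k)) * (q ^ (2 * tri (-n) + -n) * y ^ (2 * -n)) := by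
    intro k n
    have t1 : tri ((2 : ℕ) * k + (0 : ℕ) - 1 * (n + k)) + tri (n + k) =
        2 * tri k + (2 * tri (-n) + -n) := by
      have : ((2 : ℕ) * k + (0 : ℕ) - 1 * (n + k)) = k + -n := by push_cast; ring
      rw [this, tri_add, tri_add, tri_neg]; ring
    rw [show ((2 : ℕ) * k + (0 : ℕ) - 1 * (n + k)) = k + -n by push_cast; ring] at t1 ⊢
    have t2 : q ^ tri (k + -n) * q ^ tri (n + k) =
        q ^ (2 * tri k) * q ^ (2 * tri (-n) + -n) := by
      rw [← zpow_add₀ hq0, t1, zpow_add₀ hq0]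
    have t3 : (-1 : ℂ) ^ (k + -n) * (-1) ^ (n + k) = 1 := by
      rw [← zpow_add₀ hm, show k + -n + (n + k) = k + k by ring, zpow_add₀ hm,
        neg_one_zpow_mul_self]
    have t4 : (x * y) ^ (k + -n) * (x / y) ^ (n + k) = x ^ (2 * k) * y ^ (2 * -n) := by
      rw [mul_zpow, div_zpow, zpow_add₀ hx, zpow_add₀ hx, zpow_add₀ hy, zpow_add₀ hy, two_mul,
        two_mul, zpow_add₀ hx, zpow_add₀ hy, zpow_neg, zpow_neg]
      field_simp
    linear_combination (q ^ tri (k + -n) * q ^ tri (n + k)) *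
      ((x * y) ^ (k + -n) * (x / y) ^ (n + k)) * t3 +
      ((x * y) ^ (k + -n) * (x / y) ^ (n + k)) * t2 +
      (q ^ (2 * tri k) * q ^ (2 * tri (-n) + -n)) * t4
  have e1 : ∀ k n : ℤ, (-1) ^ ((2 : ℕ) * k + (1 : ℕ) - 1 * (n + k)) *
      q ^ tri ((2 : ℕ) * k + (1 : ℕ) - 1 * (n + k)) *
      (x * y) ^ ((2 : ℕ) * k + (1 : ℕ) - 1 * (n + k)) *
      ((-1) ^ (n + k) * q ^ tri (n + k) * (x / y) ^ (n + k)) =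
      (q ^ (2 * tri k + k) * x ^ (2 * k)) *
        (-(x / y) * (q ^ (2 * tri (1 - n)) * y ^ (2 * (1 - n)))) := by
    intro k n
    have t1 : tri (k + (1 - n)) + tri (n + k) =
        2 * tri k + k + 2 * tri (1 - n) := by
      have := tri_neg (n - 1)
      rw [neg_sub] at this
      rw [tri_add, tri_add, this, tri_sub_one]; ring
    rw [show ((2 : ℕ) * k + (1 : ℕ) - 1 * (n + k)) = k + (1 - n) by push_cast; ring]
    have t2 : q ^ tri (k + (1 - n)) * q ^ tri (n + k) =
        q ^ (2 * tri k + k) * q ^ (2 * tri (1 - n)) := by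
      rw [← zpow_add₀ hq0, t1, zpow_add₀ hq0]
    have t3 : (-1 : ℂ) ^ (k + (1 - n)) * (-1) ^ (n + k) = -1 := by
      rw [← zpow_add₀ hm, show k + (1 - n) + (n + k) = k + k + 1 by ring, zpow_add₀ hm,
        zpow_add₀ hm, neg_one_zpow_mul_self]
      simp
    have t4 : (x * y) ^ (k + (1 - n)) * (x / y) ^ (n + k) =
        x ^ (2 * k) * (x / y * y ^ (2 * (1 - n))) := by
      rw [mul_zpow, div_zpow, zpow_add₀ hx, zpow_add₀ hx, zpow_add₀ hy, zpow_add₀ hy, two_mul,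
        two_mul, zpow_add₀ hx, zpow_add₀ hy, zpow_sub₀ hx, zpow_sub₀ hy]
      simp only [zpow_one]
      field_simp
    linear_combination (q ^ tri (k + (1 - n)) * q ^ tri (n + k)) *
      ((x * y) ^ (k + (1 - n)) * (x / y) ^ (n + k)) * t3 -
      ((x * y) ^ (k + (1 - n)) * (x / y) ^ (n + k)) * t2 -
      (q ^ (2 * tri k + k) * q ^ (2 * tri (1 - n))) * t4
  simp_rw [e0, e1, tsum_mul_left, tsum_mul_right]
  have n0 := (Equiv.neg ℤ).tsum_eq (fun n => q ^ (2 * tri n + n) * y ^ (2 * n))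
  have n1 := (Equiv.subLeft (1 : ℤ)).tsum_eq (fun n => q ^ (2 * tri n) * y ^ (2 * n))
  simp only [Equiv.neg_apply, Equiv.subLeft_apply] at n0 n1
  rw [n0, n1]
  field_simp
  ring

/-- **Weierstrass' three-term relation** for theta functions. -/
theorem jTheta_three_term {q : ℂ} (hq0 : q ≠ 0) (hq : ‖q‖ < 1) {x y u v : ℂ}
    (hx : x ≠ 0) (hy : y ≠ 0) (hu : u ≠ 0) (hv : v ≠ 0) :
    y * (jTheta (x * y) q * jTheta (x / y) q) * (v * (jTheta (u * v) q * jTheta (u / v) q))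
      - u * (jTheta (x * u) q * jTheta (x / u) q) * (v * (jTheta (y * v) q * jTheta (y / v) q))
      + v * (jTheta (x * v) q * jTheta (x / v) q) * (u * (jTheta (y * u) q * jTheta (y / u) q))
      = 0 := by
  -- All six brackets are 2 × 2 minors of the vectors (p, r) at x, y, u, v, so the relation is
  -- Plücker's.
  obtain ⟨p, r, h⟩ := exists_jTheta_mul_jTheta hq0 hq
  rw [h x y hx hy, h u v hu hv, h x u hx hu, h y v hy hv, h x v hx hv, h y u hy hu]
  ring

/-- The relation between the theta functions of level `7`. -/
theorem jTheta_klein {t : ℂ} (ht0 : t ≠ 0) (ht : ‖t‖ < 1) :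
    jTheta (t ^ 2) (t ^ 7) ^ 3 * jTheta (t ^ 3) (t ^ 7) =
      jTheta t (t ^ 7) * jTheta (t ^ 3) (t ^ 7) ^ 3
        + t * jTheta t (t ^ 7) ^ 3 * jTheta (t ^ 2) (t ^ 7) := by
  have hQ0 : t ^ 7 ≠ 0 := pow_ne_zero _ ht0
  have hQ : ‖t ^ 7‖ < 1 := by
    rw [norm_pow]; exact pow_lt_one₀ (norm_nonneg _) ht (by norm_num)
  -- At the points t, t², t³, 1 the arguments are powers of t, and t⁴, t⁵ fold back to t³, t² under
  -- x ↦ t⁷/x.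
  have h := jTheta_three_term hQ0 hQ ht0 (pow_ne_zero 2 ht0) (pow_ne_zero 3 ht0) one_ne_zero
  simp only [mul_one, div_one] at h
  have e1 : t / t ^ 2 = t⁻¹ := by field_simp
  have e2 : t / t ^ 3 = (t ^ 2)⁻¹ := by field_simp
  have e3 : t ^ 2 / t ^ 3 = t⁻¹ := by field_simp
  have e4 : t * t ^ 3 = t ^ 7 / t ^ 3 := by field_simp
  have e5 : t ^ 2 * t ^ 3 = t ^ 7 / t ^ 2 := by field_simp
  rw [e1, e2, e3, e4, e5, jTheta_div hQ0, jTheta_div hQ0, jTheta_inv hQ0 hQ ht0,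
    jTheta_inv hQ0 hQ (pow_ne_zero 2 ht0), show t * t ^ 2 = t ^ 3 by ring] at h
  field_simp at h
  linear_combination (mul_eq_zero.1 h).resolve_left ht0

/-! ### The logarithmic derivative -/

/-- The logarithmic derivative `x j'(x; q) / j(x; q)`. -/
def jLog (x q : ℂ) : ℂ := x * deriv (fun x => jTheta x q) x / jTheta x q

theorem hasDerivAt_jTheta {q x : ℂ} (hq : ‖q‖ < 1) (hx : x ≠ 0) (h : jTheta x q ≠ 0) :
    HasDerivAt (fun x => jTheta x q) (jLog x q * jTheta x q / x) x := by
  refine (differentiableAt_jTheta hq hx).hasDerivAt.congr_deriv ?_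
  rw [jLog]
  field_simp

theorem jLog_eq_of_hasDerivAt {q x d : ℂ} (hd : HasDerivAt (fun x => jTheta x q) d x) :
    jLog x q = x * d / jTheta x q := by
  rw [jLog, hd.deriv]

theorem jLog_div {q x : ℂ} (hq0 : q ≠ 0) (hq : ‖q‖ < 1) (hx : x ≠ 0) (h : jTheta x q ≠ 0) :
    jLog (q / x) q = -jLog x q := by
  have hx' : q / x ≠ 0 := div_ne_zero hq0 hx
  have hqx : q / (q / x) = x := div_div_cancel₀ hq0
  have h1 : HasDerivAt (fun z => q / z) (q * -((q / x) ^ 2)⁻¹) (q / x) := by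
    simpa [div_eq_mul_inv] using (hasDerivAt_inv hx').const_mul q
  have h2 : HasDerivAt (fun x => jTheta x q) (jLog x q * jTheta x q / x) (q / (q / x)) := by
    rw [hqx]; exact hasDerivAt_jTheta hq hx h
  have h3 := h2.comp (q / x) h1
  have h4 : HasDerivAt (fun x => jTheta x q) _ (q / x) :=
    h3.congr_of_eventuallyEq (Eventually.of_forall fun z => (jTheta_div hq0 z).symm)
  rw [jLog_eq_of_hasDerivAt h4, jTheta_div hq0]
  field_simp

theorem jLog_mul_left {q x : ℂ} (hq0 : q ≠ 0) (hq : ‖q‖ < 1) (hx : x ≠ 0)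
    (h : jTheta x q ≠ 0) : jLog (q * x) q = jLog x q - 1 := by
  have hx' : q * x ≠ 0 := mul_ne_zero hq0 hx
  have hqx : q⁻¹ * (q * x) = x := by field_simp
  have h1 : HasDerivAt (fun z => q⁻¹ * z) q⁻¹ (q * x) := by
    simpa using (hasDerivAt_id (q * x)).const_mul q⁻¹
  have h2 : HasDerivAt (fun x => jTheta x q) (jLog x q * jTheta x q / x) (q⁻¹ * (q * x)) := by
    rw [hqx]; exact hasDerivAt_jTheta hq hx h
  have h3 := (((hasDerivAt_inv hx').const_mul (-q)).mul (h2.comp (q * x) h1))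
  have h4 := h3.congr_of_eventuallyEq (f₁ := fun x => jTheta x q) (by
    filter_upwards [isOpen_ne.mem_nhds hx'] with z hz
    have hz' : q⁻¹ * z ≠ 0 := mul_ne_zero (inv_ne_zero hq0) hz
    have := jTheta_mul_left hq0 hq hz'
    rw [show q * (q⁻¹ * z) = z by field_simp] at this
    simp only [Pi.mul_apply, Function.comp]
    rw [this]
    field_simp)
  rw [jLog_eq_of_hasDerivAt h4, jTheta_mul_left hq0 hq hx]
  simp only [Function.comp, hqx]
  field_simp
  ring

theorem jLog_inv {q x : ℂ} (hq0 : q ≠ 0) (hq : ‖q‖ < 1) (hx : x ≠ 0)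
    (h : jTheta x q ≠ 0) : jLog x⁻¹ q = 1 - jLog x q := by
  have hi : jTheta x⁻¹ q ≠ 0 := by
    rw [jTheta_inv hq0 hq hx]; exact mul_ne_zero (neg_ne_zero.2 (inv_ne_zero hx)) h
  have := jLog_mul_left hq0 hq (inv_ne_zero hx) hi
  rw [← div_eq_mul_inv, jLog_div hq0 hq hx h] at this
  linear_combination -this

theorem hasDerivAt_jTheta_one {q : ℂ} (hq : ‖q‖ < 1) :
    HasDerivAt (fun x => jTheta x q) (-qPochInf q q ^ 3) 1 := by
  have h1 : HasDerivAt (fun x : ℂ => 1 - x) (-1) 1 := by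
    simpa using (hasDerivAt_id (1 : ℂ)).const_sub 1
  have h2 := h1.mul (differentiableAt_jReg hq (one_ne_zero)).hasDerivAt
  simp only [sub_self, zero_mul, add_zero, jReg_one, neg_one_mul] at h2
  exact h2.congr_of_eventuallyEq (Eventually.of_forall fun x => jTheta_eq_mul_jReg x hq)

theorem hasDerivAt_jTheta_mul_div {q x c : ℂ} (hq : ‖q‖ < 1) (hx : x ≠ 0) (hc : c ≠ 0)
    (h1 : jTheta (x * c) q ≠ 0) (h2 : jTheta (x / c) q ≠ 0) :
    HasDerivAt (fun x => jTheta (x * c) q * jTheta (x / c) q)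
      ((jLog (x * c) q + jLog (x / c) q) / x * (jTheta (x * c) q * jTheta (x / c) q)) x := by
  have d1 := (hasDerivAt_jTheta hq (mul_ne_zero hx hc) h1).comp x
    ((hasDerivAt_id x).mul_const c)
  have d2 := (hasDerivAt_jTheta hq (div_ne_zero hx hc) h2).comp x
    ((hasDerivAt_id x).div_const c)
  refine (d1.mul d2).congr_deriv ?_
  simp only [Function.comp, id]
  field_simp

/-- The infinitesimal form of the three-term relation. -/
theorem jLog_three_term {q : ℂ} (hq0 : q ≠ 0) (hq : ‖q‖ < 1) {x u v : ℂ}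
    (hx : x ≠ 0) (hu : u ≠ 0) (hv : v ≠ 0)
    (h1 : jTheta (x * u) q ≠ 0) (h2 : jTheta (x / u) q ≠ 0)
    (h3 : jTheta (x * v) q ≠ 0) (h4 : jTheta (x / v) q ≠ 0) :
    u * (jTheta (x * u) q * jTheta (x / u) q) * (jTheta (x * v) q * jTheta (x / v) q) *
      (jLog (x * u) q + jLog (x / u) q - jLog (x * v) q - jLog (x / v) q) =
    -x * (jTheta (x * x) q * qPochInf q q ^ 3 * (jTheta (u * v) q * jTheta (u / v) q)) := by
  -- At z = x the second factor vanishes, so only its derivative, known from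
  -- `hasDerivAt_jTheta_one`, survives.
  have d0 : HasDerivAt (fun z => jTheta (z * x) q * jTheta (z / x) q)
      (jTheta (x * x) q * (-qPochInf q q ^ 3 / x)) x := by
    have e2 : HasDerivAt (fun z => jTheta (z / x) q) (-qPochInf q q ^ 3 * (1 / x)) x :=
      HasDerivAt.comp x (h₂ := fun x => jTheta x q) (h := fun z => z / x)
        (by simpa [hx] using hasDerivAt_jTheta_one hq) ((hasDerivAt_id x).div_const x)
    have e3 : DifferentiableAt ℂ (fun z => jTheta (z * x) q) x :=
      DifferentiableAt.comp x (g := fun x => jTheta x q) (f := fun z => z * x)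
        (differentiableAt_jTheta hq (mul_ne_zero hx hx)) (by fun_prop)
    refine (e3.hasDerivAt.mul e2).congr_deriv ?_
    simp only [div_self hx, jTheta_one hq]
    ring
  have d1 := hasDerivAt_jTheta_mul_div hq hx hu h1 h2
  have d2 := hasDerivAt_jTheta_mul_div hq hx hv h3 h4
  have d := (((d0.const_mul x).mul_const (v * (jTheta (u * v) q * jTheta (u / v) q))).sub
    ((d1.const_mul u).mul_const (v * (jTheta (x * v) q * jTheta (x / v) q)))).add
    ((d2.const_mul v).mul_const (u * (jTheta (x * u) q * jTheta (x / u) q)))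
  -- The three-term relation at (z, x, u, v) holds for every z ≠ 0; differentiate it at z = x.
  have hz : HasDerivAt (fun _ : ℂ => (0 : ℂ)) _ x := d.congr_of_eventuallyEq (by
    filter_upwards [isOpen_ne.mem_nhds hx] with z hz
    exact (jTheta_three_term hq0 hq hz hx hu hv).symm)
  have h0 := hz.unique (hasDerivAt_const x (0 : ℂ))
  generalize jTheta (x * x) q = A, jTheta (u * v) q = B, jTheta (x * u) q = C,
    jTheta (x * v) q = D at h0 ⊢
  field_simp at h0
  rw [mul_zero] at h0
  linear_combination -(mul_eq_zero.1 h0).resolve_left hv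

/-- The infinitesimal three-term relation at x = z, u = z³, v = 1, where the four arguments are z⁴,
z⁻², z, z; the factor j(z²) occurs on both sides and cancels. At powers of y it evaluates
combinations of logarithmic derivatives as theta quotients. -/
theorem jLog_quartic {q z : ℂ} (hq0 : q ≠ 0) (hq : ‖q‖ < 1) (hz : z ≠ 0)
    (h1 : jTheta z q ≠ 0) (h2 : jTheta (z ^ 2) q ≠ 0) (h4 : jTheta (z ^ 4) q ≠ 0) :
    jLog (z ^ 4) q + 1 - jLog (z ^ 2) q - 2 * jLog z q =
      qPochInf q q ^ 3 * jTheta (z ^ 3) q ^ 2 / (jTheta z q ^ 2 * jTheta (z ^ 4) q) := by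
  have e1 : z * z ^ 3 = z ^ 4 := by ring
  have e2 : z / z ^ 3 = (z ^ 2)⁻¹ := by field_simp
  have h2' : jTheta (z / z ^ 3) q ≠ 0 := by
    rw [e2, jTheta_inv hq0 hq (pow_ne_zero 2 hz)]
    exact mul_ne_zero (neg_ne_zero.2 (inv_ne_zero (pow_ne_zero 2 hz))) h2
  have h := jLog_three_term hq0 hq hz (pow_ne_zero 3 hz) one_ne_zero (by rwa [e1]) h2'
    (by rwa [mul_one]) (by rwa [div_one])
  rw [e1, e2, mul_one, div_one, mul_one, div_one, jTheta_inv hq0 hq (pow_ne_zero 2 hz),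
    jLog_inv hq0 hq (pow_ne_zero 2 hz) h2, ← pow_two z] at h
  rw [eq_div_iff (mul_ne_zero (pow_ne_zero 2 h1) h4)]
  field_simp at h
  linear_combination -h

/-! ### The quintuple product -/

theorem qPochInf_eq_prod_residues (x : ℂ) {p : ℂ} (hp : ‖p‖ < 1) (m : ℕ) [NeZero m] :
    qPochInf x p = ∏ i ∈ Finset.range m, qPochInf (p ^ i * x) (p ^ m) := by
  have hpm : ‖p ^ m‖ < 1 := by
    rw [norm_pow]; exact pow_lt_one₀ (norm_nonneg _) hp (NeZero.ne m)
  have hmul := multipliable_qPochInf x p hp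
  have hmul' : Multipliable fun n : ℕ × Fin m => 1 - p ^ ((Nat.divModEquiv m).symm n) * x :=
    (Nat.divModEquiv m).symm.multipliable_iff.2 hmul
  rw [Finset.prod_range]
  unfold qPochInf
  rw [← (Nat.divModEquiv m).symm.tprod_eq (fun i : ℕ => 1 - p ^ i * x),
    hmul'.tprod_prod' (fun b => Multipliable.of_finite),
    ← Multipliable.tprod_finsetProd fun i _ => multipliable_qPochInf _ _ hpm]
  refine tprod_congr fun n => ?_
  rw [tprod_fintype]
  refine Finset.prod_congr rfl fun i _ => ?_
  simp [Nat.divModEquiv, pow_add, pow_mul]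
  ring

theorem qPochInf_mul_neg (x : ℂ) {q : ℂ} (hq : ‖q‖ < 1) :
    qPochInf x q * qPochInf (-x) q = qPochInf (x ^ 2) (q ^ 2) := by
  unfold qPochInf
  rw [← Multipliable.tprod_mul (multipliable_qPochInf _ _ hq) (multipliable_qPochInf _ _ hq)]
  exact tprod_congr fun n => by ring

theorem jTheta_self_cube {q : ℂ} (hq0 : q ≠ 0) (hq : ‖q‖ < 1) :
    jTheta q (q ^ 3) = qPochInf q q := by
  simpa [J₁, J₂] using (J₁_eq_J₂ 1 one_pos q hq0 hq).symm

theorem norm_pow_lt_one {q : ℂ} (hq : ‖q‖ < 1) {m : ℕ} (hm : m ≠ 0) : ‖q ^ m‖ < 1 := by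
  rw [norm_pow]; exact pow_lt_one₀ (norm_nonneg _) hq hm

/-- In the double series on the left, a change of lattice indices modulo 3 makes the exponent of z
depend on the outer index only. The inner sums are then constants: for the residues 0 and 1 both
equal the pentagonal series in q², for the residue 2 the sum is zero. -/
theorem jTheta_neg_mul_jTheta {q z : ℂ} (hq0 : q ≠ 0) (hq : ‖q‖ < 1) (hz : z ≠ 0) :
    jTheta (-z) q * jTheta (q * z ^ 2) (q ^ 2) = qPochInf (q ^ 2) (q ^ 2) *
      (jTheta (q * z ^ 3) (q ^ 3) + z * jTheta (q * (z ^ 3)⁻¹) (q ^ 3)) := by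
  have hm : (-1 : ℂ) ≠ 0 := by norm_num
  have hz3 : z ^ 3 ≠ 0 := pow_ne_zero 3 hz
  have h1 := hasSum_jTheta hq0 hq (neg_ne_zero.2 hz)
  have h2 := hasSum_jTheta (pow_ne_zero 2 hq0) (norm_pow_lt_one hq two_ne_zero)
    (mul_ne_zero hq0 (pow_ne_zero 2 hz))
  have h3 := hasSum_jTheta (pow_ne_zero 3 hq0) (norm_pow_lt_one hq three_ne_zero)
    (mul_ne_zero hq0 hz3)
  have h4 := hasSum_jTheta (pow_ne_zero 3 hq0) (norm_pow_lt_one hq three_ne_zero)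
    (mul_ne_zero hq0 (inv_ne_zero hz3))
  have h5 := hasSum_jTheta (pow_ne_zero 3 (pow_ne_zero 2 hq0))
    (norm_pow_lt_one (norm_pow_lt_one hq two_ne_zero) three_ne_zero) (pow_ne_zero 2 hq0)
  rw [jTheta_self_cube (pow_ne_zero 2 hq0) (norm_pow_lt_one hq two_ne_zero)] at h5
  rw [← h1.tsum_eq, ← h2.tsum_eq, tsum_mul_tsum_int h1.summable h2.summable 3 2]
  simp only [Fin.sum_univ_three, Fin.val_zero, Fin.val_one, Fin.val_two]
  have key : ∀ i k n : ℤ, (-1) ^ (3 * k + i - 2 * (n + k)) * q ^ tri (3 * k + i - 2 * (n + k)) *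
      (-z) ^ (3 * k + i - 2 * (n + k)) *
      ((-1) ^ (n + k) * (q ^ 2) ^ tri (n + k) * (q * z ^ 2) ^ (n + k)) =
      ((-1) ^ k * q ^ (3 * tri k + k + k * i + tri i) * z ^ (3 * k + i)) *
        ((-1) ^ n * q ^ (6 * tri n + 4 * n - 2 * n * i)) := by
    intro i k n
    have t1 : tri (3 * k + i - 2 * (n + k)) + 2 * tri (n + k) + (n + k) =
        (3 * tri k + k + k * i + tri i) + (6 * tri n + 4 * n - 2 * n * i) := by
      have a1 : 3 * k + i - 2 * (n + k) = k + (i + (-n + -n)) := by ring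
      have a2 := two_mul_tri n
      have a3 := two_mul_tri k
      rw [a1, tri_add, tri_add, tri_add, tri_add n k, tri_neg]
      linear_combination -a2
    have t2 : q ^ tri (3 * k + i - 2 * (n + k)) * (q ^ 2) ^ tri (n + k) * q ^ (n + k) =
        q ^ (3 * tri k + k + k * i + tri i) * q ^ (6 * tri n + 4 * n - 2 * n * i) := by
      rw [pow_zpow, Nat.cast_ofNat, ← zpow_add₀ hq0, ← zpow_add₀ hq0, t1, zpow_add₀ hq0]
    have t3 : z ^ (3 * k + i - 2 * (n + k)) * (z ^ 2) ^ (n + k) = z ^ (3 * k + i) := by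
      rw [show z ^ 2 = z ^ (2 : ℤ) by norm_cast, ← zpow_mul, ← zpow_add₀ hz]
      congr 1; ring
    rw [neg_eq_neg_one_mul z, mul_zpow (-1) z, mul_zpow q, zpow_add₀ hm n k]
    have t4 := neg_one_zpow_mul_self (3 * k + i - 2 * (n + k))
    linear_combination
      (q ^ tri (3 * k + i - 2 * (n + k)) * (q ^ 2) ^ tri (n + k) * q ^ (n + k)) *
        (z ^ (3 * k + i - 2 * (n + k)) * (z ^ 2) ^ (n + k)) * (-1) ^ n * (-1) ^ k * t4
      + (z ^ (3 * k + i - 2 * (n + k)) * (z ^ 2) ^ (n + k)) * (-1) ^ n * (-1) ^ k * t2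
      + (q ^ (3 * tri k + k + k * i + tri i) * q ^ (6 * tri n + 4 * n - 2 * n * i)) *
        (-1) ^ n * (-1) ^ k * t3
  have c1 : ∑' n : ℤ, (-1) ^ n * q ^ (6 * tri n + 4 * n - 2 * n * 1) =
      qPochInf (q ^ 2) (q ^ 2) := by
    rw [← h5.tsum_eq]
    refine tsum_congr fun n => ?_
    rw [← pow_mul, pow_zpow, pow_zpow, mul_assoc ((-1 : ℂ) ^ n), ← zpow_add₀ hq0]
    congr 2; push_cast; ring
  have c0 : ∑' n : ℤ, (-1) ^ n * q ^ (6 * tri n + 4 * n - 2 * n * 0) =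
      qPochInf (q ^ 2) (q ^ 2) := by
    rw [← c1, ← (Equiv.neg ℤ).tsum_eq]
    refine tsum_congr fun n => ?_
    rw [Equiv.neg_apply, tri_neg, zpow_neg, ← inv_zpow]
    congr 2
    · norm_num
    · ring
  -- The reflection n ↦ 1 - n preserves `tri n` and reverses the sign.
  have c2 : ∑' n : ℤ, (-1) ^ n * q ^ (6 * tri n + 4 * n - 2 * n * 2) = 0 := by
    have : ∑' n : ℤ, (-1) ^ n * q ^ (6 * tri n + 4 * n - 2 * n * 2) =
        -∑' n : ℤ, (-1) ^ n * q ^ (6 * tri n + 4 * n - 2 * n * 2) := by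
      conv_lhs => rw [← (Equiv.subLeft (1 : ℤ)).tsum_eq]
      rw [← tsum_neg]
      refine tsum_congr fun n => ?_
      have := tri_neg (n - 1)
      rw [neg_sub, tri_sub_one] at this
      rw [Equiv.subLeft_apply, this, zpow_sub₀ hm, div_eq_mul_inv, ← inv_zpow,
        show (-1 : ℂ)⁻¹ = -1 by norm_num, zpow_one, neg_one_mul, neg_mul]
      congr 3; ring
    linear_combination this / 2
  push_cast
  simp_rw [key, tsum_mul_left, c0, c1, c2, tsum_mul_right]
  have s0 : ∑' k : ℤ, (-1) ^ k * q ^ (3 * tri k + k + k * 0 + tri 0) * z ^ (3 * k + 0) =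
      jTheta (q * z ^ 3) (q ^ 3) := by
    rw [← h3.tsum_eq]
    refine tsum_congr fun n => ?_
    rw [mul_zpow, ← zpow_natCast, ← zpow_mul, ← zpow_natCast z, ← zpow_mul, tri_zero,
      mul_zero, add_zero, add_zero, add_zero, zpow_add₀ hq0]
    push_cast; ring
  have s1 : ∑' k : ℤ, (-1) ^ k * q ^ (3 * tri k + k + k * 1 + tri 1) * z ^ (3 * k + 1) =
      z * jTheta (q * (z ^ 3)⁻¹) (q ^ 3) := by
    rw [← h4.tsum_eq, ← tsum_mul_left, ← (Equiv.neg ℤ).tsum_eq]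
    refine tsum_congr fun n => ?_
    rw [mul_zpow, ← zpow_natCast, ← zpow_mul, inv_zpow, ← zpow_natCast z, ← zpow_mul, ← zpow_neg,
      Equiv.neg_apply, tri_neg, tri_one, zpow_neg, ← inv_zpow, show (-1 : ℂ)⁻¹ = -1 by norm_num,
      zpow_add₀ hz, zpow_one,
      show 3 * (tri n + n) + -n + -n * 1 + 0 = 3 * tri n + n by ring, zpow_add₀ hq0]
    push_cast
    rw [mul_neg]
    ring
  rw [s0, s1]
  ring

/-- **Quintuple product identity.** -/
theorem quintuple_product {q z : ℂ} (hq0 : q ≠ 0) (hq : ‖q‖ < 1) (hz : z ≠ 0) :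
    jTheta z q * (jTheta (q * z ^ 3) (q ^ 3) + z * jTheta (q * (z ^ 3)⁻¹) (q ^ 3)) =
      qPochInf q q * jTheta (z ^ 2) q := by
  have hq2 := norm_pow_lt_one hq two_ne_zero
  have h := jTheta_neg_mul_jTheta hq0 hq hz
  have hne := qPochInf_self_ne_zero hq2
  refine mul_left_cancel₀ hne ?_
  -- Here (z;q)_∞ (-z;q)_∞ = (z²;q²)_∞, and together with (qz²;q²)_∞ this rebuilds (z²;q)_∞;
  -- likewise with q/z in place of z.
  have a1 := qPochInf_eq_prod_residues (z ^ 2) hq 2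
  have a2 := qPochInf_eq_prod_residues (q / z ^ 2) hq 2
  simp only [Finset.prod_range_succ, Finset.prod_range_zero, pow_zero, one_mul, pow_one] at a1 a2
  have a3 := qPochInf_mul_neg z hq
  have a4 := qPochInf_mul_neg (q / z) hq
  rw [show (q / z) ^ 2 = q * (q / z ^ 2) by field_simp] at a4
  have a5 : q ^ 2 / (q * z ^ 2) = q / z ^ 2 := by field_simp
  calc _ = jTheta z q * (jTheta (-z) q * jTheta (q * z ^ 2) (q ^ 2)) := by rw [h]; ring
    _ = _ := by
      rw [jTheta, jTheta, jTheta, jTheta, a1, a2, ← a3, ← a4, a5, div_neg]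
      ring

/-! ### Functions on the punctured plane invariant under `z ↦ q z` -/

/-- Liouville's theorem on the torus `ℂˣ / q ^ ℤ`. -/
theorem eq_of_forall_mul_left_eq {q : ℂ} (hq0 : q ≠ 0) (hq : ‖q‖ < 1) {f : ℂ → ℂ}
    (hf : ∀ z, z ≠ 0 → DifferentiableAt ℂ f z) (hinv : ∀ z, z ≠ 0 → f (q * z) = f z)
    {z w : ℂ} (hz : z ≠ 0) (hw : w ≠ 0) : f z = f w := by
  have hnat : ∀ (n : ℕ) (z : ℂ), z ≠ 0 → f (q ^ n * z) = f z := by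
    intro n
    induction n with
    | zero => simp
    | succ n ih =>
      intro z hz
      rw [pow_succ, mul_assoc, ih _ (mul_ne_zero hq0 hz), hinv z hz]
  have hint : ∀ (n : ℤ) (z : ℂ), z ≠ 0 → f (q ^ n * z) = f z := by
    intro n z hz
    obtain ⟨m, rfl | rfl⟩ := n.eq_nat_or_neg
    · simpa using hnat m z hz
    · rw [← hnat m (q ^ (-(m : ℤ)) * z) (mul_ne_zero (zpow_ne_zero _ hq0) hz), ← mul_assoc,
        zpow_neg, zpow_natCast, mul_inv_cancel₀ (pow_ne_zero m hq0), one_mul]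
  have hy : 1 < ‖q‖⁻¹ := (one_lt_inv₀ (norm_pos_iff.2 hq0)).2 hq
  have hK : IsCompact (Metric.closedBall (0 : ℂ) ‖q‖⁻¹ ∩ {z | 1 ≤ ‖z‖}) :=
    (isCompact_closedBall _ _).inter_right (isClosed_le continuous_const continuous_norm)
  have hfK : ContinuousOn f (Metric.closedBall (0 : ℂ) ‖q‖⁻¹ ∩ {z | 1 ≤ ‖z‖}) := by
    intro z hz
    refine (hf z ?_).continuousAt.continuousWithinAt
    rintro rfl
    have : (1 : ℝ) ≤ ‖(0 : ℂ)‖ := hz.2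
    norm_num at this
  obtain ⟨C, hC⟩ := (hK.image_of_continuousOn hfK).isBounded.exists_norm_le
  -- A power of q moves every point into the compact annulus 1 ≤ |z| ≤ 1/|q|, so f ∘ exp is entire
  -- and bounded.
  have hg : Differentiable ℂ fun t => f (Complex.exp t) := fun t =>
    (hf _ (Complex.exp_ne_zero t)).comp t Complex.differentiable_exp.differentiableAt
  have hb : Bornology.IsBounded (Set.range fun t => f (Complex.exp t)) := by
    refine isBounded_iff_forall_norm_le.2 ⟨C, ?_⟩
    rintro _ ⟨t, rfl⟩
    have ht := Complex.exp_ne_zero t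
    obtain ⟨n, hn1, hn2⟩ := exists_mem_Ico_zpow (norm_pos_iff.2 ht) hy
    have hqn : 0 < ‖q‖ ^ n := zpow_pos (norm_pos_iff.2 hq0) _
    rw [inv_zpow] at hn1
    rw [zpow_add₀ (by positivity), inv_zpow, zpow_one] at hn2
    change ‖f (Complex.exp t)‖ ≤ C
    rw [← hint n _ ht]
    refine hC _ ⟨_, ⟨?_, ?_⟩, rfl⟩
    · rw [mem_closedBall_zero_iff, norm_mul, norm_zpow]
      calc _ ≤ ‖q‖ ^ n * ((‖q‖ ^ n)⁻¹ * ‖q‖⁻¹) := by gcongr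
        _ = ‖q‖⁻¹ := by field_simp
    · change 1 ≤ ‖q ^ n * Complex.exp t‖
      rw [norm_mul, norm_zpow]
      calc 1 = ‖q‖ ^ n * (‖q‖ ^ n)⁻¹ := by field_simp
        _ ≤ _ := by gcongr
  have := hg.apply_eq_apply_of_bounded hb (Complex.log z) (Complex.log w)
  simpa [Complex.exp_log hz, Complex.exp_log hw] using this

/-! ### The factors `1 - w q ^ n` -/

theorem zpow_injective_of_norm_lt_one {q : ℂ} (hq0 : q ≠ 0) (hq : ‖q‖ < 1) :
    Function.Injective fun n : ℤ => q ^ n := by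
  intro m n h
  have h' : ‖q‖ ^ m = ‖q‖ ^ n := by simpa [norm_zpow] using congrArg norm h
  exact zpow_right_injective₀ (norm_pos_iff.2 hq0) hq.ne h'

theorem exists_le_norm_one_sub_of_finset {q w₀ : ℂ} (s : Finset ℤ) :
    ∃ δ : ℝ, 0 < δ ∧ ∀ᶠ w in 𝓝 w₀, ∀ n ∈ s, w₀ * q ^ n ≠ 1 → δ ≤ ‖1 - w * q ^ n‖ := by
  induction s using Finset.induction_on with
  | empty => exact ⟨1, one_pos, by simp⟩
  | insert m s _ ih =>
    obtain ⟨δ, hδ, h⟩ := ih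
    by_cases hm : w₀ * q ^ m = 1
    · refine ⟨δ, hδ, h.mono fun w hw n hn hne => ?_⟩
      rcases Finset.mem_insert.1 hn with rfl | hn
      · exact absurd hm hne
      · exact hw n hn hne
    · have hpos : 0 < ‖1 - w₀ * q ^ m‖ := norm_pos_iff.2 (sub_ne_zero.2 (Ne.symm hm))
      have hc : ContinuousAt (fun w : ℂ => ‖1 - w * q ^ m‖) w₀ := by fun_prop
      refine ⟨min δ (‖1 - w₀ * q ^ m‖ / 2), by positivity, ?_⟩
      filter_upwards [h, hc.eventually_const_lt (half_lt_self hpos)] with w hw hw' n hn hne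
      rcases Finset.mem_insert.1 hn with rfl | hn
      · exact (min_le_right _ _).trans hw'.le
      · exact (min_le_left _ _).trans (hw n hn hne)

/-- For w near w₀ the points w q^n leave every neighbourhood of 1 uniformly as |n| grows, and the
finitely many other n are handled by continuity. Indices with a zero at w₀ itself are excluded. -/
theorem exists_le_norm_one_sub {q w₀ : ℂ} (hq0 : q ≠ 0) (hq : ‖q‖ < 1) (hw₀ : w₀ ≠ 0) :
    ∃ δ : ℝ, 0 < δ ∧ ∀ᶠ w in 𝓝 w₀, ∀ n : ℤ, w₀ * q ^ n ≠ 1 → δ ≤ ‖1 - w * q ^ n‖ := by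
  have hp := norm_pos_iff.2 hw₀
  have hqp := norm_pos_iff.2 hq0
  have hlim := tendsto_pow_atTop_nhds_zero_of_lt_one (norm_nonneg q) hq
  -- With ‖w₀‖/2 < ‖w‖ < 2‖w₀‖ these two bounds give |w q^n| ≤ 1/2 for n > N and |w q^n| ≥ 2 for n <
  -- -N.
  obtain ⟨N, hN1, hN2⟩ := ((hlim.eventually_lt_const (show 0 < (4 * ‖w₀‖)⁻¹ by positivity)).and
    (hlim.eventually_lt_const (show 0 < ‖w₀‖ / 4 by positivity))).exists
  obtain ⟨δ, hδ, h⟩ := exists_le_norm_one_sub_of_finset (q := q) (w₀ := w₀)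
    (Finset.Icc (-(N : ℤ)) N)
  have hc : ContinuousAt (fun w : ℂ => ‖w‖) w₀ := by fun_prop
  refine ⟨min δ (1 / 2), by positivity, ?_⟩
  filter_upwards [h, hc.eventually_const_lt (half_lt_self hp),
    hc.eventually_lt_const (show ‖w₀‖ < 2 * ‖w₀‖ by linarith)] with w hw h1 h2 n hn
  by_cases hm : n ∈ Finset.Icc (-(N : ℤ)) N
  · exact (min_le_left _ _).trans (hw n hm hn)
  refine (min_le_right _ _).trans ?_
  rw [Finset.mem_Icc, not_and_or, not_le, not_le] at hm
  rcases hm with hm | hm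
  · have a1 : ‖q‖ ^ (-(N : ℤ)) ≤ ‖q‖ ^ n := zpow_le_zpow_right_of_le_one₀ hqp hq.le hm.le
    rw [zpow_neg, zpow_natCast] at a1
    have a2 : 4 / ‖w₀‖ ≤ (‖q‖ ^ N)⁻¹ := by
      rw [div_eq_mul_inv, ← inv_inv (4 : ℝ), ← mul_inv]
      exact inv_anti₀ (by positivity) (by linarith [mul_comm (4 : ℝ)⁻¹ ‖w₀‖])
    have a3 : 2 ≤ ‖w * q ^ n‖ := by
      rw [norm_mul, norm_zpow]
      calc (2 : ℝ) = ‖w₀‖ / 2 * (4 / ‖w₀‖) := by field_simp; norm_num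
        _ ≤ _ := by gcongr; exact a2.trans a1
    have a4 := norm_sub_norm_le (w * q ^ n) 1
    rw [norm_one, norm_sub_rev] at a4
    linarith
  · have a1 : ‖q‖ ^ n ≤ ‖q‖ ^ (N : ℤ) := zpow_le_zpow_right_of_le_one₀ hqp hq.le hm.le
    rw [zpow_natCast] at a1
    have a3 : ‖w * q ^ n‖ ≤ 1 / 2 := by
      rw [norm_mul, norm_zpow]
      calc _ ≤ 2 * ‖w₀‖ * (4 * ‖w₀‖)⁻¹ := by gcongr; exact a1.trans hN1.le
        _ = 1 / 2 := by field_simp; norm_num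
    have a4 := norm_sub_norm_le 1 (w * q ^ n)
    rw [norm_one] at a4
    linarith

/-- No pole has to be excluded: an index with w q^n = 1 contributes the inverse of 0, which is 0.
The Appell sums at argument 1 rely on this convention. -/
theorem exists_norm_inv_one_sub_le {q w : ℂ} (hq0 : q ≠ 0) (hq : ‖q‖ < 1) (hw : w ≠ 0) :
    ∃ C : ℝ, 0 < C ∧ ∀ n : ℤ, ‖(1 - w * q ^ n)⁻¹‖ ≤ C := by
  obtain ⟨δ, hδ, h⟩ := exists_le_norm_one_sub hq0 hq hw
  refine ⟨δ⁻¹, by positivity, fun n => ?_⟩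
  by_cases hn : w * q ^ n = 1
  · simp [hn, hδ.le]
  · rw [norm_inv]
    exact inv_anti₀ hδ (h.self_of_nhds n hn)

/-- Continuity of a sum of simple fractions, with the poles at the base point left out. -/
theorem tendsto_tsum_div_one_sub {q w₀ : ℂ} (hq0 : q ≠ 0) (hq : ‖q‖ < 1) (hw₀ : w₀ ≠ 0)
    {a : ℤ → ℂ} (ha : Summable a) :
    Tendsto (fun w => ∑' n : ℤ, if w₀ * q ^ n = 1 then 0 else a n / (1 - w * q ^ n)) (𝓝 w₀)
      (𝓝 (∑' n : ℤ, a n / (1 - w₀ * q ^ n))) := by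
  obtain ⟨δ, hδ, h⟩ := exists_le_norm_one_sub hq0 hq hw₀
  refine tendsto_tsum_of_dominated_convergence (ha.norm.mul_right δ⁻¹) (fun n => ?_) ?_
  · split_ifs with hn
    · simp [hn]
    · have : 1 - w₀ * q ^ n ≠ 0 := sub_ne_zero.2 (Ne.symm hn)
      have hc : ContinuousAt (fun w : ℂ => a n / (1 - w * q ^ n)) w₀ := by
        fun_prop (disch := assumption)
      exact hc
  · filter_upwards [h] with w hw n
    split_ifs with hn
    · rw [norm_zero]; positivity
    · rw [norm_div, div_eq_mul_inv]
      gcongr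
      exact hw n hn

/-! ### Appell sums of level three -/

/-- The coefficients of the Appell sum of level `3`. -/
def appellCoeff (c q : ℂ) (n : ℤ) : ℂ := (-1) ^ n * c ^ n * q ^ (3 * tri n + 3 * n)

/-- The Appell sum of level `3`. -/
def appell (c z q : ℂ) : ℂ := ∑' n : ℤ, appellCoeff c q n / (1 - z * q ^ n)

theorem summable_appellCoeff {c q : ℂ} (hq0 : q ≠ 0) (hq : ‖q‖ < 1) (hc : c ≠ 0) :
    Summable (appellCoeff c q) := by
  refine (hasSum_jTheta (pow_ne_zero 3 hq0) (norm_pow_lt_one hq three_ne_zero)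
    (mul_ne_zero (pow_ne_zero 3 hq0) hc)).summable.congr fun n => ?_
  rw [appellCoeff, mul_zpow, pow_zpow, pow_zpow, zpow_add₀ hq0]
  push_cast; ring

theorem summable_appell {c z q : ℂ} (hq0 : q ≠ 0) (hq : ‖q‖ < 1) (hc : c ≠ 0) (hz : z ≠ 0) :
    Summable fun n : ℤ => appellCoeff c q n / (1 - z * q ^ n) := by
  obtain ⟨C, hC0, hC⟩ := exists_norm_inv_one_sub_le hq0 hq hz
  refine Summable.of_norm_bounded ((summable_appellCoeff hq0 hq hc).norm.mul_right C) fun n => ?_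
  rw [div_eq_mul_inv, norm_mul]
  gcongr
  exact hC n

theorem jTheta_mul_zpow {q x : ℂ} (hq0 : q ≠ 0) (hq : ‖q‖ < 1) (hx : x ≠ 0) (n : ℤ) :
    (-1) ^ n * q ^ tri n * x ^ n * jTheta (x * q ^ n) q = jTheta x q := by
  have h1 := hasSum_jTheta hq0 hq (mul_ne_zero hx (zpow_ne_zero n hq0))
  have h2 := (Equiv.addRight n).hasSum_iff.2 (hasSum_jTheta hq0 hq hx)
  refine ((h1.mul_left ((-1) ^ n * q ^ tri n * x ^ n)).unique (h2.of_eq (fun k => ?_) rfl))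
  simp only [Function.comp, Equiv.coe_addRight]
  rw [tri_add, zpow_add₀ hq0, zpow_add₀ hq0, zpow_add₀ hx, zpow_add₀ (by norm_num), mul_zpow,
    ← zpow_mul, mul_comm n k]
  ring

/-- The holomorphic extension of `jTheta w q / (1 - w q ^ n)`. -/
def jPole (n : ℤ) (w q : ℂ) : ℂ := (-1) ^ n * q ^ tri n * w ^ n * jReg (w * q ^ n) q

theorem jPole_mul_one_sub {q w : ℂ} (hq0 : q ≠ 0) (hq : ‖q‖ < 1) (hw : w ≠ 0) (n : ℤ) :
    jPole n w q * (1 - w * q ^ n) = jTheta w q := by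
  rw [← jTheta_mul_zpow hq0 hq hw n, jPole, jTheta_eq_mul_jReg _ hq]; ring

theorem mul_zpow_ne_one_of_jTheta_ne_zero {q w : ℂ} (hq0 : q ≠ 0) (hq : ‖q‖ < 1) (hw : w ≠ 0)
    (h : jTheta w q ≠ 0) (n : ℤ) : w * q ^ n ≠ 1 := by
  intro hn
  apply h
  rw [← jPole_mul_one_sub hq0 hq hw n, hn, sub_self, mul_zero]

theorem jPole_mul_left {q w : ℂ} (hq0 : q ≠ 0) (hw : w ≠ 0) (n : ℤ) :
    jPole n (q * w) q = -w⁻¹ * jPole (n + 1) w q := by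
  rw [jPole, jPole, tri_add_one, zpow_add₀ hq0, zpow_add₀ hq0, zpow_add₀ hw,
    zpow_add₀ (by norm_num), mul_zpow, zpow_one, zpow_one, zpow_one,
    show q * w * q ^ n = w * (q ^ n * q) by ring]
  field_simp

theorem differentiableAt_jPole {q w : ℂ} (hq0 : q ≠ 0) (hq : ‖q‖ < 1) (hw : w ≠ 0) (n : ℤ) :
    DifferentiableAt ℂ (fun w => jPole n w q) w := by
  unfold jPole
  have h1 : DifferentiableAt ℂ (fun w : ℂ => w ^ n) w :=
    differentiableAt_zpow.2 (Or.inl hw)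
  have h2 : DifferentiableAt ℂ (fun w : ℂ => jReg (w * q ^ n) q) w :=
    DifferentiableAt.comp w (g := fun x => jReg x q) (f := fun w => w * q ^ n)
      (differentiableAt_jReg hq (mul_ne_zero hw (zpow_ne_zero n hq0))) (by fun_prop)
  fun_prop

/-- Away from a zero of 1 - w₀ q^n the quotient is bounded through `exists_le_norm_one_sub`; at most
one n has such a zero, and there continuity suffices. -/
theorem exists_norm_jPole_le {q w₀ : ℂ} (hq0 : q ≠ 0) (hq : ‖q‖ < 1) (hw₀ : w₀ ≠ 0) :
    ∃ M : ℝ, ∀ᶠ w in 𝓝 w₀, ∀ n : ℤ, ‖jPole n w q‖ ≤ M := by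
  obtain ⟨δ, hδ, h⟩ := exists_le_norm_one_sub hq0 hq hw₀
  have hc := (differentiableAt_jTheta hq hw₀).continuousAt.norm
  have key : ∃ M' : ℝ, ∀ᶠ w in 𝓝 w₀, ∀ n : ℤ, w₀ * q ^ n = 1 → ‖jPole n w q‖ ≤ M' := by
    by_cases hex : ∃ m : ℤ, w₀ * q ^ m = 1
    · obtain ⟨m, hm⟩ := hex
      have hcm := (differentiableAt_jPole hq0 hq hw₀ m).continuousAt.norm
      refine ⟨‖jPole m w₀ q‖ + 1, ?_⟩
      filter_upwards [hcm.eventually_lt_const (lt_add_one _)] with w hw n hn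
      obtain rfl : n = m := zpow_injective_of_norm_lt_one hq0 hq
        (mul_left_cancel₀ hw₀ (hn.trans hm.symm))
      exact hw.le
    · push Not at hex
      exact ⟨0, Eventually.of_forall fun w n hn => absurd hn (hex n)⟩
  obtain ⟨M', hM'⟩ := key
  refine ⟨max M' ((‖jTheta w₀ q‖ + 1) * δ⁻¹), ?_⟩
  filter_upwards [h, hM', hc.eventually_lt_const (lt_add_one _), isOpen_ne.mem_nhds hw₀]
    with w h1 h2 h3 h4 n
  by_cases hn : w₀ * q ^ n = 1
  · exact (h2 n hn).trans (le_max_left _ _)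
  · refine le_trans ?_ (le_max_right _ _)
    have h5 := h1 n hn
    rw [← div_eq_mul_inv, le_div_iff₀ hδ]
    calc _ ≤ ‖jPole n w q‖ * ‖1 - w * q ^ n‖ := by gcongr
      _ = ‖jTheta w q‖ := by rw [← norm_mul, jPole_mul_one_sub hq0 hq h4]
      _ ≤ _ := h3.le

/-- The holomorphic extension of `jTheta w q * appell c w q`. -/
def appellReg (c w q : ℂ) : ℂ := ∑' n : ℤ, appellCoeff c q n * jPole n w q

theorem summable_appellReg {c w q : ℂ} (hq0 : q ≠ 0) (hq : ‖q‖ < 1) (hc : c ≠ 0) (hw : w ≠ 0) :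
    Summable fun n : ℤ => appellCoeff c q n * jPole n w q := by
  obtain ⟨M, hM⟩ := exists_norm_jPole_le hq0 hq hw
  refine Summable.of_norm_bounded ((summable_appellCoeff hq0 hq hc).norm.mul_right M) fun n => ?_
  rw [norm_mul]
  gcongr
  exact hM.self_of_nhds n

theorem differentiableAt_appellReg {c w q : ℂ} (hq0 : q ≠ 0) (hq : ‖q‖ < 1) (hc : c ≠ 0)
    (hw : w ≠ 0) : DifferentiableAt ℂ (fun w => appellReg c w q) w := by
  obtain ⟨M, hM⟩ := exists_norm_jPole_le hq0 hq hw
  obtain ⟨ε, hε, hball⟩ := Metric.eventually_nhds_iff_ball.1 (hM.and (isOpen_ne.mem_nhds hw))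
  have h := Complex.differentiableOn_tsum_of_summable_norm (U := Metric.ball w ε)
    (F := fun n w => appellCoeff c q n * jPole n w q)
    ((summable_appellCoeff hq0 hq hc).norm.mul_right M) (fun n z hz =>
      ((differentiableAt_jPole hq0 hq (hball z hz).2 n).const_mul _).differentiableWithinAt)
    Metric.isOpen_ball (fun n z hz => by
      rw [norm_mul]
      gcongr
      exact (hball z hz).1 n)
  exact h.differentiableAt (Metric.ball_mem_nhds w hε)

theorem appellReg_eq {c w q : ℂ} (hq0 : q ≠ 0) (hq : ‖q‖ < 1) (hw : w ≠ 0)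
    (h : jTheta w q ≠ 0) : appellReg c w q = jTheta w q * appell c w q := by
  rw [appellReg, appell, ← tsum_mul_left]
  refine tsum_congr fun n => ?_
  rw [← jPole_mul_one_sub hq0 hq hw n]
  have := sub_ne_zero.2 (mul_zpow_ne_one_of_jTheta_ne_zero hq0 hq hw h n).symm
  field_simp

/-- Since j(1) = 0, all terms without a pole at w = 1 vanish and only the index 0 is left. -/
theorem appellReg_one (c : ℂ) {q : ℂ} (hq0 : q ≠ 0) (hq : ‖q‖ < 1) :
    appellReg c 1 q = qPochInf q q ^ 3 := by
  rw [appellReg, tsum_eq_single 0]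
  · simp [appellCoeff, jPole, jReg_one]
  · intro n hn
    have h := jPole_mul_one_sub hq0 hq one_ne_zero n
    rw [jTheta_one hq, one_mul] at h
    have h2 : 1 - q ^ n ≠ 0 := sub_ne_zero.2 fun h => hn
      (zpow_injective_of_norm_lt_one hq0 hq (by simpa using h.symm))
    rw [(mul_eq_zero.1 h).resolve_right h2, mul_zero]

/-- Shifting n by one removes q^(3n) from the coefficient. The discrepancy with w³ times the
original term is governed by 1 - w³q^(3n) = (1 - wq^n)(1 + wq^n + w²q^(2n)): its first factor
cancels the pole, and the second leaves three theta series in base q³. -/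
theorem appellReg_mul_left {c w q : ℂ} (hq0 : q ≠ 0) (hq : ‖q‖ < 1) (hc : c ≠ 0) (hw : w ≠ 0) :
    appellReg c (q * w) q = w⁻¹ * c⁻¹ * (w ^ 3 * appellReg c w q + jTheta w q *
      (jTheta c (q ^ 3) + w * jTheta (q * c) (q ^ 3) + w ^ 2 * jTheta (q ^ 2 * c) (q ^ 3))) := by
  have hq3 := pow_ne_zero 3 hq0
  have hq3' := norm_pow_lt_one hq three_ne_zero
  have h0 := hasSum_jTheta hq3 hq3' hc
  have h1 := hasSum_jTheta hq3 hq3' (mul_ne_zero hq0 hc)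
  have h2 := hasSum_jTheta hq3 hq3' (mul_ne_zero (pow_ne_zero 2 hq0) hc)
  have hB := (summable_appellReg hq0 hq hc hw).hasSum
  have hR := (((hB.mul_left (w ^ 3)).add (((h0.add (h1.mul_left w)).add
    (h2.mul_left (w ^ 2))).mul_left (jTheta w q))).mul_left (w⁻¹ * c⁻¹))
  have hL := (Equiv.subRight (1 : ℤ)).hasSum_iff.2
    (summable_appellReg hq0 hq hc (mul_ne_zero hq0 hw)).hasSum
  refine hL.unique (hR.of_eq (fun n => ?_) rfl)
  simp only [Function.comp, Equiv.subRight_apply]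
  have hj := jPole_mul_one_sub hq0 hq hw n
  rw [jPole_mul_left hq0 hw, sub_add_cancel, appellCoeff, appellCoeff, tri_sub_one,
    show 3 * (tri n - n + 1) + 3 * (n - 1) = 3 * tri n by ring, zpow_sub₀ hc,
    zpow_sub₀ (by norm_num : (-1 : ℂ) ≠ 0), zpow_add₀ hq0, mul_zpow, mul_zpow, pow_zpow, pow_zpow,
    ← hj, mul_comm (3 : ℤ) n, mul_comm ((2 : ℕ) : ℤ) n, zpow_mul q n, zpow_mul q n]
  push_cast
  rw [show (q ^ n) ^ (3 : ℤ) = (q ^ n) ^ 3 by norm_cast,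
    show (q ^ n) ^ (2 : ℤ) = (q ^ n) ^ 2 by norm_cast]
  field_simp
  ring

/-- The identity of Atkin and Swinnerton-Dyer, multiplied by its denominator. -/
theorem appellReg_three_term {q z s : ℂ} (hq0 : q ≠ 0) (hq : ‖q‖ < 1) (hz : z ≠ 0) (hs : s ≠ 0)
    (hjs : jTheta s q ≠ 0) :
    jTheta z q * jTheta (z / s) q * (s ^ 3 * appellReg (s ^ 3) (z * s) q)
      + jTheta (z * s) q * jTheta z q * appellReg (s ^ 3)⁻¹ (z / s) q
      - s * (jTheta (s ^ 2) q / jTheta s q) *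
        (jTheta (z * s) q * jTheta (z / s) q * appellReg 1 z q) =
      jTheta s q * jTheta (s ^ 2) q * qPochInf q q ^ 3 := by
  have hs3 := pow_ne_zero 3 hs
  have hs3' := inv_ne_zero hs3
  set H : ℂ → ℂ := fun z =>
    jTheta z q * jTheta (z / s) q * (s ^ 3 * appellReg (s ^ 3) (z * s) q)
      + jTheta (z * s) q * jTheta z q * appellReg (s ^ 3)⁻¹ (z / s) q
      - s * (jTheta (s ^ 2) q / jTheta s q) *
        (jTheta (z * s) q * jTheta (z / s) q * appellReg 1 z q) with hH
  have hdiff : ∀ z, z ≠ 0 → DifferentiableAt ℂ H z := by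
    intro z hz
    have d1 := differentiableAt_jTheta hq hz
    have d2 : DifferentiableAt ℂ (fun z => jTheta (z / s) q) z :=
      DifferentiableAt.comp z (g := fun x => jTheta x q) (f := fun z => z / s)
        (differentiableAt_jTheta hq (div_ne_zero hz hs)) (by fun_prop)
    have d3 : DifferentiableAt ℂ (fun z => jTheta (z * s) q) z :=
      DifferentiableAt.comp z (g := fun x => jTheta x q) (f := fun z => z * s)
        (differentiableAt_jTheta hq (mul_ne_zero hz hs)) (by fun_prop)
    have d4 : DifferentiableAt ℂ (fun z => appellReg (s ^ 3) (z * s) q) z :=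
      DifferentiableAt.comp z (g := fun x => appellReg (s ^ 3) x q) (f := fun z => z * s)
        (differentiableAt_appellReg hq0 hq hs3 (mul_ne_zero hz hs)) (by fun_prop)
    have d5 : DifferentiableAt ℂ (fun z => appellReg (s ^ 3)⁻¹ (z / s) q) z :=
      DifferentiableAt.comp z (g := fun x => appellReg (s ^ 3)⁻¹ x q) (f := fun z => z / s)
        (differentiableAt_appellReg hq0 hq hs3' (div_ne_zero hz hs)) (by fun_prop)
    have d6 := differentiableAt_appellReg hq0 hq one_ne_zero hz
    fun_prop
  -- The multipliers of the three summands are all 1. The inhomogeneous parts add up to j(z) j(z/s)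
  -- j(zs) times a combination that vanishes by the quintuple product identity at s; this identity
  -- fixes the coefficient j(s²)/j(s) of the central sum.
  have hinv : ∀ z, z ≠ 0 → H (q * z) = H z := by
    intro z hz
    have hq3 := pow_ne_zero 3 hq0
    have hq3' := norm_pow_lt_one hq three_ne_zero
    have hQ := quintuple_product hq0 hq hs
    have hE := jTheta_self_cube hq0 hq
    have t0 := jTheta_inv hq3 hq3' hs3
    have t1 : jTheta (q ^ 2 * s ^ 3) (q ^ 3) = jTheta (q * (s ^ 3)⁻¹) (q ^ 3) := by
      rw [← jTheta_div hq3 (q * (s ^ 3)⁻¹)]; congr 1; field_simp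
    have t2 : jTheta (q ^ 2 * (s ^ 3)⁻¹) (q ^ 3) = jTheta (q * s ^ 3) (q ^ 3) := by
      rw [← jTheta_div hq3 (q * s ^ 3)]; congr 1; field_simp
    have t3 : jTheta (q ^ 2) (q ^ 3) = jTheta q (q ^ 3) := by
      rw [← jTheta_div hq3 q]; congr 1; field_simp
    simp only [hH]
    rw [show q * z * s = q * (z * s) by ring, mul_div_assoc q z s, jTheta_mul_left hq0 hq hz,
      jTheta_mul_left hq0 hq (mul_ne_zero hz hs), jTheta_mul_left hq0 hq (div_ne_zero hz hs),
      appellReg_mul_left hq0 hq hs3 (mul_ne_zero hz hs),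
      appellReg_mul_left hq0 hq hs3' (div_ne_zero hz hs),
      appellReg_mul_left hq0 hq one_ne_zero hz, t0, t1, t2, mul_one, mul_one, t3, hE,
      jTheta_one hq3']
    generalize jTheta (q * s ^ 3) (q ^ 3) = a at *
    generalize jTheta (q * (s ^ 3)⁻¹) (q ^ 3) = b at *
    generalize jTheta (s ^ 3) (q ^ 3) = c at *
    generalize jTheta (s ^ 2) q = d at *
    generalize qPochInf q q = e at *
    have hd : d / jTheta s q * e = a + s * b := by
      field_simp
      linear_combination -hQ
    generalize d / jTheta s q = f at *
    field_simp
    linear_combination (-jTheta z q * jTheta (z / s) q * jTheta (z * s) q * z * s * (1 + z)) * hd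
  -- At z = 1/s the factor j(zs) kills two summands, and `appellReg_one` evaluates the third.
  have hconst := eq_of_forall_mul_left_eq hq0 hq hdiff hinv hz (inv_ne_zero hs)
  change H z = _
  rw [hconst]
  simp only [hH]
  rw [inv_mul_cancel₀ hs, jTheta_one hq, appellReg_one _ hq0 hq,
    show s⁻¹ / s = (s ^ 2)⁻¹ by field_simp, jTheta_inv hq0 hq hs,
    jTheta_inv hq0 hq (pow_ne_zero 2 hs)]
  field_simp
  ring

/-- **The identity of Atkin and Swinnerton-Dyer.** -/
theorem appell_three_term {q z s : ℂ} (hq0 : q ≠ 0) (hq : ‖q‖ < 1) (hz : z ≠ 0) (hs : s ≠ 0)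
    (hjs : jTheta s q ≠ 0) (hjz : jTheta z q ≠ 0) (h1 : jTheta (z * s) q ≠ 0)
    (h2 : jTheta (z / s) q ≠ 0) :
    s ^ 3 * appell (s ^ 3) (z * s) q + appell (s ^ 3)⁻¹ (z / s) q
      - s * (jTheta (s ^ 2) q / jTheta s q) * appell 1 z q =
      jTheta s q * jTheta (s ^ 2) q * qPochInf q q ^ 3 /
        (jTheta (z / s) q * jTheta z q * jTheta (z * s) q) := by
  have h := appellReg_three_term hq0 hq hz hs hjs
  rw [appellReg_eq hq0 hq (mul_ne_zero hz hs) h1, appellReg_eq hq0 hq (div_ne_zero hz hs) h2,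
    appellReg_eq hq0 hq hz hjz] at h
  rw [← h]
  generalize jTheta (z * s) q = u, appell (s ^ 3) (z * s) q = v at *
  field_simp

theorem continuousAt_appell {c q w : ℂ} (hq0 : q ≠ 0) (hq : ‖q‖ < 1) (hc : c ≠ 0) (hw : w ≠ 0)
    (h : jTheta w q ≠ 0) : ContinuousAt (fun w => appell c w q) w := by
  have := tendsto_tsum_div_one_sub hq0 hq hw (summable_appellCoeff hq0 hq hc)
  simp_rw [if_neg (mul_zpow_ne_one_of_jTheta_ne_zero hq0 hq hw h _)] at this
  exact this

/-- At argument 1 division by zero drops precisely the term of index 0, which is the polar part 1/(1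
- w). So `appell c 1 q` is the finite part at the pole. -/
theorem tendsto_appell_one {c q : ℂ} (hq0 : q ≠ 0) (hq : ‖q‖ < 1) (hc : c ≠ 0) :
    Tendsto (fun w => appell c w q - 1 / (1 - w)) (𝓝[≠] 1) (𝓝 (appell c 1 q)) := by
  have h := tendsto_tsum_div_one_sub hq0 hq one_ne_zero (summable_appellCoeff hq0 hq hc)
  refine (h.mono_left nhdsWithin_le_nhds).congr' ?_
  filter_upwards [nhdsWithin_le_nhds (isOpen_ne.mem_nhds (one_ne_zero (α := ℂ)))] with w hw
  rw [appell, (summable_appell hq0 hq hc hw).tsum_eq_add_tsum_ite 0]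
  simp only [zpow_zero, mul_one, one_mul]
  have : appellCoeff c q 0 = 1 := by simp [appellCoeff]
  rw [this, add_sub_cancel_left]
  refine tsum_congr fun n => ?_
  have hn : q ^ n = 1 ↔ n = 0 :=
    ⟨fun h => zpow_injective_of_norm_lt_one hq0 hq (by simpa using h), fun h => by simp [h]⟩
  simp only [hn]

/-- The function is invariant under x ↦ 1/x, so its derivative at the fixed point 1 equals its own
negative. -/
theorem hasDerivAt_jReg_one {q : ℂ} (hq : ‖q‖ < 1) : HasDerivAt (fun x => jReg x q) 0 1 := by
  have h := (differentiableAt_jReg hq one_ne_zero).hasDerivAt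
  have h1 : HasDerivAt (fun x : ℂ => x⁻¹) (-1) 1 := by
    simpa using hasDerivAt_inv (one_ne_zero (α := ℂ))
  have h2 : HasDerivAt (fun x => jReg x⁻¹ q) (deriv (fun x => jReg x q) 1 * -1) 1 :=
    HasDerivAt.comp 1 (h₂ := fun x => jReg x q) (h := fun x => x⁻¹) (by simpa using h) h1
  simp_rw [jReg_inv] at h2
  have h3 := h.unique h2
  have h4 : deriv (fun x => jReg x q) 1 = 0 := by linear_combination h3 / 2
  rwa [h4] at h

/-- The limiting case `z = s` of the identity of Atkin and Swinnerton-Dyer. In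
`appell (s ^ 3)⁻¹ 1 q` the term of index `0` vanishes. -/
theorem appell_three_term_self {q s : ℂ} (hq0 : q ≠ 0) (hq : ‖q‖ < 1) (hs : s ≠ 0)
    (hjs : jTheta s q ≠ 0) (hjs2 : jTheta (s ^ 2) q ≠ 0) :
    s ^ 3 * appell (s ^ 3) (s ^ 2) q + appell (s ^ 3)⁻¹ 1 q
      - s * (jTheta (s ^ 2) q / jTheta s q) * appell 1 s q = jLog s q + jLog (s ^ 2) q := by
  have hs2 := pow_ne_zero 2 hs
  have hs3 := pow_ne_zero 3 hs
  have hE := qPochInf_self_ne_zero hq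
  -- With z = sw the right side of `appell_three_term` is ψ(1)/((1 - w)ψ(w)), with the simple pole
  -- at w = 1 exposed.
  set ψ : ℂ → ℂ := fun w => jReg w q * jTheta (s * w) q * jTheta (s ^ 2 * w) q with hψ
  have hψ1 : ψ 1 = jTheta s q * jTheta (s ^ 2) q * qPochInf q q ^ 3 := by
    simp only [hψ, mul_one, jReg_one]; ring
  have hd : ∀ x : ℂ, x ≠ 0 → jTheta x q ≠ 0 →
      HasDerivAt (fun w => jTheta (x * w) q) (jLog x q * jTheta x q) 1 := by
    intro x hx hjx
    have := HasDerivAt.comp 1 (h₂ := fun x => jTheta x q) (h := fun w => x * w)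
      (by simpa using hasDerivAt_jTheta hq hx hjx) ((hasDerivAt_id (1 : ℂ)).const_mul x)
    refine HasDerivAt.congr_deriv this ?_
    field_simp
  have hψd : HasDerivAt ψ ((jLog s q + jLog (s ^ 2) q) * ψ 1) 1 := by
    refine (((hasDerivAt_jReg_one hq).mul (hd s hs hjs)).mul (hd _ hs2 hjs2)).congr_deriv ?_
    simp only [hψ, mul_one, jReg_one, Pi.mul_apply]
    ring
  have hψ0 : ψ 1 ≠ 0 := by
    rw [hψ1]; exact mul_ne_zero (mul_ne_zero hjs hjs2) (pow_ne_zero 3 hE)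
  have hslope : HasDerivAt (fun w => ψ 1 / ψ w) (-(jLog s q + jLog (s ^ 2) q)) 1 := by
    refine ((hasDerivAt_const (1 : ℂ) (ψ 1)).div hψd hψ0).congr_deriv ?_
    field_simp
    ring
  -- The finite part is minus the derivative of ψ(1)/ψ(w) at 1, hence the logarithmic derivative of
  -- ψ there.
  have hR : Tendsto (fun w => ψ 1 / ((1 - w) * ψ w) - 1 / (1 - w)) (𝓝[≠] 1)
      (𝓝 (jLog s q + jLog (s ^ 2) q)) := by
    have := (hasDerivAt_iff_tendsto_slope.1 hslope).neg
    rw [neg_neg] at this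
    refine this.congr' ?_
    filter_upwards [self_mem_nhdsWithin, nhdsWithin_le_nhds
      (hψd.continuousAt.eventually_ne hψ0)] with w hw hw2
    have h1 : w - 1 ≠ 0 := sub_ne_zero.2 hw
    have h2 : 1 - w ≠ 0 := sub_ne_zero.2 (Ne.symm hw)
    rw [slope_def_field, div_self hψ0]
    field_simp
    ring
  have c1 : ContinuousAt (fun w => appell (s ^ 3) (s ^ 2 * w) q) 1 :=
    ContinuousAt.comp (g := fun x => appell (s ^ 3) x q) (f := fun w => s ^ 2 * w)
      (by simpa using continuousAt_appell hq0 hq hs3 hs2 hjs2) (by fun_prop)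
  have c2 : ContinuousAt (fun w => appell 1 (s * w) q) 1 :=
    ContinuousAt.comp (g := fun x => appell 1 x q) (f := fun w => s * w)
      (by simpa using continuousAt_appell hq0 hq one_ne_zero hs hjs) (by fun_prop)
  have hL : Tendsto (fun w => s ^ 3 * appell (s ^ 3) (s ^ 2 * w) q
      + (appell (s ^ 3)⁻¹ w q - 1 / (1 - w))
      - s * (jTheta (s ^ 2) q / jTheta s q) * appell 1 (s * w) q) (𝓝[≠] 1)
      (𝓝 (s ^ 3 * appell (s ^ 3) (s ^ 2) q + appell (s ^ 3)⁻¹ 1 q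
      - s * (jTheta (s ^ 2) q / jTheta s q) * appell 1 s q)) := by
    have c1' := c1.tendsto.mono_left (nhdsWithin_le_nhds (s := {1}ᶜ))
    have c2' := c2.tendsto.mono_left (nhdsWithin_le_nhds (s := {1}ᶜ))
    rw [mul_one] at c1' c2'
    exact ((c1'.const_mul _).add (tendsto_appell_one hq0 hq (inv_ne_zero hs3))).sub
      (c2'.const_mul _)
  refine tendsto_nhds_unique (hL.congr' ?_) hR
  filter_upwards [self_mem_nhdsWithin, nhdsWithin_le_nhds (hψd.continuousAt.eventually_ne hψ0),
    nhdsWithin_le_nhds (isOpen_ne.mem_nhds (one_ne_zero (α := ℂ)))] with w hw hw2 hw0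
  have h2 : 1 - w ≠ 0 := sub_ne_zero.2 (Ne.symm hw)
  simp only [hψ, mul_ne_zero_iff] at hw2
  obtain ⟨⟨n1, n2⟩, n3⟩ := hw2
  have e1 : s * w * s = s ^ 2 * w := by ring
  have e2 : s * w / s = w := by field_simp
  have n4 : jTheta w q ≠ 0 := by rw [jTheta_eq_mul_jReg _ hq]; exact mul_ne_zero h2 n1
  have h := appell_three_term hq0 hq (mul_ne_zero hs hw0) hs hjs n2 (by rwa [e1]) (by rwa [e2])
  rw [e1, e2, ← hψ1, jTheta_eq_mul_jReg w hq, mul_assoc (1 - w), mul_assoc (1 - w)] at h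
  simp only [hψ] at h ⊢
  rw [← h]
  ring

/-! ### Bounds for finite products -/

/-- Factor by factor, |1 - q^i x| ≥ 1 - |q|^(i+1), so the product for the real base |q| bounds all x
at once. -/
theorem exists_norm_inv_qPoch_le_of_norm_le {q : ℂ} (hq : ‖q‖ < 1) :
    ∃ C : ℝ, 0 < C ∧ ∀ x : ℂ, ‖x‖ ≤ ‖q‖ → ∀ n, ‖(qPoch x q n)⁻¹‖ ≤ C := by
  have hr : ‖((‖q‖ : ℝ) : ℂ)‖ < 1 := by simpa using hq
  obtain ⟨C, hC0, hC⟩ := exists_norm_inv_qPoch_le hr (pow_mul_ne_one_of_norm_lt_one hr hr)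
  refine ⟨C, hC0, fun x hx n => le_trans ?_ (hC n)⟩
  rw [norm_inv, norm_inv]
  have hne := qPoch_ne_zero (pow_mul_ne_one_of_norm_lt_one hr hr) n
  refine inv_anti₀ (norm_pos_iff.2 hne) ?_
  rw [qPoch, qPoch, norm_prod, norm_prod]
  refine Finset.prod_le_prod (fun _ _ => norm_nonneg _) fun i _ => ?_
  have h1 : ‖q‖ ^ i * ‖q‖ ≤ 1 :=
    mul_le_one₀ (pow_le_one₀ (norm_nonneg q) hq.le) (norm_nonneg q) hq.le
  have h2 : ‖(1 : ℂ) - (‖q‖ : ℂ) ^ i * (‖q‖ : ℂ)‖ = 1 - ‖q‖ ^ i * ‖q‖ := by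
    rw [← Complex.ofReal_pow, ← Complex.ofReal_mul, ← Complex.ofReal_one, ← Complex.ofReal_sub,
      Complex.norm_real, Real.norm_of_nonneg (by linarith)]
  rw [h2]
  have h3 := norm_sub_norm_le 1 (q ^ i * x)
  rw [norm_one, norm_mul, norm_pow] at h3
  have h4 : ‖q‖ ^ i * ‖x‖ ≤ ‖q‖ ^ i * ‖q‖ := by gcongr
  linarith

theorem summable_norm_pow_sq {q : ℂ} (hq : ‖q‖ < 1) : Summable fun n : ℕ => ‖q‖ ^ n ^ 2 :=
  (summable_geometric_of_lt_one (norm_nonneg q) hq).of_nonneg_of_le (fun _ => by positivity)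
    fun n => pow_le_pow_of_le_one (norm_nonneg q) hq.le (by nlinarith)

/-! ### The series of the universal mock theta function -/

theorem pow_mul_ne_one_of_zpow {q x : ℂ} (h : ∀ n : ℤ, x * q ^ n ≠ 1) (i : ℕ) :
    q ^ i * x ≠ 1 := by
  simpa [mul_comm] using h i

theorem pow_mul_div_ne_one_of_zpow {q x : ℂ} (hq0 : q ≠ 0) (hx : x ≠ 0)
    (h : ∀ n : ℤ, x * q ^ n ≠ 1) (i : ℕ) : q ^ i * (q / x) ≠ 1 := by
  intro hi
  refine h (-(i + 1)) ?_
  have : q ^ ((i : ℤ) + 1) = x := by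
    rw [zpow_add₀ hq0]
    field_simp at hi
    simpa using hi
  rw [zpow_neg, this, mul_inv_cancel₀ hx]

theorem summable_gTerm {q x : ℂ} (hq0 : q ≠ 0) (hq : ‖q‖ < 1) (hx : x ≠ 0)
    (h : ∀ n : ℤ, x * q ^ n ≠ 1) : Summable (gTerm x q) := by
  obtain ⟨C, hC0, hC⟩ := exists_norm_inv_qPoch_le hq (pow_mul_ne_one_of_zpow h)
  obtain ⟨D, hD0, hD⟩ := exists_norm_inv_qPoch_le hq (pow_mul_div_ne_one_of_zpow hq0 hx h)
  refine Summable.of_norm_bounded ((summable_norm_pow_sq hq).mul_right (C * D)) fun n => ?_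
  rw [gTerm, div_eq_mul_inv, mul_inv, norm_mul, norm_mul, norm_pow]
  gcongr
  · exact hC _
  · exact hD _

/-- Partial fractions of the terms of the universal mock theta function. -/
theorem hasSum_partial_fractions {q x : ℂ} (hq0 : q ≠ 0) (hq : ‖q‖ < 1) (hx : x ≠ 0)
    (h : ∀ n : ℤ, x * q ^ n ≠ 1) (n : ℕ) :
    HasSum (fun k : ℤ => (-1) ^ k * q ^ (tri k + k) * (invQ q (n - k) * invQ q (n + k)) /
      (1 - x * q ^ k)) (1 / (qPoch x q (n + 1) * qPoch (q / x) q n)) := by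
  induction n with
  | zero =>
    have := hasSum_single (f := fun k : ℤ => (-1) ^ k * q ^ (tri k + k) *
      (invQ q ((0 : ℕ) - k) * invQ q ((0 : ℕ) + k)) / (1 - x * q ^ k)) 0 (fun k hk => by
        rcases lt_or_gt_of_ne hk with h | h
        · rw [invQ_of_neg q (m := (0 : ℕ) + k) (by push_cast; omega)]; simp
        · rw [invQ_of_neg q (m := (0 : ℕ) - k) (by push_cast; omega)]; simp)
    simpa [qPoch_succ, qPoch_zero, invQ] using this
  | succ n ih =>
    -- After division by the two new factors, the old terms differ from the required ones by
    -- multiples of the terms of the finite triple products at x = 1 and x = q. Both of these have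
    -- sum zero, as (1;q)_(n+1) = 0.
    have j1 := hasSum_finite_jacobi hq0 hq one_ne_zero (n + 1)
    have j2 := hasSum_finite_jacobi hq0 hq hq0 (n + 1)
    have z1 : qPoch 1 q (n + 1) = 0 := by simp [qPoch_succ']
    rw [z1, zero_mul, zero_div] at j1
    rw [div_self hq0, z1, mul_zero, zero_div] at j2
    have d1 : 1 - q ^ (n + 1) * x ≠ 0 := sub_ne_zero.2 (pow_mul_ne_one_of_zpow h _).symm
    have d2 : 1 - q ^ n * (q / x) ≠ 0 :=
      sub_ne_zero.2 (pow_mul_div_ne_one_of_zpow hq0 hx h _).symm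
    have hh := (ih.mul_left ((1 - q ^ (n + 1) * x) * (1 - q ^ n * (q / x)))⁻¹).add
      (((j2.mul_left x⁻¹).sub j1).mul_left
        (-(q ^ (n + 1) / ((1 - q ^ (n + 1) * x) * (1 - q ^ n * (q / x))))))
    refine hh.of_eq (fun k => ?_) ?_
    · have i1 := invQ_sub_one hq (n + 1 - k)
      have i2 := invQ_sub_one hq (n + 1 + k)
      have hK : q ^ k ≠ 0 := zpow_ne_zero _ hq0
      have y1 : q ^ ((n : ℤ) + 1 - k) = q ^ n * q / q ^ k := by
        rw [zpow_sub₀ hq0, zpow_add₀ hq0]; simp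
      have y2 : q ^ ((n : ℤ) + 1 + k) = q ^ n * q * q ^ k := by
        rw [zpow_add₀ hq0, zpow_add₀ hq0]; simp
      rw [y1, show (n : ℤ) + 1 - k - 1 = n - k by ring] at i1
      rw [y2, show (n : ℤ) + 1 + k - 1 = n + k by ring] at i2
      have d3 : 1 - x * q ^ k ≠ 0 := sub_ne_zero.2 (h k).symm
      push_cast
      rw [i1, i2, one_zpow, zpow_add₀ hq0]
      rw [pow_succ] at d1 ⊢
      generalize invQ q (n + 1 - k) = u
      generalize invQ q (n + 1 + k) = v
      generalize (-1 : ℂ) ^ k = s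
      generalize q ^ tri k = T
      rw [← sub_eq_zero]
      have d12 := mul_ne_zero d1 d2
      clear hh j1 j2 ih i1 i2 y1 y2 z1 h
      generalize q ^ n = N at *
      generalize q ^ k = K at *
      set D := (1 - N * q * x) * (1 - N * (q / x)) with hD
      have hD' : D * x = (1 - N * q * x) * (x - N * q) := by rw [hD]; field_simp
      clear_value D
      have d3' : 1 - K * x ≠ 0 := by rwa [mul_comm]
      field_simp
      linear_combination (K * s * T * u * v) * hD'
    · rw [qPoch_succ x q (n + 1), qPoch_succ (q / x) q n]
      have e1 := qPoch_ne_zero (pow_mul_ne_one_of_zpow h) (n + 1)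
      have e2 := qPoch_ne_zero (pow_mul_div_ne_one_of_zpow hq0 hx h) n
      simp only [mul_zero, sub_self, add_zero, one_div, mul_inv]
      ring

/-- The summands of Cauchy's series. -/
def cauchyTerm (q : ℂ) (k m : ℕ) : ℂ := q ^ (m ^ 2 + m * k) * (invQ q m * invQ q (m + k))

theorem norm_cauchyTerm_le {q : ℂ} (hq : ‖q‖ < 1) {C : ℝ}
    (hC : ∀ m, ‖invQ q m‖ ≤ C) (k m : ℕ) : ‖cauchyTerm q k m‖ ≤ ‖q‖ ^ m ^ 2 * (C * C) := by
  have hC0 : 0 ≤ C := (norm_nonneg _).trans (hC 0)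
  rw [cauchyTerm, norm_mul, norm_mul, norm_pow]
  refine mul_le_mul (pow_le_pow_of_le_one (norm_nonneg q) hq.le (by omega))
    (mul_le_mul (hC _) (hC _) (norm_nonneg _) hC0) (by positivity) (by positivity)

theorem summable_cauchyTerm {q : ℂ} (hq : ‖q‖ < 1) (k : ℕ) : Summable (cauchyTerm q k) := by
  obtain ⟨C, -, hC⟩ := exists_norm_invQ_le hq
  exact Summable.of_norm_bounded ((summable_norm_pow_sq hq).mul_right _)
    (norm_cauchyTerm_le hq hC k)

/-- The auxiliary series `w` is summed in two ways: by applying `invQ_sub_one` to both factors, and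
by shifting m past its vanishing first term. -/
theorem tsum_cauchyTerm_sub {q : ℂ} (hq : ‖q‖ < 1) (k : ℕ) :
    (∑' m, cauchyTerm q k m) - ∑' m, cauchyTerm q (k + 1) m =
      -q ^ (k + 1) * ((∑' m, cauchyTerm q (k + 1) m) - ∑' m, cauchyTerm q (k + 2) m) := by
  have s0 := summable_cauchyTerm hq k
  have s1 := summable_cauchyTerm hq (k + 1)
  have s2 := summable_cauchyTerm hq (k + 2)
  set w : ℕ → ℂ := fun m => q ^ (m ^ 2 + m * k) * (invQ q (m - 1) * invQ q (m + k + 1)) with hw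
  have hw1 : ∀ m, w m = cauchyTerm q k m - cauchyTerm q (k + 1) m +
      q ^ (k + 1) * cauchyTerm q (k + 1) m := by
    intro m
    have i1 := invQ_sub_one hq m
    have i2 := invQ_sub_one hq (m + k + 1)
    rw [add_sub_cancel_right] at i2
    have y : q ^ ((m : ℤ) + k + 1) = q ^ (m + k + 1) := by exact_mod_cast zpow_natCast q (m + k + 1)
    rw [y] at i2
    rw [zpow_natCast] at i1
    simp only [hw, cauchyTerm]
    push_cast
    rw [i1, i2, ← add_assoc]
    ring
  have hw2 : ∀ m, w (m + 1) = q ^ (k + 1) * cauchyTerm q (k + 2) m := by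
    intro m
    simp only [hw, cauchyTerm]
    push_cast
    rw [add_sub_cancel_right, show (m : ℤ) + 1 + k + 1 = m + (k + 2) by ring]
    ring
  have hw0 : w 0 = 0 := by simp [hw, invQ_of_neg]
  have sw : Summable w := by
    rw [funext hw1]; exact (s0.sub s1).add (s1.mul_left _)
  have t1 : ∑' m, w m = q ^ (k + 1) * ∑' m, cauchyTerm q (k + 2) m := by
    rw [sw.tsum_eq_zero_add, hw0, zero_add, ← tsum_mul_left]
    exact tsum_congr hw2
  have t2 : ∑' m, w m = (∑' m, cauchyTerm q k m) - ∑' m, cauchyTerm q (k + 1) m +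
      q ^ (k + 1) * ∑' m, cauchyTerm q (k + 1) m := by
    rw [tsum_congr hw1, (s0.sub s1).tsum_add (s1.mul_left _), s0.tsum_sub s1, tsum_mul_left]
  linear_combination t1 - t2

/-- By `tsum_cauchyTerm_sub` the consecutive differences do not decrease in norm as k grows, yet
they tend to 0, so they all vanish. The sum is thus independent of k and equals its limit as k → ∞,
where only m = 0 survives. -/
theorem tsum_cauchyTerm {q : ℂ} (hq : ‖q‖ < 1) (k : ℕ) :
    ∑' m, cauchyTerm q k m = (qPochInf q q)⁻¹ := by
  obtain ⟨C, hC0, hC⟩ := exists_norm_invQ_le hq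
  have hlim : Tendsto (fun k => ∑' m, cauchyTerm q k m) atTop
      (𝓝 (∑' m : ℕ, if m = 0 then (qPochInf q q)⁻¹ else 0)) := by
    refine tendsto_tsum_of_dominated_convergence ((summable_norm_pow_sq hq).mul_right (C * C))
      (fun m => ?_) (Eventually.of_forall fun k => norm_cauchyTerm_le hq hC k)
    rcases Nat.eq_zero_or_pos m with rfl | hm
    · simpa [cauchyTerm, invQ_natCast, qPoch_zero, show invQ q 0 = 1 by simp [invQ, qPoch_zero]] using
        (tendsto_qPoch q hq).inv₀ (qPochInf_self_ne_zero hq)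
    · rw [if_neg hm.ne']
      refine squeeze_zero_norm (a := fun k => ‖q‖ ^ k * (C * C)) (fun k => ?_) ?_
      · rw [cauchyTerm, norm_mul, norm_mul, norm_pow]
        refine mul_le_mul (pow_le_pow_of_le_one (norm_nonneg q) hq.le (by nlinarith))
          (mul_le_mul (hC _) (hC _) (norm_nonneg _) hC0.le) (by positivity) (by positivity)
      · simpa using (tendsto_pow_atTop_nhds_zero_of_lt_one (norm_nonneg q) hq).mul_const (C * C)
  rw [tsum_ite_eq] at hlim
  set c := fun k => ∑' m, cauchyTerm q k m with hc
  have hstep : ∀ k, ‖c k - c (k + 1)‖ ≤ ‖q‖ * ‖c (k + 1) - c (k + 2)‖ := by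
    intro k
    simp only [hc]
    rw [tsum_cauchyTerm_sub hq k, norm_mul, norm_neg, norm_pow]
    gcongr
    exact pow_le_of_le_one (norm_nonneg q) hq.le (by omega)
  have hiter : ∀ j k, ‖c k - c (k + 1)‖ ≤ ‖c (k + j) - c (k + j + 1)‖ := by
    intro j
    induction j with
    | zero => intro k; rfl
    | succ j ih =>
      intro k
      refine (ih k).trans ((hstep (k + j)).trans ?_)
      exact mul_le_of_le_one_left (norm_nonneg _) hq.le
  have hconst : ∀ k, c k = c (k + 1) := by
    intro k
    have l1 : Tendsto (fun j => ‖c (k + j) - c (k + j + 1)‖) atTop (𝓝 0) := by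
      have a1 : Tendsto (fun j => c (k + j)) atTop (𝓝 (qPochInf q q)⁻¹) :=
        hlim.comp (tendsto_add_atTop_nat k |>.congr fun j => add_comm j k)
      have a2 : Tendsto (fun j => c (k + j + 1)) atTop (𝓝 (qPochInf q q)⁻¹) :=
        hlim.comp (tendsto_add_atTop_nat (k + 1) |>.congr fun j => by omega)
      simpa using (a1.sub a2).norm
    have l2 := ge_of_tendsto' l1 fun j => hiter j k
    exact sub_eq_zero.1 (norm_le_zero_iff.1 l2)
  have hall : ∀ k, c k = c 0 := fun k => by
    induction k with
    | zero => rfl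
    | succ k ih => rw [← hconst, ih]
  have l3 : Tendsto c atTop (𝓝 (c k)) := by
    rw [hall k]
    exact tendsto_const_nhds.congr fun j => (hall j).symm
  exact tendsto_nhds_unique l3 hlim

/-- **Cauchy's identity**, the Durfee rectangle dissection. -/
theorem hasSum_durfee {q : ℂ} (hq : ‖q‖ < 1) (k : ℤ) :
    HasSum (fun n : ℕ => q ^ n ^ 2 * (invQ q (n - k) * invQ q (n + k)))
      (q ^ (k ^ 2) * (qPochInf q q)⁻¹) := by
  wlog hk : 0 ≤ k generalizing k
  · have := this (-k) (by omega)
    simp only [sub_neg_eq_add, neg_sq, ← sub_eq_add_neg] at this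
    refine this.of_eq (fun n => by ring) rfl
  obtain ⟨l, rfl⟩ := Int.eq_ofNat_of_zero_le hk
  rw [← hasSum_nat_add_iff' l]
  have h0 : ∑ i ∈ Finset.range l, q ^ i ^ 2 * (invQ q (i - (l : ℤ)) * invQ q (i + (l : ℤ))) = 0 :=
    Finset.sum_eq_zero fun i hi => by
      rw [invQ_of_neg q (m := i - (l : ℤ)) (by have := Finset.mem_range.1 hi; omega)]; simp
  rw [h0, sub_zero]
  have h := (summable_cauchyTerm hq (2 * l)).hasSum
  rw [tsum_cauchyTerm hq] at h
  refine (h.mul_left (q ^ l ^ 2)).of_eq (fun m => ?_) ?_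
  · rw [cauchyTerm]
    push_cast
    rw [add_sub_cancel_right, show (m : ℤ) + l + l = m + 2 * l by ring]
    ring
  · congr 1

/-- The Appell sum of the universal mock theta function. -/
theorem qPochInf_mul_tsum_gTerm {q x : ℂ} (hq0 : q ≠ 0) (hq : ‖q‖ < 1) (hx : x ≠ 0)
    (h : ∀ n : ℤ, x * q ^ n ≠ 1) :
    qPochInf q q * ∑' n, gTerm x q n =
      ∑' k : ℤ, (-1) ^ k * q ^ (3 * tri k + 2 * k) / (1 - x * q ^ k) := by
  obtain ⟨C, hC0, hC⟩ := exists_norm_invQ_le hq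
  obtain ⟨D, hD0, hD⟩ := exists_norm_inv_one_sub_le hq0 hq hx
  have hE := qPochInf_self_ne_zero hq
  obtain ⟨F, hF⟩ : ∃ F : ℕ → ℤ → ℂ, ∀ n k, F n k = q ^ n ^ 2 * ((-1) ^ k * q ^ (tri k + k) *
    (invQ q (n - k) * invQ q (n + k)) / (1 - x * q ^ k)) := ⟨_, fun _ _ => rfl⟩
  have e1 : ∀ n, gTerm x q n = ∑' k : ℤ, F n k := by
    intro n
    simp_rw [hF]
    rw [tsum_mul_left, (hasSum_partial_fractions hq0 hq hx h n).tsum_eq, gTerm]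
    ring
  have hs : Summable (Function.uncurry F) := by
    have hb := ((summable_norm_pow_sq hq).mul_of_nonneg
      (summable_norm_zpow_mul_zpow_tri hq0 hq hq0) (fun _ => by positivity)
      (fun _ => by positivity)).mul_right (C * C * D)
    refine Summable.of_norm_bounded hb fun p => ?_
    rw [Function.uncurry, hF, norm_mul, div_eq_mul_inv, norm_mul, norm_mul, norm_mul, norm_mul (invQ q _), norm_pow,
      norm_zpow, norm_zpow, norm_neg, norm_one, one_zpow, one_mul,
      zpow_add₀ (norm_ne_zero_iff.2 hq0)]
    have hCC : ‖invQ q (p.1 - p.2)‖ * ‖invQ q (p.1 + p.2)‖ ≤ C * C :=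
      mul_le_mul (hC _) (hC _) (norm_nonneg _) hC0.le
    calc _ ≤ ‖q‖ ^ p.1 ^ 2 * (‖q‖ ^ tri p.2 * ‖q‖ ^ p.2 * (C * C) * D) := by
          gcongr
          exact hD _
      _ = _ := by ring
  -- With the order of summation exchanged, the sum over n is the Durfee rectangle identity.
  rw [tsum_congr e1, ← Summable.tsum_comm hs, ← tsum_mul_left]
  refine tsum_congr fun k => ?_
  have e2 : ∀ n : ℕ, F n k = (-1) ^ k * q ^ (tri k + k) / (1 - x * q ^ k) *
        (q ^ n ^ 2 * (invQ q (n - k) * invQ q (n + k))) := fun n => by rw [hF]; ring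
  rw [tsum_congr e2, tsum_mul_left, (hasSum_durfee hq k).tsum_eq]
  have e3 : q ^ (3 * tri k + 2 * k) = q ^ (tri k + k) * q ^ (k ^ 2) := by
    rw [← zpow_add₀ hq0]
    congr 1
    linear_combination two_mul_tri k
  rw [e3]
  field_simp

/-- The split q^(2k)/(1 - xq^k) = x q^(3k)/(1 - xq^k) + q^(2k) leaves a pentagonal series, which
accounts for the -1 in the definition of g. -/
theorem appell_one_eq {q x : ℂ} (hq0 : q ≠ 0) (hq : ‖q‖ < 1) (hx : x ≠ 0)
    (h : ∀ n : ℤ, x * q ^ n ≠ 1) : appell 1 x q = qPochInf q q * gMock x q := by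
  have hq3 := pow_ne_zero 3 hq0
  have hq3' := norm_pow_lt_one hq three_ne_zero
  have h2 := hasSum_jTheta hq3 hq3' (pow_ne_zero 2 hq0)
  have t3 : jTheta (q ^ 2) (q ^ 3) = qPochInf q q := by
    rw [← jTheta_self_cube hq0 hq, ← jTheta_div hq3 q]; congr 1; field_simp
  rw [t3] at h2
  have hA := (summable_appell hq0 hq one_ne_zero hx).hasSum
  have e : ∀ k : ℤ, (-1) ^ k * q ^ (3 * tri k + 2 * k) / (1 - x * q ^ k) =
      x * (appellCoeff 1 q k / (1 - x * q ^ k)) + (-1) ^ k * (q ^ 3) ^ tri k * (q ^ 2) ^ k := by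
    intro k
    have hk := sub_ne_zero.2 (h k).symm
    rw [appellCoeff, one_zpow, show 3 * tri k + 3 * k = 3 * tri k + 2 * k + k by ring,
      zpow_add₀ hq0 _ k, zpow_add₀ hq0, pow_zpow, pow_zpow]
    push_cast
    field_simp
    ring
  have := qPochInf_mul_tsum_gTerm hq0 hq hx h
  rw [tsum_congr e, ((hA.mul_left x).add h2).tsum_eq] at this
  rw [gMock]
  change _ = x * appell 1 x q + _ at this
  field_simp
  linear_combination -this

/-! ### The Rogers–Fine identity -/

/-- The series `1 + ∑_{m ≥ 1} b (z q) ^ m / (b q; q)_m`. -/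
def fineSeries (b z q : ℂ) : ℂ := 1 + ∑' m : ℕ, b * (z * q) ^ (m + 1) / qPoch (b * q) q (m + 1)

theorem summable_fineSeries {b z q : ℂ} (hq : ‖q‖ < 1) (hb : ‖b‖ ≤ 1) (hz : ‖z‖ ≤ 1) :
    Summable fun m : ℕ => b * (z * q) ^ (m + 1) / qPoch (b * q) q (m + 1) := by
  obtain ⟨C, hC0, hC⟩ := exists_norm_inv_qPoch_le_of_norm_le hq
  have hbq : ‖b * q‖ ≤ ‖q‖ := by
    rw [norm_mul]; exact mul_le_of_le_one_left (norm_nonneg q) hb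
  have hzq : ‖z * q‖ < 1 := by
    rw [norm_mul]; exact (mul_le_of_le_one_left (norm_nonneg q) hz).trans_lt hq
  refine Summable.of_norm_bounded (((summable_nat_add_iff 1).2
    (summable_geometric_of_lt_one (norm_nonneg _) hzq)).mul_right C) fun m => ?_
  rw [div_eq_mul_inv, norm_mul, norm_mul, norm_pow]
  have := mul_le_of_le_one_left (pow_nonneg (norm_nonneg (z * q)) (m + 1)) hb
  exact mul_le_mul this (hC _ hbq _) (norm_nonneg _) (by positivity)

theorem exists_norm_fineSeries_le {q : ℂ} (hq : ‖q‖ < 1) :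
    ∃ M : ℝ, ∀ b z : ℂ, ‖b‖ ≤ 1 → ‖z‖ ≤ 1 → ‖fineSeries b z q‖ ≤ M := by
  obtain ⟨C, hC0, hC⟩ := exists_norm_inv_qPoch_le_of_norm_le hq
  have hg := ((summable_nat_add_iff 1).2
    (summable_geometric_of_lt_one (norm_nonneg q) hq)).mul_right C
  refine ⟨1 + ∑' m : ℕ, ‖q‖ ^ (m + 1) * C, fun b z hb hz => ?_⟩
  have hbq : ‖b * q‖ ≤ ‖q‖ := by
    rw [norm_mul]; exact mul_le_of_le_one_left (norm_nonneg q) hb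
  have hzq : ‖z * q‖ ≤ ‖q‖ := by
    rw [norm_mul]; exact mul_le_of_le_one_left (norm_nonneg q) hz
  refine (norm_add_le _ _).trans ?_
  rw [norm_one]
  gcongr
  refine tsum_of_norm_bounded hg.hasSum fun m => ?_
  rw [div_eq_mul_inv, norm_mul, norm_mul, norm_pow]
  have h1 := mul_le_of_le_one_left (pow_nonneg (norm_nonneg (z * q)) (m + 1)) hb
  have h2 : ‖z * q‖ ^ (m + 1) ≤ ‖q‖ ^ (m + 1) := by gcongr
  exact mul_le_mul (h1.trans h2) (hC _ hbq _) (norm_nonneg _) (by positivity)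

/-- Up to a constant, the terms of the series at (bq, zq) are a term of the series at (b, z) minus
zq times its predecessor. Summation yields a linear equation for the original series. -/
theorem fineSeries_eq {b z q : ℂ} (hq0 : q ≠ 0) (hq : ‖q‖ < 1) (hb : ‖b‖ ≤ 1) (hz : ‖z‖ ≤ 1)
    (hz0 : z ≠ 0) :
    fineSeries b z q = 1 + b * z * q / ((1 - z * q) * (1 - b * q)) *
      fineSeries (b * q) (z * q) q := by
  have hbq : ‖b * q‖ ≤ ‖q‖ := by
    rw [norm_mul]; exact mul_le_of_le_one_left (norm_nonneg q) hb
  have hzq : ‖z * q‖ ≤ ‖q‖ := by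
    rw [norm_mul]; exact mul_le_of_le_one_left (norm_nonneg q) hz
  have hne := pow_mul_ne_one_of_norm_lt_one hq (hbq.trans_lt hq)
  have hne0 : 1 - b * q ≠ 0 := sub_ne_zero.2 (by simpa using (hne 0).symm)
  have hz1 : 1 - z * q ≠ 0 := sub_ne_zero.2 fun h => by
    rw [← h, norm_one] at hzq; linarith
  have s1 := summable_fineSeries hq hb hz
  have s2 := summable_fineSeries (b := b * q) (z := z * q) hq (hbq.trans hq.le) (hzq.trans hq.le)
  have s3 := (summable_nat_add_iff 1).2 s1
  have e : ∀ m : ℕ, b * (z * q / (1 - b * q) * (b * q * (z * q * q) ^ (m + 1) /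
      qPoch (b * q * q) q (m + 1))) = b * (z * q) ^ (m + 1 + 1) / qPoch (b * q) q (m + 1 + 1) -
      z * q * (b * (z * q) ^ (m + 1) / qPoch (b * q) q (m + 1)) := by
    intro m
    have p1 : qPoch (b * q) q (m + 1 + 1) = (1 - b * q) * qPoch (b * q * q) q (m + 1) := by
      rw [qPoch_succ', mul_comm q]
    have p2 : qPoch (b * q) q (m + 1 + 1) =
        qPoch (b * q) q (m + 1) * (1 - q ^ (m + 1) * (b * q)) := qPoch_succ _ _ _
    have n1 := qPoch_ne_zero hne (m + 1)
    have n2 := qPoch_ne_zero hne (m + 1 + 1)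
    have n3 : qPoch (b * q * q) q (m + 1) ≠ 0 := by
      intro h; rw [p1, h, mul_zero] at n2; exact n2 rfl
    have p3 : qPoch (b * q * q) q (m + 1) =
        qPoch (b * q) q (m + 1) * (1 - q ^ (m + 1) * (b * q)) / (1 - b * q) := by
      rw [← p2, p1]; field_simp
    have n4 : 1 - q ^ (m + 1) * (b * q) ≠ 0 := sub_ne_zero.2 (hne _).symm
    rw [p2, p3]
    generalize qPoch (b * q) q (m + 1) = P at *
    have : (z * q * q) ^ (m + 1) = (z * q) ^ (m + 1) * q ^ (m + 1) := mul_pow _ _ _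
    rw [this, pow_succ (z * q) (m + 1)]
    generalize q ^ (m + 1) = N at *
    generalize (z * q) ^ (m + 1) = Z at *
    generalize 1 - b * q = t at *
    have n5 : 1 - b * q * N ≠ 0 := by rwa [mul_comm]
    field_simp
    ring
  have t := tsum_congr (L := .unconditional ℕ) e
  rw [tsum_mul_left, tsum_mul_left, s3.tsum_sub (s1.mul_left _), tsum_mul_left] at t
  have t2 := s1.tsum_eq_zero_add
  simp only [zero_add, pow_one] at t2
  rw [qPoch_succ, qPoch_zero, pow_zero, one_mul, one_mul] at t2
  rw [fineSeries, fineSeries]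
  generalize (∑' m : ℕ, b * (z * q) ^ (m + 1) / qPoch (b * q) q (m + 1)) = S at *
  generalize (∑' m : ℕ, b * (z * q) ^ (m + 1 + 1) / qPoch (b * q) q (m + 1 + 1)) = S' at *
  generalize (∑' m : ℕ, b * q * (z * q * q) ^ (m + 1) / qPoch (b * q * q) q (m + 1)) = R at *
  have hS : S * (1 - z * q) = b * (z * q) / (1 - b * q) +
      b * (z * q / (1 - b * q) * R) := by linear_combination t2 - t
  rw [eq_comm, ← sub_eq_zero]
  have : S = (b * (z * q) / (1 - b * q) + b * (z * q / (1 - b * q) * R)) / (1 - z * q) := by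
    rw [eq_div_iff hz1, hS]
  rw [this]
  field_simp
  ring

/-- N applications of `fineSeries_eq` produce the first N terms and a remainder carrying q^(N²); by
`exists_norm_fineSeries_le` its last factor stays bounded. -/
theorem hasSum_fineSeries {z q : ℂ} (hq0 : q ≠ 0) (hq : ‖q‖ < 1) (hz : ‖z‖ = 1) :
    HasSum (fun n : ℕ => q ^ n ^ 2 / (qPoch (z * q) q n * qPoch (q / z) q n))
      (fineSeries z⁻¹ z q) := by
  obtain ⟨C, hC0, hC⟩ := exists_norm_inv_qPoch_le_of_norm_le hq
  obtain ⟨M, hM⟩ := exists_norm_fineSeries_le hq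
  have hz0 : z ≠ 0 := norm_ne_zero_iff.1 (by rw [hz]; exact one_ne_zero)
  have hzq : ‖z * q‖ ≤ ‖q‖ := by rw [norm_mul, hz, one_mul]
  have hbq : ‖q / z‖ ≤ ‖q‖ := by rw [norm_div, hz, div_one]
  have hterm : ∀ n : ℕ, ‖q ^ n ^ 2 / (qPoch (z * q) q n * qPoch (q / z) q n)‖ ≤
      ‖q‖ ^ n ^ 2 * (C * C) := by
    intro n
    rw [div_eq_mul_inv, mul_inv, norm_mul, norm_mul, norm_pow]
    gcongr
    · exact hC _ hzq _
    · exact hC _ hbq _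
  have hsum := Summable.of_norm_bounded ((summable_norm_pow_sq hq).mul_right (C * C)) hterm
  have hqN : ∀ N, ‖q ^ N‖ ≤ 1 := fun N => by
    rw [norm_pow]; exact pow_le_one₀ (norm_nonneg q) hq.le
  have hfin : ∀ N : ℕ, fineSeries z⁻¹ z q =
      (∑ n ∈ Finset.range N, q ^ n ^ 2 / (qPoch (z * q) q n * qPoch (q / z) q n)) +
      q ^ N ^ 2 / (qPoch (z * q) q N * qPoch (q / z) q N) *
        fineSeries (z⁻¹ * q ^ N) (z * q ^ N) q := by
    intro N
    induction N with
    | zero => simp [qPoch_zero]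
    | succ N ih =>
      have a1 : ‖z⁻¹ * q ^ N‖ ≤ 1 := by
        rw [norm_mul, norm_inv, hz, inv_one, one_mul]; exact hqN N
      have a2 : ‖z * q ^ N‖ ≤ 1 := by rw [norm_mul, hz, one_mul]; exact hqN N
      have a3 : z * q ^ N ≠ 0 := mul_ne_zero hz0 (pow_ne_zero N hq0)
      rw [ih, fineSeries_eq hq0 hq a1 a2 a3, Finset.sum_range_succ, qPoch_succ, qPoch_succ]
      have b1 : z⁻¹ * q ^ N * q = z⁻¹ * q ^ (N + 1) := by ring
      have b2 : z * q ^ N * q = z * q ^ (N + 1) := by ring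
      have b3 : q ^ N * (z * q) = z * q ^ (N + 1) := by ring
      have b4 : q ^ N * (q / z) = z⁻¹ * q ^ (N + 1) := by ring
      have b5 : z⁻¹ * q ^ N * (z * q ^ N) * q = q ^ (2 * N + 1) := by field_simp; ring
      rw [b1, b2, b3, b4, b5]
      simp only [div_eq_mul_inv, mul_inv]
      ring
  have hrem : Tendsto (fun N : ℕ => q ^ N ^ 2 / (qPoch (z * q) q N * qPoch (q / z) q N) *
      fineSeries (z⁻¹ * q ^ N) (z * q ^ N) q) atTop (𝓝 0) := by
    refine squeeze_zero_norm (a := fun N : ℕ => ‖q‖ ^ N ^ 2 * (C * C) * M) (fun N => ?_) ?_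
    · rw [norm_mul]
      refine mul_le_mul (hterm N) (hM _ _ ?_ ?_) (norm_nonneg _) (by positivity)
      · rw [norm_mul, norm_inv, hz, inv_one, one_mul]; exact hqN N
      · rw [norm_mul, hz, one_mul]; exact hqN N
    · simpa using ((summable_norm_pow_sq hq).tendsto_atTop_zero.mul_const (C * C)).mul_const M
  have hlim := hsum.hasSum.tendsto_sum_nat.add hrem
  rw [add_zero] at hlim
  have : (∑' n : ℕ, q ^ n ^ 2 / (qPoch (z * q) q n * qPoch (q / z) q n)) = fineSeries z⁻¹ z q :=
    tendsto_nhds_unique hlim (tendsto_const_nhds.congr hfin)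
  rw [← this]
  exact hsum.hasSum

/-! ### Generating functions of partitions -/

theorem Nat.Partition.sup_parts_le_iff {n : ℕ} (p : n.Partition) (m : ℕ) :
    p.parts.sup ≤ m ↔ ∀ i ∈ p.parts, i ≤ m := Multiset.sup_le

theorem Nat.Partition.sup_parts_le {n : ℕ} (p : n.Partition) : p.parts.sup ≤ n :=
  (p.sup_parts_le_iff n).2 fun _ hi => (Multiset.le_sum_of_mem hi).trans p.parts_sum.le

/-- The sum of `w ^ (number of parts)` over the partitions of `n` with parts at most `m`. -/
def partSum (w : ℂ) (m n : ℕ) : ℂ :=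
  ∑ p : n.Partition with p.parts.sup ≤ m, w ^ Multiset.card p.parts

theorem partSum_succ_of_lt (w : ℂ) {m n : ℕ} (h : n < m + 1) :
    partSum w (m + 1) n = partSum w m n := by
  unfold partSum
  congr 1
  ext p
  have := p.sup_parts_le
  simp only [Finset.mem_filter, Finset.mem_univ, true_and]
  omega

/-- Either m + 1 is not a part, or one copy of it can be removed at the price of a factor w. -/
theorem partSum_succ_add (w : ℂ) (m n : ℕ) :
    partSum w (m + 1) (n + (m + 1)) = partSum w m (n + (m + 1)) + w * partSum w (m + 1) n := by
  unfold partSum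
  rw [← Finset.sum_filter_not_add_sum_filter _ fun p : (n + (m + 1)).Partition => m + 1 ∈ p.parts]
  congr 1
  · rw [Finset.filter_filter]
    refine Finset.sum_congr (Finset.filter_congr fun p _ => ?_) fun _ _ => rfl
    rw [p.sup_parts_le_iff, p.sup_parts_le_iff]
    constructor
    · rintro ⟨h1, h2⟩ i hi
      exact Nat.lt_succ_iff.1 (lt_of_le_of_ne (h1 i hi) fun h => h2 (by rwa [h] at hi))
    · intro h
      exact ⟨fun i hi => (h i hi).trans (Nat.le_succ m), fun h' => by have := h _ h'; omega⟩
  · rw [Finset.mul_sum]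
    symm
    refine Finset.sum_bij' (fun p _ => (⟨(m + 1) ::ₘ p.parts, fun {i} hi => by
        rcases Multiset.mem_cons.1 hi with rfl | hi
        · omega
        · exact p.parts_pos hi, by rw [Multiset.sum_cons, p.parts_sum]; omega⟩ :
          (n + (m + 1)).Partition))
      (fun p hp => (⟨p.parts.erase (m + 1), fun {i} hi =>
        p.parts_pos (Multiset.mem_of_mem_erase hi), by
          have h1 := Multiset.sum_erase (Finset.mem_filter.1 hp).2
          rw [p.parts_sum] at h1
          omega⟩ : n.Partition)) ?_ ?_ ?_ ?_ ?_
    · intro p hp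
      have := (Finset.mem_filter.1 hp).2
      simp only [Finset.mem_filter, Finset.mem_univ, true_and, Multiset.mem_cons_self, and_true,
        Multiset.sup_cons]
      exact max_le le_rfl this
    · intro p hp
      have := (Finset.mem_filter.1 (Finset.mem_filter.1 hp).1).2
      simp only [Finset.mem_filter, Finset.mem_univ, true_and]
      exact (Multiset.sup_mono (Multiset.subset_of_le (Multiset.erase_le _ _))).trans this
    · intro p hp
      ext1
      simp
    · intro p hp
      ext1
      exact Multiset.cons_erase (Finset.mem_filter.1 hp).2
    · intro p hp
      simp [pow_succ, mul_comm]

theorem partSum_zero (w : ℂ) (n : ℕ) : partSum w 0 n = if n = 0 then 1 else 0 := by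
  unfold partSum
  split_ifs with h
  · subst h
    simp
  · refine Finset.sum_eq_zero fun p hp => absurd p.parts_sum ?_
    have h1 := (p.sup_parts_le_iff 0).1 (Finset.mem_filter.1 hp).2
    have : p.parts = 0 := Multiset.eq_zero_of_forall_notMem fun i hi => by
      have h2 := h1 i hi
      have h3 := p.parts_pos hi
      omega
    rw [this]
    simpa using Ne.symm h

/-- The recurrence says B = A + w q^d B for the generating functions. Convergence of B comes from
the same inequality for partial sums of norms, because |q|^d < 1. -/
theorem hasSum_mul_pow_of_recurrence {a b : ℕ → ℂ} {w q A : ℂ} {d : ℕ} (hd : d ≠ 0)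
    (hq : ‖q‖ < 1) (hw : ‖w‖ ≤ 1) (h1 : ∀ n < d, b n = a n) (h2 : ∀ n, b (n + d) = a (n + d) + w * b n)
    (ha : HasSum (fun n => a n * q ^ n) A) (ha' : Summable fun n => ‖a n * q ^ n‖) :
    HasSum (fun n => b n * q ^ n) (A / (1 - w * q ^ d)) := by
  set e : ℕ → ℂ := fun n => if n < d then 0 else b (n - d) * q ^ (n - d) with he
  have hbe : ∀ n, b n * q ^ n = a n * q ^ n + w * q ^ d * e n := by
    intro n
    simp only [he]
    split_ifs with hn
    · rw [h1 n hn]; ring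
    · obtain ⟨k, rfl⟩ := Nat.exists_eq_add_of_le' (not_lt.1 hn)
      rw [Nat.add_sub_cancel, h2, pow_add]
      ring
  have hqd : ‖q‖ ^ d < 1 := pow_lt_one₀ (norm_nonneg q) hq hd
  have hsum_e : ∀ N, ∑ n ∈ Finset.range N, ‖e n‖ ≤ ∑ n ∈ Finset.range N, ‖b n * q ^ n‖ := by
    intro N
    have : ∑ n ∈ Finset.range (N + d), ‖e n‖ = ∑ n ∈ Finset.range N, ‖b n * q ^ n‖ := by
      rw [add_comm, Finset.sum_range_add]
      have z : ∑ n ∈ Finset.range d, ‖e n‖ = 0 := Finset.sum_eq_zero fun n hn => by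
        simp [he, Finset.mem_range.1 hn]
      rw [z, zero_add]
      exact Finset.sum_congr rfl fun n _ => by simp [he]
    rw [← this]
    exact Finset.sum_le_sum_of_subset_of_nonneg
      (Finset.range_mono (Nat.le_add_right N d)) fun _ _ _ => norm_nonneg _
  have hbs : Summable fun n => ‖b n * q ^ n‖ := by
    refine summable_of_sum_range_le (c := (∑' n, ‖a n * q ^ n‖) / (1 - ‖q‖ ^ d))
      (fun _ => norm_nonneg _) fun N => ?_
    rw [le_div_iff₀ (by linarith)]
    have i1 : ∑ n ∈ Finset.range N, ‖b n * q ^ n‖ ≤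
        ∑ n ∈ Finset.range N, (‖a n * q ^ n‖ + ‖q‖ ^ d * ‖e n‖) := by
      refine Finset.sum_le_sum fun n _ => ?_
      rw [hbe n]
      refine (norm_add_le _ _).trans ?_
      rw [norm_mul (w * q ^ d), norm_mul w, norm_pow]
      have := mul_le_of_le_one_left (pow_nonneg (norm_nonneg q) d) hw
      gcongr
    rw [Finset.sum_add_distrib, ← Finset.mul_sum] at i1
    have i2 := ha'.sum_le_tsum (Finset.range N) fun _ _ => norm_nonneg _
    have i3 := mul_le_mul_of_nonneg_left (hsum_e N) (pow_nonneg (norm_nonneg q) d)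
    linarith
  have hb := hbs.of_norm.hasSum
  set B := ∑' n, b n * q ^ n
  have hee : HasSum e B := by
    rw [← hasSum_nat_add_iff' d]
    have z : ∑ n ∈ Finset.range d, e n = 0 := Finset.sum_eq_zero fun n hn => by
      simp [he, Finset.mem_range.1 hn]
    rw [z, sub_zero]
    exact hb.of_eq (fun n => by simp [he]) rfl
  have hB : B = A + w * q ^ d * B :=
    hb.unique ((ha.add (hee.mul_left (w * q ^ d))).of_eq hbe rfl)
  have hne : 1 - w * q ^ d ≠ 0 := sub_ne_zero.2 fun h => by
    have h3 : ‖w * q ^ d‖ ≤ 1 * ‖q‖ ^ d := by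
      rw [norm_mul, norm_pow]; gcongr
    rw [← h, norm_one] at h3
    linarith
  refine hb.of_eq (fun _ => rfl) ?_
  rw [div_eq_iff hne]
  linear_combination -hB

theorem hasSum_partSum {w q : ℂ} (hq : ‖q‖ < 1) (hw : ‖w‖ ≤ 1) (m : ℕ) :
    HasSum (fun n => partSum w m n * q ^ n) (qPoch (w * q) q m)⁻¹ := by
  induction m with
  | zero =>
    simp_rw [partSum_zero, qPoch_zero, inv_one]
    have := hasSum_single (f := fun n : ℕ => (if n = 0 then (1 : ℂ) else 0) * q ^ n) 0
      (fun n hn => by simp [hn])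
    simpa using this
  | succ m ih =>
    refine (hasSum_mul_pow_of_recurrence (Nat.succ_ne_zero m) hq hw
      (fun n hn => partSum_succ_of_lt w hn) (partSum_succ_add w m) ih ih.summable.norm).of_eq
      (fun _ => rfl) ?_
    rw [qPoch_succ, mul_inv, div_eq_mul_inv]
    congr 3
    rw [Nat.succ_eq_add_one]
    ring

/-- For n < N the restriction to parts at most N is vacuous, so the partial sum is at most
1/(r;r)_N, which is bounded in N. -/
theorem summable_partitionCount {r : ℝ} (hr0 : 0 ≤ r) (hr : r < 1) :
    Summable fun n => (partitionCount n : ℝ) * r ^ n := by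
  have hq : ‖(r : ℂ)‖ < 1 := by rwa [Complex.norm_real, Real.norm_of_nonneg hr0]
  obtain ⟨C, hC0, hC⟩ := exists_norm_inv_qPoch_le_of_norm_le hq
  have hreal : ∀ m n, ∃ x : ℝ, 0 ≤ x ∧ partSum 1 m n * (r : ℂ) ^ n = x := by
    intro m n
    refine ⟨((Finset.univ.filter fun p : n.Partition => p.parts.sup ≤ m).card : ℝ) * r ^ n,
      by positivity, ?_⟩
    simp [partSum]
  refine summable_of_sum_range_le (c := C) (fun n => by positivity) fun N => ?_
  have h := hasSum_partSum (w := 1) hq (by simp) N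
  choose x hx0 hx using hreal N
  simp_rw [hx] at h
  have hn : ‖∑' n, (x n : ℂ)‖ ≤ C := by
    rw [h.tsum_eq]
    exact hC _ (by simp) N
  rw [← Complex.ofReal_tsum, Complex.norm_real,
    Real.norm_of_nonneg (tsum_nonneg hx0)] at hn
  have hs : Summable x := Complex.summable_ofReal.1 h.summable
  refine le_trans ?_ ((hs.sum_le_tsum (Finset.range N) fun n _ => hx0 n).trans hn)
  refine Finset.sum_le_sum fun n hn' => le_of_eq ?_
  have h1 := hx n
  have h2 : partSum 1 N n = partitionCount n := by
    have : ∀ p : n.Partition, p.parts.sup ≤ N := fun p =>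
      p.sup_parts_le.trans (Finset.mem_range.1 hn').le
    simp [partSum, partitionCount, this]
  rw [h2] at h1
  exact_mod_cast h1

/-- The sum of `z ^ rank` over the partitions of `n`. -/
def rankPoly (z : ℂ) (n : ℕ) : ℂ := ∑ p : n.Partition, z ^ partitionRank p

/-- Partitions with largest part m + 1 are counted by the difference of two consecutive products,
giving the m-th term of the series. On |z| = 1 the double sum over size and largest part is
dominated by the partition counts, so it may be rearranged. -/
theorem hasSum_rankPoly_fineSeries {z q : ℂ} (hq : ‖q‖ < 1) (hz : ‖z‖ = 1) :
    HasSum (fun n => rankPoly z n * q ^ n) (fineSeries z⁻¹ z q) := by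
  have hz0 : z ≠ 0 := norm_ne_zero_iff.1 (by rw [hz]; exact one_ne_zero)
  have hw : ‖z⁻¹‖ ≤ 1 := by rw [norm_inv, hz, inv_one]
  set d : ℕ → ℕ → ℂ := fun m n =>
    ∑ p : n.Partition with p.parts.sup = m, z⁻¹ ^ Multiset.card p.parts with hd
  have hd0 : ∀ n, d 0 n = partSum z⁻¹ 0 n := fun n => by
    simp only [hd, partSum, Nat.le_zero]
  have hd1 : ∀ m n, d (m + 1) n = partSum z⁻¹ (m + 1) n - partSum z⁻¹ m n := by
    intro m n
    rw [eq_sub_iff_add_eq]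
    simp only [hd, partSum]
    rw [← Finset.sum_union]
    · refine Finset.sum_congr ?_ fun _ _ => rfl
      ext p
      simp only [Finset.mem_union, Finset.mem_filter, Finset.mem_univ, true_and]
      omega
    · refine Finset.disjoint_left.2 fun p h1 h2 => ?_
      simp only [Finset.mem_filter, Finset.mem_univ, true_and] at h1 h2
      omega
  have hmaps : ∀ n, ∀ p ∈ (Finset.univ : Finset (Nat.Partition n)), p.parts.sup ∈ Finset.range (n + 1) :=
    fun n p _ => Finset.mem_range.2 (Nat.lt_succ_iff.2 p.sup_parts_le)
  have hdz : ∀ n m, m ∉ Finset.range (n + 1) →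
      (Finset.univ.filter fun p : n.Partition => p.parts.sup = m) = ∅ := by
    intro n m hm
    refine Finset.filter_eq_empty_iff.2 fun p _ h => hm ?_
    rw [← h]; exact hmaps n p (Finset.mem_univ p)
  obtain ⟨F, hF⟩ : ∃ F : ℕ → ℕ → ℂ, ∀ n m, F n m = z ^ m * d m n * q ^ n := ⟨_, fun _ _ => rfl⟩
  have hFrow : ∀ n, ∑' m, F n m = rankPoly z n * q ^ n := by
    intro n
    rw [tsum_eq_sum (s := Finset.range (n + 1)) fun m hm => by
      rw [hF]; simp only [hd]; rw [hdz n m hm]; simp]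
    simp_rw [hF]
    rw [← Finset.sum_mul, rankPoly, ← Finset.sum_fiberwise_of_maps_to (hmaps n)]
    congr 1
    refine Finset.sum_congr rfl fun m _ => ?_
    simp only [hd]
    rw [Finset.mul_sum]
    refine Finset.sum_congr rfl fun p hp => ?_
    rw [partitionRank, (Finset.mem_filter.1 hp).2, zpow_sub₀ hz0, zpow_natCast, zpow_natCast,
      inv_pow, div_eq_mul_inv]
  have hFs : Summable (Function.uncurry F) := by
    set G : ℕ × ℕ → ℝ := fun x =>
      ((Finset.univ.filter fun p : x.1.Partition => p.parts.sup = x.2).card : ℝ) * ‖q‖ ^ x.1 with hG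
    have hGz : ∀ n, ∀ m ∉ Finset.range (n + 1), G (n, m) = 0 := fun n m hm => by
      simp only [hG]; rw [hdz n m hm]; simp
    have hGs : Summable G := by
      refine (summable_prod_of_nonneg fun x => by simp only [hG, Pi.zero_apply]; positivity).2
        ⟨fun n => summable_of_ne_finset_zero (hGz n), ?_⟩
      refine (summable_partitionCount (norm_nonneg q) hq).congr fun n => ?_
      rw [tsum_eq_sum (hGz n)]
      simp only [hG]
      rw [← Finset.sum_mul, ← Nat.cast_sum,
        ← Finset.card_eq_sum_card_fiberwise (hmaps n), partitionCount, Finset.card_univ]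
    refine Summable.of_norm_bounded hGs fun x => ?_
    rw [Function.uncurry, hF, norm_mul, norm_mul, norm_pow, hz, one_pow, one_mul, norm_pow]
    simp only [hd, hG]
    gcongr
    refine (norm_sum_le _ _).trans ?_
    simp [hz]
  have hcol : ∀ m, HasSum (fun n => F n (m + 1))
      (z⁻¹ * (z * q) ^ (m + 1) / qPoch (z⁻¹ * q) q (m + 1)) := by
    intro m
    have hbq : ‖z⁻¹ * q‖ < 1 := by rw [norm_mul, norm_inv, hz, inv_one, one_mul]; exact hq
    have n1 := qPoch_ne_zero (pow_mul_ne_one_of_norm_lt_one hq hbq) m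
    have n2 : 1 - q ^ m * (z⁻¹ * q) ≠ 0 :=
      sub_ne_zero.2 (pow_mul_ne_one_of_norm_lt_one hq hbq m).symm
    refine (((hasSum_partSum hq hw (m + 1)).sub (hasSum_partSum hq hw m)).mul_left
      (z ^ (m + 1))).of_eq (fun n => by rw [hF, hd1]; ring) ?_
    rw [qPoch_succ, mul_pow]
    generalize qPoch (z⁻¹ * q) q m = P at *
    rw [mul_inv, div_eq_mul_inv, mul_inv]
    have : (1 - q ^ m * (z⁻¹ * q))⁻¹ - 1 = z⁻¹ * q ^ (m + 1) * (1 - q ^ m * (z⁻¹ * q))⁻¹ := by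
      rw [eq_comm, ← sub_eq_zero]
      generalize hX : 1 - q ^ m * (z⁻¹ * q) = X at *
      have : z⁻¹ * q ^ (m + 1) = 1 - X := by rw [← hX]; ring
      rw [this]
      field_simp
      ring
    linear_combination (-z ^ (m + 1) * P⁻¹) * this
  have hcol0 : HasSum (fun n => F n 0) 1 := by
    refine (hasSum_partSum hq hw 0).of_eq (fun n => by rw [hF, hd0]; ring) ?_
    simp [qPoch_zero]
  have hrows := hFs.hasSum.prod_fiberwise fun n => (hFs.prod_factor n).hasSum
  refine hrows.of_eq (fun n => (hFrow n).symm) ?_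
  have hsw : Summable (Function.uncurry fun m n => F n m) := hFs.prod_symm
  have hT : ∑' p, Function.uncurry F p = ∑' m, ∑' n, F n m := by
    rw [Summable.tsum_comm hFs, hFs.tsum_prod' fun n => hFs.prod_factor n]
    rfl
  have hsp : Summable fun m => ∑' n, F n m := hsw.prod
  rw [hT, hsp.tsum_eq_zero_add, fineSeries, hcol0.tsum_eq]
  congr 1
  exact tsum_congr fun m => (hcol m).tsum_eq.symm

/-! ### The rank generating function -/

theorem mul_zpow_ne_one_of_norm_eq_one {q z : ℂ} (hq0 : q ≠ 0) (hq : ‖q‖ < 1) (hz : ‖z‖ = 1)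
    (hz1 : z ≠ 1) (n : ℤ) : z * q ^ n ≠ 1 := by
  intro h
  have h1 : ‖q‖ ^ n = ‖q‖ ^ (0 : ℤ) := by simpa [hz, norm_zpow] using congrArg norm h
  have h2 := zpow_right_injective₀ (norm_pos_iff.2 hq0) hq.ne h1
  rw [h2] at h
  exact hz1 (by simpa using h)

theorem qPochInf_mul_tsum_rankPoly {q z : ℂ} (hq0 : q ≠ 0) (hq : ‖q‖ < 1) (hz : ‖z‖ = 1)
    (hz1 : z ≠ 1) :
    qPochInf q q * ∑' n, rankPoly z n * q ^ n =
      (1 - z) * ∑' k : ℤ, (-1) ^ k * q ^ (3 * tri k + 2 * k) / (1 - z * q ^ k) := by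
  have hz0 : z ≠ 0 := norm_ne_zero_iff.1 (by rw [hz]; exact one_ne_zero)
  rw [← qPochInf_mul_tsum_gTerm hq0 hq hz0 (mul_zpow_ne_one_of_norm_eq_one hq0 hq hz hz1),
    (hasSum_rankPoly_fineSeries hq hz).tsum_eq, ← (hasSum_fineSeries hq0 hq hz).tsum_eq]
  rw [mul_left_comm, ← tsum_mul_left (a := 1 - z)]
  congr 1
  refine tsum_congr fun n => ?_
  rw [gTerm, qPoch_succ', mul_comm q z]
  have := sub_ne_zero.2 (Ne.symm hz1)
  simp only [div_eq_mul_inv, mul_inv]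
  field_simp

/-- At z = 1 the Appell form degenerates, so Durfee's identity for squares, k = 0, is used directly.
-/
theorem qPochInf_mul_tsum_partitionCount {q : ℂ} (hq0 : q ≠ 0) (hq : ‖q‖ < 1) :
    qPochInf q q * ∑' n, (partitionCount n : ℂ) * q ^ n = 1 := by
  have h1 : ∀ n, (partitionCount n : ℂ) = rankPoly 1 n := fun n => by
    simp [rankPoly, partitionCount]
  simp_rw [h1]
  rw [(hasSum_rankPoly_fineSeries hq norm_one).tsum_eq,
    ← (hasSum_fineSeries hq0 hq norm_one).tsum_eq]
  have h2 := (hasSum_durfee hq 0).tsum_eq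
  simp only [sub_zero, add_zero, invQ_natCast] at h2
  simp only [one_mul, div_eq_mul_inv, mul_inv, inv_one, mul_one]
  rw [h2]
  simp [qPochInf_self_ne_zero hq]

/-! ### The root of unity filter -/

/-- Invertibility of the Vandermonde matrix of the seventh roots of unity. -/
theorem eq_zero_of_forall_root_of_unity {u : Fin 7 → ℂ}
    (h : ∀ z : ℂ, z ^ 7 = 1 → ∑ i : Fin 7, z ^ (i : ℕ) * u i = 0) (i : Fin 7) : u i = 0 := by
  have hω := Complex.isPrimitiveRoot_exp 7 (by norm_num)
  set ω := Complex.exp (2 * Real.pi * Complex.I / (7 : ℕ))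
  have hinj : Function.Injective fun j : Fin 7 => ω ^ (j : ℕ) := fun a b hab =>
    Fin.ext (hω.pow_inj a.2 b.2 hab)
  exact congrFun (Matrix.eq_zero_of_forall_index_sum_pow_mul_eq_zero hinj fun j =>
    h _ (by rw [← pow_mul, mul_comm, pow_mul, hω.pow_eq_one, one_pow])) i

/-! ### Ranks modulo seven as Lambert-type series -/

/-- The series `∑_{k ≠ 0} (-1) ^ k q ^ (k (3 k + 1) / 2 + b k) / (1 - q ^ (7 k))`; the term of
index `0` vanishes. -/
def rankSum (q : ℂ) (b : ℤ) : ℂ :=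
  ∑' k : ℤ, (-1) ^ k * q ^ (3 * tri k + (2 + b) * k) / (1 - (q ^ 7) ^ k)

theorem summable_pent {q : ℂ} (hq0 : q ≠ 0) (hq : ‖q‖ < 1) (b : ℤ) :
    Summable fun k : ℤ => (-1) ^ k * q ^ (3 * tri k + b * k) := by
  refine (hasSum_jTheta (pow_ne_zero 3 hq0) (norm_pow_lt_one hq three_ne_zero)
    (zpow_ne_zero b hq0)).summable.congr fun n => ?_
  rw [pow_zpow, ← zpow_mul, zpow_add₀ hq0]
  push_cast; ring

theorem hasSum_pent {q : ℂ} (hq0 : q ≠ 0) (hq : ‖q‖ < 1) :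
    HasSum (fun k : ℤ => (-1) ^ k * q ^ (3 * tri k + 2 * k)) (qPochInf q q) := by
  have hq3 := pow_ne_zero 3 hq0
  have h2 := hasSum_jTheta hq3 (norm_pow_lt_one hq three_ne_zero) (pow_ne_zero 2 hq0)
  rw [show jTheta (q ^ 2) (q ^ 3) = qPochInf q q by
    rw [← jTheta_self_cube hq0 hq, ← jTheta_div hq3 q]; congr 1; field_simp] at h2
  refine h2.of_eq (fun n => ?_) rfl
  rw [pow_zpow, pow_zpow, zpow_add₀ hq0]
  push_cast; ring

theorem summable_rankSum {q : ℂ} (hq0 : q ≠ 0) (hq : ‖q‖ < 1) (b : ℤ) :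
    Summable fun k : ℤ => (-1) ^ k * q ^ (3 * tri k + (2 + b) * k) / (1 - (q ^ 7) ^ k) := by
  obtain ⟨C, hC0, hC⟩ := exists_norm_inv_one_sub_le (pow_ne_zero 7 hq0)
    (norm_pow_lt_one hq (by norm_num : (7 : ℕ) ≠ 0)) one_ne_zero
  refine Summable.of_norm_bounded ((summable_pent hq0 hq (2 + b)).norm.mul_right C) fun k => ?_
  rw [div_eq_mul_inv, norm_mul]
  gcongr
  simpa using hC k

theorem one_sub_pow_zpow_ne_zero {q : ℂ} (hq0 : q ≠ 0) (hq : ‖q‖ < 1) {m : ℕ} (hm : m ≠ 0)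
    {k : ℤ} (hk : k ≠ 0) : 1 - (q ^ m) ^ k ≠ 0 := sub_ne_zero.2 fun h => hk
  (zpow_injective_of_norm_lt_one (pow_ne_zero m hq0) (norm_pow_lt_one hq hm)
    (by simpa using h.symm))

theorem rankSum_neg {q : ℂ} (hq0 : q ≠ 0) (hq : ‖q‖ < 1) (b : ℤ) :
    rankSum q (6 - b) = -rankSum q b := by
  rw [rankSum, ← (Equiv.neg ℤ).tsum_eq, rankSum, ← tsum_neg]
  refine tsum_congr fun k => ?_
  rw [Equiv.neg_apply]
  rcases eq_or_ne k 0 with rfl | hk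
  · simp
  have h1 := one_sub_pow_zpow_ne_zero hq0 hq (by norm_num : (7 : ℕ) ≠ 0) hk
  have h2 : (q ^ 7) ^ k ≠ 0 := zpow_ne_zero _ (pow_ne_zero 7 hq0)
  have h3 : 1 - ((q ^ 7) ^ k)⁻¹ ≠ 0 := by
    rw [← zpow_neg]; exact one_sub_pow_zpow_ne_zero hq0 hq (by norm_num) (neg_ne_zero.2 hk)
  rw [tri_neg, zpow_neg, zpow_neg, ← inv_zpow, show (-1 : ℂ)⁻¹ = -1 by norm_num,
    show 3 * (tri k + k) + (2 + (6 - b)) * -k = 3 * tri k + (2 + b) * k - (7 : ℕ) * k by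
      push_cast; ring, zpow_sub₀ hq0, ← pow_zpow]
  generalize (q ^ 7) ^ k = Y at *
  have h4 : Y - 1 ≠ 0 := fun h => h1 (by linear_combination -h)
  rw [show 1 - Y⁻¹ = (Y - 1) / Y by field_simp, show 1 - Y = -(Y - 1) by ring]
  field_simp

/-- From X/(1 - X) = 1/(1 - X) - 1 with X = q^(7k). The subtracted pentagonal series includes k = 0,
where both rank sums have no term; hence the 1. -/
theorem rankSum_seven {q : ℂ} (hq0 : q ≠ 0) (hq : ‖q‖ < 1) :
    rankSum q 7 = rankSum q 0 - qPochInf q q + 1 := by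
  have h := ((summable_rankSum hq0 hq 0).hasSum.sub (hasSum_pent hq0 hq)).add
    (hasSum_ite_eq (0 : ℤ) (1 : ℂ))
  refine (summable_rankSum hq0 hq 7).hasSum.unique (h.of_eq (fun k => ?_) rfl)
  rcases eq_or_ne k 0 with rfl | hk
  · simp
  have h1 := one_sub_pow_zpow_ne_zero hq0 hq (by norm_num : (7 : ℕ) ≠ 0) hk
  rw [if_neg hk, add_zero, show 3 * tri k + (2 + 7) * k = 3 * tri k + 2 * k + (7 : ℕ) * k by
    push_cast; ring, zpow_add₀ hq0 _ ((7 : ℕ) * k), ← pow_zpow, add_zero]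
  field_simp
  ring

theorem norm_eq_one_of_pow_seven {z : ℂ} (hz : z ^ 7 = 1) : ‖z‖ = 1 :=
  Complex.norm_eq_one_of_pow_eq_one hz (by norm_num)

/-- For z⁷ = 1, 1/(1 - zX) = Σ_{i<7} z^i X^i/(1 - X⁷) with X = q^k. The term k = 0 is kept apart and
yields the summand 1; at z = 1 the formula is the partition generating function. -/
theorem qPochInf_mul_tsum_rankPoly_root {q z : ℂ} (hq0 : q ≠ 0) (hq : ‖q‖ < 1) (hz : z ^ 7 = 1) :
    qPochInf q q * ∑' n, rankPoly z n * q ^ n =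
      1 + (1 - z) * ∑ i : Fin 7, z ^ (i : ℕ) * rankSum q (i : ℕ) := by
  by_cases hz1 : z = 1
  · subst hz1
    simpa [rankPoly, partitionCount] using qPochInf_mul_tsum_partitionCount hq0 hq
  have hn := norm_eq_one_of_pow_seven hz
  have hz1' : 1 - z ≠ 0 := sub_ne_zero.2 (Ne.symm hz1)
  rw [qPochInf_mul_tsum_rankPoly hq0 hq hn hz1]
  have hs : HasSum (fun k : ℤ => ∑ i : Fin 7, z ^ (i : ℕ) *
      ((-1) ^ k * q ^ (3 * tri k + (2 + ((i : ℕ) : ℤ)) * k) / (1 - (q ^ 7) ^ k)))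
      (∑ i : Fin 7, z ^ (i : ℕ) * rankSum q (i : ℕ)) :=
    hasSum_sum fun i _ => (summable_rankSum hq0 hq _).hasSum.mul_left _
  have h := (hasSum_ite_eq (0 : ℤ) (1 - z)⁻¹).add hs
  have e : ∀ k : ℤ, (-1) ^ k * q ^ (3 * tri k + 2 * k) / (1 - z * q ^ k) =
      (if k = 0 then (1 - z)⁻¹ else 0) + ∑ i : Fin 7, z ^ (i : ℕ) *
      ((-1) ^ k * q ^ (3 * tri k + (2 + ((i : ℕ) : ℤ)) * k) / (1 - (q ^ 7) ^ k)) := by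
    intro k
    rcases eq_or_ne k 0 with rfl | hk
    · simp
    have h1 := one_sub_pow_zpow_ne_zero hq0 hq (by norm_num : (7 : ℕ) ≠ 0) hk
    have h2 := sub_ne_zero.2 (mul_zpow_ne_one_of_norm_eq_one hq0 hq hn hz1 k).symm
    have e2 : ∀ i : ℕ, q ^ (3 * tri k + (2 + (i : ℤ)) * k) =
        q ^ (3 * tri k + 2 * k) * (q ^ k) ^ i := by
      intro i
      rw [← zpow_natCast, ← zpow_mul, ← zpow_add₀ hq0]
      congr 1; ring
    have e3 : (q ^ 7) ^ k = (q ^ k) ^ 7 := by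
      rw [pow_zpow, ← zpow_natCast, ← zpow_mul, mul_comm]
    simp_rw [e2]
    rw [if_neg hk, zero_add, Fin.sum_univ_eq_sum_range (fun i => z ^ i * ((-1) ^ k *
      (q ^ (3 * tri k + 2 * k) * (q ^ k) ^ i) / (1 - (q ^ 7) ^ k)))]
    rw [e3] at h1 ⊢
    generalize q ^ k = K at *
    simp only [Finset.sum_range_succ, Finset.sum_range_zero]
    field_simp
    linear_combination ((-1) ^ k * q ^ (3 * tri k + 2 * k) * K ^ 7) * hz
  rw [tsum_congr e, h.tsum_eq]
  field_simp

theorem rankPoly_eq_sum {z : ℂ} (hz : z ^ 7 = 1) (n : ℕ) :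
    rankPoly z n = ∑ i : Fin 7, z ^ (i : ℕ) * (rankCount i 7 n : ℂ) := by
  have hz0 : z ≠ 0 := fun h => by simp [h] at hz
  have hmod : ∀ p : n.Partition, z ^ partitionRank p = ∑ i : Fin 7,
      if partitionRank p ≡ ((i : ℕ) : ℤ) [ZMOD ((7 : ℕ) : ℤ)] then z ^ (i : ℕ) else 0 := by
    intro p
    set m := partitionRank p
    have hm0 := Int.emod_nonneg m (by norm_num : (7 : ℤ) ≠ 0)
    have hm7 := Int.emod_lt_of_pos m (by norm_num : (0 : ℤ) < 7)
    have hj : (m % 7).toNat < 7 := by omega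
    rw [Finset.sum_eq_single (⟨(m % 7).toNat, hj⟩ : Fin 7)]
    · rw [if_pos (by rw [Int.ModEq]; push_cast; omega)]
      conv_lhs => rw [← Int.emod_add_mul_ediv m 7]
      rw [zpow_add₀ hz0, zpow_mul, show z ^ (7 : ℤ) = 1 by exact_mod_cast hz, one_zpow, mul_one,
        ← zpow_natCast]
      congr 1
      simp only
      omega
    · intro i _ hi
      refine if_neg fun h => hi (Fin.ext ?_)
      rw [Int.ModEq] at h
      have := i.2
      simp only
      push_cast at h
      omega
    · exact fun h => absurd (Finset.mem_univ _) h
  rw [rankPoly, Finset.sum_congr rfl fun p _ => hmod p, Finset.sum_comm]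
  refine Finset.sum_congr rfl fun i _ => ?_
  rw [← Finset.sum_filter, Finset.sum_const, nsmul_eq_mul, rankCount, mul_comm]

theorem rankCount_le (a M n : ℕ) : rankCount a M n ≤ partitionCount n :=
  (Finset.card_filter_le _ _).trans (by rw [partitionCount, Finset.card_univ])

theorem summable_partitionCount_mul_pow {q : ℂ} (hq : ‖q‖ < 1) :
    Summable fun n => (partitionCount n : ℂ) * q ^ n :=
  Summable.of_norm (by
    simpa [norm_mul, norm_pow] using summable_partitionCount (norm_nonneg q) hq)

theorem summable_rankCount_mul_pow {q : ℂ} (hq : ‖q‖ < 1) (a M : ℕ) :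
    Summable fun n => (rankCount a M n : ℂ) * q ^ n := by
  refine Summable.of_norm_bounded (summable_partitionCount (norm_nonneg q) hq) fun n => ?_
  rw [norm_mul, norm_pow, Complex.norm_natCast]
  gcongr
  exact rankCount_le a M n

/-- Comparison of the coefficients of z^i modulo z⁷ - 1. The factor 1 - z takes cyclic differences,
so i - 1 is meant in `Fin 7` and 0 wraps to 6. -/
theorem qPochInf_mul_tsum_rankCount {q : ℂ} (hq0 : q ≠ 0) (hq : ‖q‖ < 1) (i : Fin 7) :
    qPochInf q q * ∑' n, (rankCount i 7 n : ℂ) * q ^ n =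
      (if i = 0 then 1 else 0) + rankSum q (i : ℕ) - rankSum q ((i - 1 : Fin 7) : ℕ) := by
  rw [← sub_eq_zero]
  refine eq_zero_of_forall_root_of_unity (u := fun i => qPochInf q q *
    ∑' n, (rankCount i 7 n : ℂ) * q ^ n - ((if i = 0 then 1 else 0) + rankSum q (i : ℕ) -
      rankSum q ((i - 1 : Fin 7) : ℕ))) (fun z hz => ?_) i
  have h := qPochInf_mul_tsum_rankPoly_root hq0 hq hz
  have hs : HasSum (fun n => rankPoly z n * q ^ n)
      (∑ i : Fin 7, z ^ (i : ℕ) * ∑' n, (rankCount i 7 n : ℂ) * q ^ n) := by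
    refine (hasSum_sum fun i (_ : i ∈ Finset.univ) =>
      (summable_rankCount_mul_pow hq (i : Fin 7) 7).hasSum.mul_left (z ^ (i : ℕ))).of_eq
      (fun n => ?_) rfl
    rw [rankPoly_eq_sum hz, Finset.sum_mul]
    exact Finset.sum_congr rfl fun i _ => by ring
  rw [hs.tsum_eq] at h
  have m2 : ((1 - 1 : Fin 7) : ℕ) = 0 := rfl
  have m3 : ((2 - 1 : Fin 7) : ℕ) = 1 := rfl
  have m4 : ((3 - 1 : Fin 7) : ℕ) = 2 := rfl
  have m5 : ((4 - 1 : Fin 7) : ℕ) = 3 := rfl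
  have m6 : ((5 - 1 : Fin 7) : ℕ) = 4 := rfl
  have m7 : ((6 - 1 : Fin 7) : ℕ) = 5 := rfl
  have m8 : ((0 - 1 : Fin 7) : ℕ) = 6 := rfl
  simp only [Fin.sum_univ_seven, m2, m3, m4, m5, m6, m7, m8] at h ⊢
  simp only [Fin.isValue, Fin.coe_ofNat_eq_mod, Nat.reduceMod, Fin.reduceEq, if_true, if_false,
    pow_zero, pow_one] at h ⊢
  linear_combination h - rankSum q ((6 : ℕ) : ℤ) * hz

/-! ### Theta functions of level seven -/

/-- `j(y ^ k; y ^ 7)`. -/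
def jSeven (y : ℂ) (k : ℤ) : ℂ := jTheta (y ^ k) (y ^ 7)

/-- The logarithmic derivative of the theta function at `y ^ k`. -/
def jLogSeven (y : ℂ) (k : ℤ) : ℂ := jLog (y ^ k) (y ^ 7)

section

variable {y : ℂ}

theorem zpow_mul_zpow_ne_one (hy0 : y ≠ 0) (hy : ‖y‖ < 1) {k : ℤ} (hk : ¬ 7 ∣ k) (n : ℤ) :
    y ^ k * (y ^ 7) ^ n ≠ 1 := by
  rw [pow_zpow, ← zpow_add₀ hy0]
  intro h
  have := zpow_injective_of_norm_lt_one hy0 hy (h.trans (zpow_zero y).symm)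
  push_cast at this
  omega

theorem jSeven_ne_zero (hy0 : y ≠ 0) (hy : ‖y‖ < 1) {k : ℤ} (hk : ¬ 7 ∣ k) : jSeven y k ≠ 0 :=
  jTheta_ne_zero (pow_ne_zero 7 hy0) (norm_pow_lt_one hy (by norm_num)) (zpow_ne_zero k hy0)
    (zpow_mul_zpow_ne_one hy0 hy hk)

theorem jSeven_sub (hy0 : y ≠ 0) (k : ℤ) : jSeven y (7 - k) = jSeven y k := by
  rw [jSeven, zpow_sub₀ hy0, jSeven, ← jTheta_div (pow_ne_zero 7 hy0) (y ^ k)]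
  norm_cast

theorem jSeven_neg (hy0 : y ≠ 0) (hy : ‖y‖ < 1) (k : ℤ) :
    jSeven y (-k) = -(y ^ k)⁻¹ * jSeven y k := by
  rw [jSeven, zpow_neg, jTheta_inv (pow_ne_zero 7 hy0) (norm_pow_lt_one hy (by norm_num))
    (zpow_ne_zero k hy0), jSeven]

theorem jLogSeven_sub (hy0 : y ≠ 0) (hy : ‖y‖ < 1) {k : ℤ} (hk : ¬ 7 ∣ k) :
    jLogSeven y (7 - k) = -jLogSeven y k := by
  have h := jLog_div (pow_ne_zero 7 hy0) (norm_pow_lt_one hy (by norm_num)) (zpow_ne_zero k hy0)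
    (jSeven_ne_zero hy0 hy hk)
  rw [jLogSeven, zpow_sub₀ hy0, jLogSeven, ← h]
  norm_cast

theorem jSeven_four (hy0 : y ≠ 0) : jSeven y 4 = jSeven y 3 := jSeven_sub hy0 3

theorem jSeven_five (hy0 : y ≠ 0) : jSeven y 5 = jSeven y 2 := jSeven_sub hy0 2

theorem jSeven_six (hy0 : y ≠ 0) : jSeven y 6 = jSeven y 1 := jSeven_sub hy0 1

/-- The Appell sum with argument `y ^ (t + k)` and coefficient `y ^ (3 k)`. -/
def appellSeven (y : ℂ) (t k : ℤ) : ℂ := appell ((y ^ k) ^ 3) (y ^ (t + k)) (y ^ 7)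

theorem appellSeven_pair (hy0 : y ≠ 0) (hy : ‖y‖ < 1) {t k : ℤ} (ht : ¬ 7 ∣ t) (hk : ¬ 7 ∣ k)
    (h1 : ¬ 7 ∣ t + k) (h2 : ¬ 7 ∣ t - k) :
    (y ^ k) ^ 3 * appellSeven y t k + appellSeven y t (-k) =
      y ^ k * (jSeven y (2 * k) / jSeven y k) * appellSeven y t 0 +
        jSeven y k * jSeven y (2 * k) * qPochInf (y ^ 7) (y ^ 7) ^ 3 /
          (jSeven y (t - k) * jSeven y t * jSeven y (t + k)) := by
  have e1 : y ^ t * y ^ k = y ^ (t + k) := (zpow_add₀ hy0 t k).symm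
  have e2 : y ^ t / y ^ k = y ^ (t - k) := (zpow_sub₀ hy0 t k).symm
  have e3 : (y ^ k) ^ 2 = y ^ (2 * k) := by rw [two_mul, zpow_add₀ hy0, sq]
  have h := appell_three_term (pow_ne_zero 7 hy0) (norm_pow_lt_one hy (by norm_num))
    (zpow_ne_zero t hy0) (zpow_ne_zero k hy0) (jSeven_ne_zero hy0 hy hk)
    (jSeven_ne_zero hy0 hy ht) (by rw [e1]; exact jSeven_ne_zero hy0 hy h1)
    (by rw [e2]; exact jSeven_ne_zero hy0 hy h2)
  rw [e1, e2, e3] at h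
  simp only [appellSeven, jSeven, zpow_zero, one_pow, add_zero, ← sub_eq_add_neg, zpow_neg,
    inv_pow]
  linear_combination h

theorem appellSeven_pair_self (hy0 : y ≠ 0) (hy : ‖y‖ < 1) {t : ℤ} (ht : ¬ 7 ∣ t) :
    (y ^ t) ^ 3 * appellSeven y t t + appellSeven y t (-t) =
      y ^ t * (jSeven y (2 * t) / jSeven y t) * appellSeven y t 0 +
        (jLogSeven y t + jLogSeven y (2 * t)) := by
  have e3 : (y ^ t) ^ 2 = y ^ (2 * t) := by rw [two_mul, zpow_add₀ hy0, sq]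
  have h := appell_three_term_self (pow_ne_zero 7 hy0) (norm_pow_lt_one hy (by norm_num))
    (zpow_ne_zero t hy0) (jSeven_ne_zero hy0 hy ht)
    (by rw [e3]; exact jSeven_ne_zero hy0 hy (by omega))
  rw [e3] at h
  simp only [appellSeven, jSeven, jLogSeven, zpow_zero, one_pow, add_zero, add_neg_cancel, zpow_neg,
    inv_pow, ← two_mul]
  linear_combination h

theorem appellSeven_zero (hy0 : y ≠ 0) (hy : ‖y‖ < 1) {t : ℤ} (ht : ¬ 7 ∣ t) :
    appellSeven y t 0 = qPochInf (y ^ 7) (y ^ 7) * gMock (y ^ t) (y ^ 7) := by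
  rw [appellSeven, zpow_zero, one_pow, add_zero, appell_one_eq (pow_ne_zero 7 hy0)
    (norm_pow_lt_one hy (by norm_num)) (zpow_ne_zero t hy0) (zpow_mul_zpow_ne_one hy0 hy ht)]

theorem jSeven_klein (hy0 : y ≠ 0) (hy : ‖y‖ < 1) :
    jSeven y 2 ^ 3 * jSeven y 3 = jSeven y 1 * jSeven y 3 ^ 3 + y * jSeven y 1 ^ 3 * jSeven y 2 := by
  simpa only [jSeven, zpow_ofNat, zpow_one, pow_one] using jTheta_klein hy0 hy

theorem jLogSeven_quartic (hy0 : y ≠ 0) (hy : ‖y‖ < 1) {k : ℤ} (hk : ¬ 7 ∣ k) :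
    jLogSeven y (4 * k) + 1 - jLogSeven y (2 * k) - 2 * jLogSeven y k =
      qPochInf (y ^ 7) (y ^ 7) ^ 3 * jSeven y (3 * k) ^ 2 / (jSeven y k ^ 2 * jSeven y (4 * k)) := by
  have e : ∀ n : ℕ, (y ^ k) ^ n = y ^ ((n : ℤ) * k) := fun n => by
    rw [← zpow_natCast, ← zpow_mul, mul_comm]
  have h := jLog_quartic (pow_ne_zero 7 hy0) (norm_pow_lt_one hy (by norm_num))
    (zpow_ne_zero k hy0) (jSeven_ne_zero hy0 hy hk)
    (by rw [e]; exact jSeven_ne_zero hy0 hy (by omega))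
    (by rw [e]; exact jSeven_ne_zero hy0 hy (by omega))
  simpa [e, jSeven, jLogSeven] using h

theorem qPochInf_eq_jSeven (hy0 : y ≠ 0) (hy : ‖y‖ < 1) :
    qPochInf y y * qPochInf (y ^ 7) (y ^ 7) ^ 2 = jSeven y 1 * jSeven y 2 * jSeven y 3 := by
  rw [qPochInf_eq_prod_residues y hy 7]
  simp only [Finset.prod_range_succ, Finset.prod_range_zero, jSeven, jTheta]
  have e : ∀ n : ℕ, n ≤ 7 → y ^ 7 / y ^ n = y ^ (7 - n) := fun n hn => by
    rw [div_eq_iff (pow_ne_zero n hy0), ← pow_add, Nat.sub_add_cancel hn]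
  norm_cast
  rw [e 1, e 2, e 3] <;> norm_num [← pow_succ]
  rw [← sq]
  ring

end

/-! ### The seven-dissection of the Euler product -/

/-- In the pentagonal series put n = 7r + s - 1. Each class s is a theta function in base q^147, the
classes s and -s combine by the quintuple product identity, and s = 0 gives the term -q². -/
theorem qPochInf_dissection_seven {q : ℂ} (hq0 : q ≠ 0) (hq : ‖q‖ < 1) :
    qPochInf q q = qPochInf ((q ^ 7) ^ 7) ((q ^ 7) ^ 7) *
      (jSeven (q ^ 7) 2 / jSeven (q ^ 7) 1 - q * (jSeven (q ^ 7) 3 / jSeven (q ^ 7) 2) - q ^ 2 +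
        q ^ 5 * (jSeven (q ^ 7) 1 / jSeven (q ^ 7) 3)) := by
  set y := q ^ 7 with hy_def
  have hy0 : y ≠ 0 := pow_ne_zero 7 hq0
  have hy : ‖y‖ < 1 := norm_pow_lt_one hq (by norm_num)
  have hp0 : y ^ 7 ≠ 0 := pow_ne_zero 7 hy0
  have hp : ‖y ^ 7‖ < 1 := norm_pow_lt_one hy (by norm_num)
  have hp3 : (y ^ 7) ^ 3 ≠ 0 := pow_ne_zero 3 hp0
  have hp3' : ‖(y ^ 7) ^ 3‖ < 1 := norm_pow_lt_one hp (by norm_num)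
  set F : ℤ → ℂ := fun s => jTheta (y ^ 7 * (y ^ s) ^ 3) ((y ^ 7) ^ 3) with hF
  have h0 := hasSum_jTheta (pow_ne_zero 3 hq0) (norm_pow_lt_one hq three_ne_zero) hq0
  have h1 : ∀ s : ℤ, ∑' r : ℤ, (-1) ^ (7 * r + (s - 1)) * (q ^ 3) ^ tri (7 * r + (s - 1)) *
      q ^ (7 * r + (s - 1)) = (-1) ^ (s - 1) * q ^ (3 * tri (s - 1) + (s - 1)) * F s := by
    intro s
    simp only [hF]
    rw [← (hasSum_jTheta hp3 hp3' (mul_ne_zero hp0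
      (pow_ne_zero 3 (zpow_ne_zero s hy0)))).tsum_eq, ← tsum_mul_left]
    refine tsum_congr fun r => ?_
    have ht : tri (7 * r + (s - 1)) = 49 * tri r + 21 * r + 7 * r * (s - 1) + tri (s - 1) := by
      have h : 2 * tri (7 * r + (s - 1)) =
          2 * (49 * tri r + 21 * r + 7 * r * (s - 1) + tri (s - 1)) := by
        linear_combination two_mul_tri (7 * r + (s - 1)) - 49 * two_mul_tri r - two_mul_tri (s - 1)
      omega
    have hm : (-1 : ℂ) ^ (7 * r) = (-1) ^ r := by rw [zpow_mul]; norm_num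
    have e1 : ((y ^ 7) ^ 3) ^ tri r = q ^ (147 * tri r) := by
      rw [hy_def, ← pow_mul, ← pow_mul, pow_zpow]; norm_num
    have e2 : (y ^ 7 * (y ^ s) ^ 3) ^ r = q ^ (49 * r + 21 * s * r) := by
      rw [hy_def, pow_zpow, mul_zpow, ← pow_mul, pow_zpow, pow_zpow, ← zpow_mul, ← zpow_add₀ hq0]
      congr 1; push_cast; ring
    rw [ht, e1, e2, pow_zpow, zpow_add₀ (by norm_num : (-1 : ℂ) ≠ 0), hm]
    rw [show ∀ a b c d : ℂ, a * b * c * d = a * b * (c * d) from fun _ _ _ _ => by ring,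
      show ∀ a b c d e : ℂ, a * b * (c * d * e) = c * a * (b * (d * e)) from
        fun _ _ _ _ _ => by ring, ← zpow_add₀ hq0, ← zpow_add₀ hq0, ← zpow_add₀ hq0]
    congr 2
    push_cast; ring
  have hF0 : F 0 = qPochInf (y ^ 7) (y ^ 7) := by
    simpa [hF] using jTheta_self_cube hp0 hp
  have hpair : ∀ s : ℤ, ¬ 7 ∣ s → F s + y ^ s * F (-s) =
      qPochInf (y ^ 7) (y ^ 7) * (jSeven y (2 * s) / jSeven y s) := by
    intro s hs
    have h := quintuple_product hp0 hp (zpow_ne_zero s hy0)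
    have hne := jSeven_ne_zero hy0 hy hs
    have e : (y ^ s) ^ 2 = y ^ (2 * s) := by rw [two_mul, zpow_add₀ hy0, sq]
    rw [e] at h
    simp only [hF, zpow_neg, inv_pow]
    rw [← mul_div_assoc, eq_div_iff hne]
    simp only [jSeven]
    linear_combination h
  -- The offset -4 makes s = i - 3 run symmetrically over -3, …, 3.
  have h2 := tsum_int_eq_sum_residues h0.summable 7 (-4)
  rw [h0.tsum_eq, jTheta_self_cube hq0 hq] at h2
  rw [h2, Fin.sum_univ_eq_sum_range (fun i => ∑' r : ℤ, (-1) ^ (((7 : ℕ) : ℤ) * r + i + -4) *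
    (q ^ 3) ^ tri (((7 : ℕ) : ℤ) * r + i + -4) * q ^ (((7 : ℕ) : ℤ) * r + i + -4)) 7]
  have h3 : ∀ i : ℕ, ∑' r : ℤ, (-1) ^ (((7 : ℕ) : ℤ) * r + i + -4) *
      (q ^ 3) ^ tri (((7 : ℕ) : ℤ) * r + i + -4) * q ^ (((7 : ℕ) : ℤ) * r + i + -4) =
      (-1) ^ ((i : ℤ) - 4) * q ^ (3 * tri ((i : ℤ) - 4) + (i - 4)) * F (i - 3) := by
    intro i
    rw [show (i : ℤ) - 4 = (i - 3) - 1 by ring, ← h1]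
    refine tsum_congr fun r => ?_
    rw [show ((7 : ℕ) : ℤ) * r + i + -4 = 7 * r + (((i : ℤ) - 3) - 1) by push_cast; ring]
  have p1 := hpair 1 (by norm_num)
  have p2 := hpair 2 (by norm_num)
  have p3 := hpair 3 (by norm_num)
  simp only [h3, Finset.sum_range_succ, Finset.sum_range_zero]
  norm_num [tri, hF0]
  norm_num [jSeven_four hy0, jSeven_six hy0] at p1 p2 p3
  linear_combination p1 - q * p2 + q ^ 5 * p3 + (-F (-1) + q * (y + q ^ 7) * F (-2) -
    q ^ 5 * (y ^ 2 + y * q ^ 7 + q ^ 14) * F (-3)) * hy_def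

/-! ### Evaluation of the rank sums -/

/-- Put 7r + t + k for the summation index, with -3 ≤ k ≤ 3. The value b = 10 - 3t is the one for
which the linear exponent in r becomes 147r + 21kr, so the Appell coefficient is y^(3k) and the
classes are symmetric about k = 0. For k = -t the argument is 1, and the missing term of index 0 is
the missing term of the rank sum. -/
theorem rankSum_eq_sum_appellSeven {q : ℂ} (hq0 : q ≠ 0) (hq : ‖q‖ < 1) (t : ℤ) :
    rankSum q (10 - 3 * t) = ∑ i ∈ Finset.range 7,
      (-1) ^ (t + ((i : ℤ) - 3)) * q ^ (3 * tri (t + ((i : ℤ) - 3)) +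
        (12 - 3 * t) * (t + ((i : ℤ) - 3))) * appellSeven (q ^ 7) t ((i : ℤ) - 3) := by
  have hy0 : q ^ 7 ≠ 0 := pow_ne_zero 7 hq0
  rw [rankSum, tsum_int_eq_sum_residues (summable_rankSum hq0 hq _) 7 (t - 3),
    ← Fin.sum_univ_eq_sum_range (fun i : ℕ => (-1) ^ (t + ((i : ℤ) - 3)) *
      q ^ (3 * tri (t + ((i : ℤ) - 3)) + (12 - 3 * t) * (t + ((i : ℤ) - 3))) *
      appellSeven (q ^ 7) t ((i : ℤ) - 3))]
  refine Finset.sum_congr rfl fun i _ => ?_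
  obtain ⟨k, hk⟩ : ∃ k : ℤ, ((i : ℕ) : ℤ) - 3 = k := ⟨_, rfl⟩
  rw [hk, appellSeven, appell, ← tsum_mul_left]
  refine tsum_congr fun r => ?_
  have hn : ((7 : ℕ) : ℤ) * r + (i : ℕ) + (t - 3) = 7 * r + (t + k) := by
    rw [← hk]; push_cast; ring
  obtain ⟨s, hs⟩ : ∃ s : ℤ, t + k = s := ⟨_, rfl⟩
  have ht : tri (7 * r + s) = 49 * tri r + 21 * r + 7 * r * s + tri s := by
    have h : 2 * tri (7 * r + s) = 2 * (49 * tri r + 21 * r + 7 * r * s + tri s) := by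
      linear_combination two_mul_tri (7 * r + s) - 49 * two_mul_tri r - two_mul_tri s
    omega
  have hm : (-1 : ℂ) ^ (7 * r + s) = (-1) ^ s * (-1) ^ r := by
    rw [zpow_add₀ (by norm_num), zpow_mul, mul_comm]; norm_num
  have hd : (q ^ 7) ^ (7 * r + s) = (q ^ 7) ^ s * ((q ^ 7) ^ 7) ^ r := by
    rw [pow_zpow (q ^ 7) 7 r, ← zpow_add₀ hy0, add_comm]; norm_num
  have e1 : (((q ^ 7) ^ k) ^ 3) ^ r = q ^ (21 * k * r) := by
    rw [pow_zpow, pow_zpow, ← zpow_mul]; congr 1; push_cast; ring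
  have e2 : ((q ^ 7) ^ 7) ^ (3 * tri r + 3 * r) = q ^ (147 * tri r + 147 * r) := by
    rw [← pow_mul, pow_zpow]; congr 1; push_cast; ring
  have e : q ^ (3 * tri (7 * r + s) + (2 + (10 - 3 * t)) * (7 * r + s)) =
      q ^ (3 * tri s + (12 - 3 * t) * s) * q ^ (21 * k * r) * q ^ (147 * tri r + 147 * r) := by
    rw [← zpow_add₀ hq0, ← zpow_add₀ hq0, ht]
    congr 1
    linear_combination (21 * r) * hs.symm
  rw [hn, hs, hm, hd, e, appellCoeff, e1, e2]
  ring

section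

variable {q : ℂ}

/-- The value of a rank sum, in terms of theta functions, logarithmic derivatives of theta
functions and a mock theta function. -/
theorem rankSum_seven_eq (hq0 : q ≠ 0) (hq : ‖q‖ < 1) :
    rankSum q 7 = qPochInf q q * (q ^ 7 * gMock (q ^ 7) ((q ^ 7) ^ 7)) + jLogSeven (q ^ 7) 1 +
      jLogSeven (q ^ 7) 2 + qPochInf ((q ^ 7) ^ 7) ((q ^ 7) ^ 7) ^ 3 *
        (q * (jSeven (q ^ 7) 2 / jSeven (q ^ 7) 1 ^ 2) - q ^ 5 / jSeven (q ^ 7) 2) := by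
  have hy0 : q ^ 7 ≠ 0 := pow_ne_zero 7 hq0
  have hy : ‖q ^ 7‖ < 1 := norm_pow_lt_one hq (by norm_num)
  have ha : jSeven (q ^ 7) 1 ≠ 0 := jSeven_ne_zero hy0 hy (by norm_num)
  have hb : jSeven (q ^ 7) 2 ≠ 0 := jSeven_ne_zero hy0 hy (by norm_num)
  have hc : jSeven (q ^ 7) 3 ≠ 0 := jSeven_ne_zero hy0 hy (by norm_num)
  have n1 := jSeven_neg hy0 hy 1
  have n2 := jSeven_neg hy0 hy 2
  have h0 := appellSeven_zero hy0 hy (t := 1) (by norm_num)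
  have h1 := appellSeven_pair_self hy0 hy (t := 1) (by norm_num)
  have h2 := appellSeven_pair hy0 hy (t := 1) (k := 2) (by norm_num) (by norm_num)
    (by norm_num) (by norm_num)
  have h3 := appellSeven_pair hy0 hy (t := 1) (k := 3) (by norm_num) (by norm_num)
    (by norm_num) (by norm_num)
  have h := rankSum_eq_sum_appellSeven hq0 hq 1
  simp only [Finset.sum_range_succ, Finset.sum_range_zero] at h
  norm_num [tri] at h
  norm_num [jSeven_four hy0, jSeven_five hy0, jSeven_six hy0, n1, n2] at h1 h2 h3 h0
  rw [h0] at h h1 h2 h3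
  rw [h, qPochInf_dissection_seven hq0 hq]
  clear h n1 n2 h0
  generalize jSeven (q ^ 7) 1 = a at *
  generalize jSeven (q ^ 7) 2 = b at *
  generalize jSeven (q ^ 7) 3 = c at *
  -- The weight of each pair is the coefficient of its sum of index -k. The contributions to the
  -- central sum then add up to q⁷ times the dissection of (q;q)_∞ over (q⁴⁹;q⁴⁹)_∞.
  linear_combination (norm := (field_simp; ring)) h1 - (q ^ 6)⁻¹ * h2 + (q ^ 9)⁻¹ * h3

/-- The value of a rank sum, in terms of theta functions, logarithmic derivatives of theta
functions and a mock theta function. -/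
theorem rankSum_four_eq (hq0 : q ≠ 0) (hq : ‖q‖ < 1) :
    rankSum q 4 = -(qPochInf q q * (q ^ 13 * gMock ((q ^ 7) ^ 2) ((q ^ 7) ^ 7))) +
      jLogSeven (q ^ 7) 2 - jLogSeven (q ^ 7) 3 + qPochInf ((q ^ 7) ^ 7) ((q ^ 7) ^ 7) ^ 3 *
        (q ^ 4 * (jSeven (q ^ 7) 3 / jSeven (q ^ 7) 2 ^ 2) - q ^ 6 / jSeven (q ^ 7) 3) := by
  have hy0 : q ^ 7 ≠ 0 := pow_ne_zero 7 hq0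
  have hy : ‖q ^ 7‖ < 1 := norm_pow_lt_one hq (by norm_num)
  have ha : jSeven (q ^ 7) 1 ≠ 0 := jSeven_ne_zero hy0 hy (by norm_num)
  have hb : jSeven (q ^ 7) 2 ≠ 0 := jSeven_ne_zero hy0 hy (by norm_num)
  have hc : jSeven (q ^ 7) 3 ≠ 0 := jSeven_ne_zero hy0 hy (by norm_num)
  have n1 := jSeven_neg hy0 hy 1
  have n2 := jSeven_neg hy0 hy 2
  have h0 := appellSeven_zero hy0 hy (t := 2) (by norm_num)
  have h1 := appellSeven_pair hy0 hy (t := 2) (k := 1) (by norm_num) (by norm_num)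
    (by norm_num) (by norm_num)
  have h2 := appellSeven_pair_self hy0 hy (t := 2) (by norm_num)
  have h3 := appellSeven_pair hy0 hy (t := 2) (k := 3) (by norm_num) (by norm_num)
    (by norm_num) (by norm_num)
  have h := rankSum_eq_sum_appellSeven hq0 hq 2
  have l := jLogSeven_sub hy0 hy (k := 3) (by norm_num)
  norm_num at l
  simp only [Finset.sum_range_succ, Finset.sum_range_zero] at h
  norm_num [tri] at h
  norm_num [jSeven_four hy0, jSeven_five hy0, jSeven_six hy0, n1, n2, l] at h1 h2 h3 h0
  rw [h0] at h h1 h2 h3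
  rw [h, qPochInf_dissection_seven hq0 hq]
  clear h n1 n2 h0
  generalize jSeven (q ^ 7) 1 = a at *
  generalize jSeven (q ^ 7) 2 = b at *
  generalize jSeven (q ^ 7) 3 = c at *
  linear_combination (norm := (field_simp; ring)) h2 - q ^ 6 * h1 - (q ^ 3)⁻¹ * h3

/-- The value of a rank sum, in terms of theta functions, logarithmic derivatives of theta
functions and a mock theta function. -/
theorem rankSum_one_eq (hq0 : q ≠ 0) (hq : ‖q‖ < 1) :
    rankSum q 1 = qPochInf q q * (q ^ 16 * gMock ((q ^ 7) ^ 3) ((q ^ 7) ^ 7)) + jLogSeven (q ^ 7) 3 -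
      jLogSeven (q ^ 7) 1 + qPochInf ((q ^ 7) ^ 7) ((q ^ 7) ^ 7) ^ 3 *
        (q ^ 9 * (jSeven (q ^ 7) 1 / jSeven (q ^ 7) 3 ^ 2) - q ^ 3 / jSeven (q ^ 7) 1) := by
  have hy0 : q ^ 7 ≠ 0 := pow_ne_zero 7 hq0
  have hy : ‖q ^ 7‖ < 1 := norm_pow_lt_one hq (by norm_num)
  have ha : jSeven (q ^ 7) 1 ≠ 0 := jSeven_ne_zero hy0 hy (by norm_num)
  have hb : jSeven (q ^ 7) 2 ≠ 0 := jSeven_ne_zero hy0 hy (by norm_num)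
  have hc : jSeven (q ^ 7) 3 ≠ 0 := jSeven_ne_zero hy0 hy (by norm_num)
  have n1 := jSeven_neg hy0 hy 1
  have n2 := jSeven_neg hy0 hy 2
  have h0 := appellSeven_zero hy0 hy (t := 3) (by norm_num)
  have h1 := appellSeven_pair hy0 hy (t := 3) (k := 1) (by norm_num) (by norm_num)
    (by norm_num) (by norm_num)
  have h2 := appellSeven_pair hy0 hy (t := 3) (k := 2) (by norm_num) (by norm_num)
    (by norm_num) (by norm_num)
  have h3 := appellSeven_pair_self hy0 hy (t := 3) (by norm_num)
  have h := rankSum_eq_sum_appellSeven hq0 hq 3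
  have l := jLogSeven_sub hy0 hy (k := 1) (by norm_num)
  norm_num at l
  simp only [Finset.sum_range_succ, Finset.sum_range_zero] at h
  norm_num [tri] at h
  norm_num [jSeven_four hy0, jSeven_five hy0, jSeven_six hy0, n1, n2, l] at h1 h2 h3 h0
  rw [h0] at h h1 h2 h3
  rw [h, qPochInf_dissection_seven hq0 hq]
  clear h n1 n2 h0
  generalize jSeven (q ^ 7) 1 = a at *
  generalize jSeven (q ^ 7) 2 = b at *
  generalize jSeven (q ^ 7) 3 = c at *
  linear_combination (norm := (field_simp; ring)) h3 + q ^ 9 * h1 - q ^ 3 * h2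

end

/-! ### Relations between the theta functions of level seven -/

section

variable {y : ℂ}

theorem jLogSeven_neg (hy0 : y ≠ 0) (hy : ‖y‖ < 1) {k : ℤ} (hk : ¬ 7 ∣ k) :
    jLogSeven y (-k) = 1 - jLogSeven y k := by
  rw [jLogSeven, zpow_neg, jLog_inv (pow_ne_zero 7 hy0) (norm_pow_lt_one hy (by norm_num))
    (zpow_ne_zero k hy0) (jSeven_ne_zero hy0 hy hk), jLogSeven]

/-- `jLogSeven_quartic` at k = 1, with all indices folded back to 1, 2, 3. It and the relations from
k = 2, 3 form a linear system of determinant -14, so they determine the three logarithmic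
derivatives. -/
theorem jLogSeven_relation_one (hy0 : y ≠ 0) (hy : ‖y‖ < 1) :
    1 - jLogSeven y 3 - jLogSeven y 2 - 2 * jLogSeven y 1 =
      qPochInf (y ^ 7) (y ^ 7) ^ 3 * (jSeven y 3 / jSeven y 1 ^ 2) := by
  have hc : jSeven y 3 ≠ 0 := jSeven_ne_zero hy0 hy (by norm_num)
  have h := jLogSeven_quartic hy0 hy (k := 1) (by norm_num)
  have l := jLogSeven_sub hy0 hy (k := 3) (by norm_num)
  norm_num at l
  norm_num [l, jSeven_four hy0] at h
  linear_combination (norm := (field_simp; ring)) h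

theorem jLogSeven_relation_two (hy0 : y ≠ 0) (hy : ‖y‖ < 1) :
    jLogSeven y 1 + jLogSeven y 3 - 2 * jLogSeven y 2 =
      -(qPochInf (y ^ 7) (y ^ 7) ^ 3 * (y * (jSeven y 1 / jSeven y 2 ^ 2))) := by
  have ha : jSeven y 1 ≠ 0 := jSeven_ne_zero hy0 hy (by norm_num)
  have h := jLogSeven_quartic hy0 hy (k := 2) (by norm_num)
  have l1 := jLogSeven_sub hy0 hy (k := 3) (by norm_num)
  have l2 := jLogSeven_sub hy0 hy (k := -1) (by norm_num)
  have j2 := jSeven_sub hy0 (-1)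
  rw [jLogSeven_neg hy0 hy (by norm_num)] at l2
  rw [jSeven_neg hy0 hy] at j2
  norm_num at l1 l2 j2
  norm_num [l1, l2, j2, jSeven_six hy0] at h
  linear_combination (norm := (field_simp; ring)) h

theorem jLogSeven_relation_three (hy0 : y ≠ 0) (hy : ‖y‖ < 1) :
    jLogSeven y 1 - jLogSeven y 2 - 2 * jLogSeven y 3 =
      -(qPochInf (y ^ 7) (y ^ 7) ^ 3 * (y * (jSeven y 2 / jSeven y 3 ^ 2))) := by
  have hb : jSeven y 2 ≠ 0 := jSeven_ne_zero hy0 hy (by norm_num)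
  have h := jLogSeven_quartic hy0 hy (k := 3) (by norm_num)
  have l1 := jLogSeven_sub hy0 hy (k := 1) (by norm_num)
  have l2 := jLogSeven_sub hy0 hy (k := 2) (by norm_num)
  have l3 := jLogSeven_sub hy0 hy (k := -5) (by norm_num)
  have j1 := jSeven_sub hy0 (-2)
  have j2 := jSeven_sub hy0 (-5)
  rw [jLogSeven_neg hy0 hy (by norm_num)] at l3
  rw [jSeven_neg hy0 hy] at j1 j2
  norm_num at l1 l2 l3 j1 j2
  norm_num [l1, l2, l3, j1, j2, jSeven_five hy0] at h
  linear_combination (norm := (field_simp; ring)) h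

end

/-! ### The deviations modulo seven -/

section

variable {q : ℂ}

theorem summable_deviationCoeff (hq : ‖q‖ < 1) (a M : ℕ) :
    Summable fun n => deviationCoeff a M n * q ^ n :=
  ((summable_rankCount_mul_pow hq a M).sub
    ((summable_partitionCount_mul_pow hq).mul_left (M : ℂ)⁻¹)).congr fun n => by
      rw [deviationCoeff]; ring

theorem rankDeviation_eq (hq : ‖q‖ < 1) (a M : ℕ) :
    rankDeviation a M q = ∑' n, (rankCount a M n : ℂ) * q ^ n -
      (M : ℂ)⁻¹ * ∑' n, (partitionCount n : ℂ) * q ^ n := by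
  rw [rankDeviation, ← tsum_mul_left, ← (summable_rankCount_mul_pow hq a M).tsum_sub
    ((summable_partitionCount_mul_pow hq).mul_left (M : ℂ)⁻¹)]
  exact tsum_congr fun n => by rw [deviationCoeff]; ring

theorem qPochInf_mul_rankDeviation (hq0 : q ≠ 0) (hq : ‖q‖ < 1) (i : Fin 7) :
    qPochInf q q * rankDeviation i 7 q = (if i = 0 then 1 else 0) + rankSum q (i : ℕ) -
      rankSum q ((i - 1 : Fin 7) : ℕ) - 1 / 7 := by
  rw [rankDeviation_eq hq, ← qPochInf_mul_tsum_rankCount hq0 hq]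
  have h := qPochInf_mul_tsum_partitionCount hq0 hq
  push_cast
  linear_combination (-1 / 7) * h

theorem rankSum_zero (hq0 : q ≠ 0) (hq : ‖q‖ < 1) :
    rankSum q 0 = rankSum q 7 + qPochInf q q - 1 := by
  linear_combination -rankSum_seven hq0 hq

theorem rankSum_two (hq0 : q ≠ 0) (hq : ‖q‖ < 1) : rankSum q 2 = -rankSum q 4 := by
  simpa using rankSum_neg hq0 hq 4

theorem rankSum_three (hq0 : q ≠ 0) (hq : ‖q‖ < 1) : rankSum q 3 = 0 := by
  have h := rankSum_neg hq0 hq 3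
  norm_num at h
  linear_combination h / 2

theorem rankSum_five (hq0 : q ≠ 0) (hq : ‖q‖ < 1) : rankSum q 5 = -rankSum q 1 := by
  simpa using rankSum_neg hq0 hq 1

theorem rankSum_six (hq0 : q ≠ 0) (hq : ‖q‖ < 1) : rankSum q 6 = -rankSum q 0 := by
  simpa using rankSum_neg hq0 hq 0

/-- The relations between the rank sums and the theta functions of level seven. -/
theorem rankSum_relations (hq0 : q ≠ 0) (hq : ‖q‖ < 1) :
    ∃ a b c E : ℂ, a ≠ 0 ∧ b ≠ 0 ∧ c ≠ 0 ∧ E ≠ 0 ∧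
      J₂ 7 49 q = a ∧ J₂ 14 49 q = b ∧ J₂ 21 49 q = c ∧ J₁ 49 q = E ∧
      J₁ 7 q = a * b * c / E ^ 2 ∧
      qPochInf q q = E * (b / a - q * (c / b) - q ^ 2 + q ^ 5 * (a / c)) ∧
      b / a ^ 2 = c ^ 2 / (a * b ^ 2) + q ^ 7 * a / (b * c) ∧
      b ^ 2 / (a ^ 2 * c) = c / (a * b) + q ^ 7 * a / c ^ 2 ∧
      b / (a * c) = c / b ^ 2 + q ^ 7 * a ^ 2 / (b * c ^ 2) ∧
      ∃ ρ₁ ρ₂ ρ₃ : ℂ, 1 - ρ₃ - ρ₂ - 2 * ρ₁ = E ^ 3 * (c / a ^ 2) ∧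
        ρ₁ + ρ₃ - 2 * ρ₂ = -(E ^ 3 * (q ^ 7 * (a / b ^ 2))) ∧
        ρ₁ - ρ₂ - 2 * ρ₃ = -(E ^ 3 * (q ^ 7 * (b / c ^ 2))) ∧
        rankSum q 7 = qPochInf q q * (q ^ 7 * gMock (q ^ 7) (q ^ 49)) + ρ₁ + ρ₂ +
          E ^ 3 * (q * (b / a ^ 2) - q ^ 5 / b) ∧
        rankSum q 4 = -(qPochInf q q * (q ^ 13 * gMock (q ^ 14) (q ^ 49))) + ρ₂ - ρ₃ +
          E ^ 3 * (q ^ 4 * (c / b ^ 2) - q ^ 6 / c) ∧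
        rankSum q 1 = qPochInf q q * (q ^ 16 * gMock (q ^ 21) (q ^ 49)) + ρ₃ - ρ₁ +
          E ^ 3 * (q ^ 9 * (a / c ^ 2) - q ^ 3 / a) := by
  have hy0 : q ^ 7 ≠ 0 := pow_ne_zero 7 hq0
  have hy : ‖q ^ 7‖ < 1 := norm_pow_lt_one hq (by norm_num)
  have ha : jSeven (q ^ 7) 1 ≠ 0 := jSeven_ne_zero hy0 hy (by norm_num)
  have hb : jSeven (q ^ 7) 2 ≠ 0 := jSeven_ne_zero hy0 hy (by norm_num)
  have hc : jSeven (q ^ 7) 3 ≠ 0 := jSeven_ne_zero hy0 hy (by norm_num)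
  have hE : qPochInf ((q ^ 7) ^ 7) ((q ^ 7) ^ 7) ≠ 0 :=
    qPochInf_self_ne_zero (norm_pow_lt_one hy (by norm_num))
  have e2 : (q ^ 7) ^ 2 = q ^ 14 := by rw [← pow_mul]
  have e3 : (q ^ 7) ^ 3 = q ^ 21 := by rw [← pow_mul]
  have e7 : (q ^ 7) ^ 7 = q ^ 49 := by rw [← pow_mul]
  have hk := jSeven_klein hy0 hy
  have h7 := rankSum_seven_eq hq0 hq
  have h4 := rankSum_four_eq hq0 hq
  have h1 := rankSum_one_eq hq0 hq
  rw [e2] at h4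
  rw [e3] at h1
  refine ⟨jSeven (q ^ 7) 1, jSeven (q ^ 7) 2, jSeven (q ^ 7) 3, qPochInf ((q ^ 7) ^ 7) ((q ^ 7) ^ 7),
    ha, hb, hc, hE, ?_, ?_, ?_, ?_, ?_, qPochInf_dissection_seven hq0 hq, ?_, ?_, ?_,
    jLogSeven (q ^ 7) 1, jLogSeven (q ^ 7) 2, jLogSeven (q ^ 7) 3,
    jLogSeven_relation_one hy0 hy, jLogSeven_relation_two hy0 hy, jLogSeven_relation_three hy0 hy,
    ?_, ?_, ?_⟩
  · rw [jSeven, zpow_one, e7, J₂]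
  · rw [jSeven, zpow_ofNat, e2, e7, J₂]
  · rw [jSeven, zpow_ofNat, e3, e7, J₂]
  · rw [e7, J₁]
  · rw [J₁, eq_div_iff (pow_ne_zero 2 hE), qPochInf_eq_jSeven hy0 hy]
  -- Klein's relation divided by three different monomials, in the shapes needed for the powers q,
  -- q² and q⁴.
  · linear_combination (norm := (field_simp; ring))
      hk / (jSeven (q ^ 7) 1 ^ 2 * jSeven (q ^ 7) 2 ^ 2 * jSeven (q ^ 7) 3)
  · linear_combination (norm := (field_simp; ring))
      hk / (jSeven (q ^ 7) 1 ^ 2 * jSeven (q ^ 7) 2 * jSeven (q ^ 7) 3 ^ 2)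
  · linear_combination (norm := (field_simp; ring))
      hk / (jSeven (q ^ 7) 1 * jSeven (q ^ 7) 2 ^ 2 * jSeven (q ^ 7) 3 ^ 2)
  · rw [← e7]; exact h7
  · rw [← e7]; exact h4
  · rw [← e7]; exact h1

theorem qPochInf_mul_rankDeviation_zero (hq0 : q ≠ 0) (hq : ‖q‖ < 1) :
    qPochInf q q * rankDeviation 0 7 q = 6 / 7 + 2 * rankSum q 0 := by
  have h := qPochInf_mul_rankDeviation hq0 hq 0
  have e : ((0 - 1 : Fin 7) : ℕ) = 6 := rfl
  rw [e, if_pos rfl] at h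
  norm_num [rankSum_six hq0 hq] at h
  linear_combination h

theorem qPochInf_mul_rankDeviation_one (hq0 : q ≠ 0) (hq : ‖q‖ < 1) :
    qPochInf q q * rankDeviation 1 7 q = rankSum q 1 - rankSum q 0 - 1 / 7 := by
  have h := qPochInf_mul_rankDeviation hq0 hq 1
  have e : ((1 - 1 : Fin 7) : ℕ) = 0 := rfl
  rw [e, if_neg (by decide)] at h
  norm_num at h
  linear_combination h

theorem qPochInf_mul_rankDeviation_two (hq0 : q ≠ 0) (hq : ‖q‖ < 1) :
    qPochInf q q * rankDeviation 2 7 q = -rankSum q 4 - rankSum q 1 - 1 / 7 := by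
  have h := qPochInf_mul_rankDeviation hq0 hq 2
  have e : ((2 - 1 : Fin 7) : ℕ) = 1 := rfl
  rw [e, if_neg (by decide)] at h
  norm_num [rankSum_two hq0 hq] at h
  linear_combination h

theorem qPochInf_mul_rankDeviation_three (hq0 : q ≠ 0) (hq : ‖q‖ < 1) :
    qPochInf q q * rankDeviation 3 7 q = rankSum q 4 - 1 / 7 := by
  have h := qPochInf_mul_rankDeviation hq0 hq 3
  have e : ((3 - 1 : Fin 7) : ℕ) = 2 := rfl
  rw [e, if_neg (by decide)] at h
  norm_num [rankSum_two hq0 hq, rankSum_three hq0 hq] at h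
  linear_combination h

theorem qPochInf_mul_rankDeviation_four (hq0 : q ≠ 0) (hq : ‖q‖ < 1) :
    qPochInf q q * rankDeviation 4 7 q = rankSum q 4 - 1 / 7 := by
  have h := qPochInf_mul_rankDeviation hq0 hq 4
  have e : ((4 - 1 : Fin 7) : ℕ) = 3 := rfl
  rw [e, if_neg (by decide)] at h
  norm_num [rankSum_three hq0 hq] at h
  linear_combination h

theorem qPochInf_mul_rankDeviation_five (hq0 : q ≠ 0) (hq : ‖q‖ < 1) :
    qPochInf q q * rankDeviation 5 7 q = -rankSum q 4 - rankSum q 1 - 1 / 7 := by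
  have h := qPochInf_mul_rankDeviation hq0 hq 5
  have e : ((5 - 1 : Fin 7) : ℕ) = 4 := rfl
  rw [e, if_neg (by decide)] at h
  norm_num [rankSum_five hq0 hq] at h
  linear_combination h

theorem qPochInf_mul_rankDeviation_six (hq0 : q ≠ 0) (hq : ‖q‖ < 1) :
    qPochInf q q * rankDeviation 6 7 q = rankSum q 1 - rankSum q 0 - 1 / 7 := by
  have h := qPochInf_mul_rankDeviation hq0 hq 6
  have e : ((6 - 1 : Fin 7) : ℕ) = 5 := rfl
  rw [e, if_neg (by decide)] at h
  norm_num [rankSum_six hq0 hq, rankSum_five hq0 hq] at h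
  linear_combination h

theorem rankDeviation_zero_seven (hq0 : q ≠ 0) (hq : ‖q‖ < 1) :
    rankDeviation 0 7 q =
      2 + 2 * q ^ 7 * gMock (q ^ 7) (q ^ 49)
      - 8 / 7 * (J₂ 21 49 q ^ 2 / J₁ 7 q)
      + 6 / 7 * q * (J₁ 49 q ^ 2 / J₂ 7 49 q)
      - 2 / 7 * q ^ 2 * (J₂ 14 49 q ^ 2 / J₁ 7 q)
      + 4 / 7 * q ^ 3 * (J₁ 49 q ^ 2 / J₂ 14 49 q)
      + 2 / 7 * q ^ 4 * (J₁ 49 q ^ 2 / J₂ 21 49 q)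
      - 4 / 7 * q ^ 6 * (J₂ 7 49 q ^ 2 / J₁ 7 q) := by
  refine mul_left_cancel₀ (qPochInf_self_ne_zero hq) ?_
  rw [qPochInf_mul_rankDeviation_zero hq0 hq, rankSum_zero hq0 hq]
  obtain ⟨a, b, c, E, ha, hb, hc, hE, ja, jb, jc, jE, jF, hD, K1, K2, K4,
    ρ₁, ρ₂, ρ₃, R1, R2, R3, h7, h4, h1⟩ := rankSum_relations hq0 hq
  rw [ja, jb, jc, jE, jF]
  -- As J_7 = abc/E², the claimed theta part is E² times the bracket multiplying `hD`. The relations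
  -- `R1`, `R2`, `R3` enter with the coefficients at q⁰, q⁶ and minus that at q² and eliminate the
  -- ρ's; `K1`, `K2`, `K4` then absorb the cross terms, with minus the first, minus the third and
  -- the last of the bracket's coefficients. The other deviations follow the same pattern.
  linear_combination (norm := (field_simp; ring)) 2 * h7 -
    (E ^ 2 * (-8 / 7 * (c / (a * b)) + 6 / 7 * (q / a) +
      -2 / 7 * (q ^ 2 * b / (a * c)) + 4 / 7 * (q ^ 3 / b) + 2 / 7 * (q ^ 4 / c) +
      -4 / 7 * (q ^ 6 * a / (b * c)))) * hD +
    -8 / 7 * R1 + -4 / 7 * R2 - -2 / 7 * R3 + 8 / 7 * q * E ^ 3 * K1 +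
    2 / 7 * q ^ 2 * E ^ 3 * K2 + -4 / 7 * q ^ 4 * E ^ 3 * K4

theorem rankDeviation_one_seven (hq0 : q ≠ 0) (hq : ‖q‖ < 1) :
    rankDeviation 1 7 q =
      -1 - q ^ 7 * gMock (q ^ 7) (q ^ 49) + q ^ 16 * gMock (q ^ 21) (q ^ 49)
      + 6 / 7 * (J₂ 21 49 q ^ 2 / J₁ 7 q)
      - 1 / 7 * q * (J₁ 49 q ^ 2 / J₂ 7 49 q)
      + 5 / 7 * q ^ 2 * (J₂ 14 49 q ^ 2 / J₁ 7 q)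
      - 3 / 7 * q ^ 3 * (J₁ 49 q ^ 2 / J₂ 14 49 q)
      + 2 / 7 * q ^ 4 * (J₁ 49 q ^ 2 / J₂ 21 49 q)
      + 3 / 7 * q ^ 6 * (J₂ 7 49 q ^ 2 / J₁ 7 q) := by
  refine mul_left_cancel₀ (qPochInf_self_ne_zero hq) ?_
  rw [qPochInf_mul_rankDeviation_one hq0 hq, rankSum_zero hq0 hq]
  obtain ⟨a, b, c, E, ha, hb, hc, hE, ja, jb, jc, jE, jF, hD, K1, K2, K4,
    ρ₁, ρ₂, ρ₃, R1, R2, R3, h7, h4, h1⟩ := rankSum_relations hq0 hq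
  rw [ja, jb, jc, jE, jF]
  linear_combination (norm := (field_simp; ring)) h1 - h7 -
    (E ^ 2 * (6 / 7 * (c / (a * b)) + -1 / 7 * (q / a) +
      5 / 7 * (q ^ 2 * b / (a * c)) + -3 / 7 * (q ^ 3 / b) + 2 / 7 * (q ^ 4 / c) +
      3 / 7 * (q ^ 6 * a / (b * c)))) * hD +
    6 / 7 * R1 + 3 / 7 * R2 - 5 / 7 * R3 + -6 / 7 * q * E ^ 3 * K1 +
    -5 / 7 * q ^ 2 * E ^ 3 * K2 + 3 / 7 * q ^ 4 * E ^ 3 * K4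

theorem rankDeviation_two_seven (hq0 : q ≠ 0) (hq : ‖q‖ < 1) :
    rankDeviation 2 7 q =
      q ^ 13 * gMock (q ^ 14) (q ^ 49) - q ^ 16 * gMock (q ^ 21) (q ^ 49)
      - 1 / 7 * (J₂ 21 49 q ^ 2 / J₁ 7 q)
      - 1 / 7 * q * (J₁ 49 q ^ 2 / J₂ 7 49 q)
      - 2 / 7 * q ^ 2 * (J₂ 14 49 q ^ 2 / J₁ 7 q)
      + 4 / 7 * q ^ 3 * (J₁ 49 q ^ 2 / J₂ 14 49 q)
      - 5 / 7 * q ^ 4 * (J₁ 49 q ^ 2 / J₂ 21 49 q)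
      + 3 / 7 * q ^ 6 * (J₂ 7 49 q ^ 2 / J₁ 7 q) := by
  refine mul_left_cancel₀ (qPochInf_self_ne_zero hq) ?_
  rw [qPochInf_mul_rankDeviation_two hq0 hq]
  obtain ⟨a, b, c, E, ha, hb, hc, hE, ja, jb, jc, jE, jF, hD, K1, K2, K4,
    ρ₁, ρ₂, ρ₃, R1, R2, R3, h7, h4, h1⟩ := rankSum_relations hq0 hq
  rw [ja, jb, jc, jE, jF]
  linear_combination (norm := (field_simp; ring)) -h4 - h1 -
    (E ^ 2 * (-1 / 7 * (c / (a * b)) + -1 / 7 * (q / a) +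
      -2 / 7 * (q ^ 2 * b / (a * c)) + 4 / 7 * (q ^ 3 / b) + -5 / 7 * (q ^ 4 / c) +
      3 / 7 * (q ^ 6 * a / (b * c)))) * hD +
    -1 / 7 * R1 + 3 / 7 * R2 - -2 / 7 * R3 + 1 / 7 * q * E ^ 3 * K1 +
    2 / 7 * q ^ 2 * E ^ 3 * K2 + 3 / 7 * q ^ 4 * E ^ 3 * K4

theorem rankDeviation_three_seven (hq0 : q ≠ 0) (hq : ‖q‖ < 1) :
    rankDeviation 3 7 q =
      -(q ^ 13 * gMock (q ^ 14) (q ^ 49))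
      - 1 / 7 * (J₂ 21 49 q ^ 2 / J₁ 7 q)
      - 1 / 7 * q * (J₁ 49 q ^ 2 / J₂ 7 49 q)
      - 2 / 7 * q ^ 2 * (J₂ 14 49 q ^ 2 / J₁ 7 q)
      - 3 / 7 * q ^ 3 * (J₁ 49 q ^ 2 / J₂ 14 49 q)
      + 2 / 7 * q ^ 4 * (J₁ 49 q ^ 2 / J₂ 21 49 q)
      - 4 / 7 * q ^ 6 * (J₂ 7 49 q ^ 2 / J₁ 7 q) := by
  refine mul_left_cancel₀ (qPochInf_self_ne_zero hq) ?_
  rw [qPochInf_mul_rankDeviation_three hq0 hq]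
  obtain ⟨a, b, c, E, ha, hb, hc, hE, ja, jb, jc, jE, jF, hD, K1, K2, K4,
    ρ₁, ρ₂, ρ₃, R1, R2, R3, h7, h4, h1⟩ := rankSum_relations hq0 hq
  rw [ja, jb, jc, jE, jF]
  linear_combination (norm := (field_simp; ring)) h4 -
    (E ^ 2 * (-1 / 7 * (c / (a * b)) + -1 / 7 * (q / a) +
      -2 / 7 * (q ^ 2 * b / (a * c)) + -3 / 7 * (q ^ 3 / b) + 2 / 7 * (q ^ 4 / c) +
      -4 / 7 * (q ^ 6 * a / (b * c)))) * hD +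
    -1 / 7 * R1 + -4 / 7 * R2 - -2 / 7 * R3 + 1 / 7 * q * E ^ 3 * K1 +
    2 / 7 * q ^ 2 * E ^ 3 * K2 + -4 / 7 * q ^ 4 * E ^ 3 * K4

end

/-! ### Rank differences modulo seven -/

/-- If a power series vanishes on the punctured unit disc, then its coefficients vanish. -/
theorem eq_zero_of_hasSum_mul_pow {u : ℕ → ℂ}
    (h : ∀ x : ℂ, x ≠ 0 → ‖x‖ < 1 → HasSum (fun n => u n * x ^ n) 0) (n : ℕ) : u n = 0 := by
  induction n using Nat.strong_induction_on with
  | _ n ih =>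
    -- Once the lower coefficients vanish, x^n can be divided out, and letting x → 0 isolates u n.
    have h1 : ∀ x : ℂ, x ≠ 0 → ‖x‖ < 1 → HasSum (fun m => u (m + n) * x ^ m) 0 := by
      intro x hx0 hx
      have h2 := (hasSum_nat_add_iff' n).2 (h x hx0 hx)
      rw [Finset.sum_eq_zero fun i hi => by rw [ih i (Finset.mem_range.1 hi), zero_mul],
        sub_zero] at h2
      refine (h2.mul_right (x ^ n)⁻¹).of_eq (fun m => ?_) (zero_mul _).symm
      have := pow_ne_zero n hx0
      rw [pow_add]
      field_simp
    have hb := (h1 (1 / 2) (by norm_num) (by norm_num)).summable.norm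
    have hev : ∀ᶠ x : ℂ in 𝓝[≠] 0, ∀ m, ‖u (m + n) * x ^ m‖ ≤ ‖u (m + n) * (1 / 2) ^ m‖ := by
      have : ∀ᶠ x : ℂ in 𝓝[≠] 0, ‖x‖ < 1 / 2 :=
        nhdsWithin_le_nhds
          ((isOpen_lt continuous_norm continuous_const).mem_nhds (by simp))
      filter_upwards [this] with x hx m
      rw [norm_mul, norm_mul, norm_pow, norm_pow]
      gcongr
      exact hx.le.trans (by norm_num)
    have hlim : Tendsto (fun x : ℂ => ∑' m, u (m + n) * x ^ m) (𝓝[≠] 0)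
        (𝓝 (∑' m, u (m + n) * 0 ^ m)) := by
      refine tendsto_tsum_of_dominated_convergence hb (fun m => ?_) hev
      exact (Continuous.tendsto (by fun_prop) 0).mono_left nhdsWithin_le_nhds
    have h0 : (fun x : ℂ => ∑' m, u (m + n) * x ^ m) =ᶠ[𝓝[≠] 0] fun _ => 0 := by
      have : ∀ᶠ x : ℂ in 𝓝[≠] 0, ‖x‖ < 1 :=
        nhdsWithin_le_nhds
          ((isOpen_lt continuous_norm continuous_const).mem_nhds (by simp))
      filter_upwards [this, self_mem_nhdsWithin] with x hx hx0
      exact (h1 x hx0 hx).tsum_eq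
    have := tendsto_nhds_unique (hlim.congr' h0) tendsto_const_nhds
    rw [tsum_eq_single 0 fun m hm => by rw [zero_pow hm, mul_zero]] at this
    simpa using this

/-- For a seventh root q of x this is, up to the factor q^c, a subseries of a convergent series in
q. -/
theorem summable_rankDifferenceCoeff {x : ℂ} (hx0 : x ≠ 0) (hx : ‖x‖ < 1) (a b c : ℕ) :
    Summable fun n => rankDifferenceCoeff a b 7 c 7 n * x ^ n := by
  obtain ⟨q, hq⟩ := IsAlgClosed.exists_pow_nat_eq x (by norm_num : 0 < 7)
  have hq0 : q ≠ 0 := fun h => hx0 (by rw [← hq, h]; norm_num)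
  have hq1 : ‖q‖ < 1 := by
    by_contra! h
    exact absurd (one_le_pow₀ h (n := 7)) (not_le.2 (by rwa [← norm_pow, hq]))
  have h := ((summable_rankCount_mul_pow hq1 a 7).sub (summable_rankCount_mul_pow hq1 b 7)).comp_injective
    (i := fun n : ℕ => 7 * n + c) fun m n h => by simpa using h
  refine (h.mul_right (q ^ c)⁻¹).congr fun n => ?_
  have := pow_ne_zero c hq0
  simp only [Function.comp]
  rw [rankDifferenceCoeff, ← hq, pow_add, ← pow_mul]
  field_simp

theorem rankDeviation_sub {q : ℂ} (hq : ‖q‖ < 1) (a b : ℕ) :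
    rankDeviation a 7 q - rankDeviation b 7 q =
      ∑ c : Fin 7, q ^ (c : ℕ) * rankDifference a b 7 c 7 (q ^ 7) := by
  have ha := summable_rankCount_mul_pow hq a 7
  have hb := summable_rankCount_mul_pow hq b 7
  rw [rankDeviation_eq hq, rankDeviation_eq hq, sub_sub_sub_cancel_right, ← ha.tsum_sub hb,
    Nat.sumByResidueClasses (ha.sub hb) 7]
  refine Finset.sum_congr rfl fun c _ => ?_
  rw [rankDifference, ← tsum_mul_left]
  refine tsum_congr fun n => ?_
  change Fin 7 at c
  rw [show ZMod.val (n := 7) c = (c : ℕ) from rfl, rankDifferenceCoeff, ← pow_mul,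
    add_comm (c : ℕ), pow_add]
  ring

/-- The coefficients of the powers `q ^ c`, `c < 7`, in the deviations `D(a, 7)` for `a < 4`, as
functions of `x = q ^ 7`. -/
def deviationClass (x : ℂ) : Fin 4 → Fin 7 → ℂ :=
  ![![2 + 2 * (x * gMock x (x ^ 7)) - 8 / 7 * (J₂ 3 7 x ^ 2 / J₁ 1 x),
      6 / 7 * (J₁ 7 x ^ 2 / J₂ 1 7 x), -2 / 7 * (J₂ 2 7 x ^ 2 / J₁ 1 x),
      4 / 7 * (J₁ 7 x ^ 2 / J₂ 2 7 x), 2 / 7 * (J₁ 7 x ^ 2 / J₂ 3 7 x), 0,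
      -4 / 7 * (J₂ 1 7 x ^ 2 / J₁ 1 x)],
    ![-1 - x * gMock x (x ^ 7) + 6 / 7 * (J₂ 3 7 x ^ 2 / J₁ 1 x),
      -1 / 7 * (J₁ 7 x ^ 2 / J₂ 1 7 x),
      x ^ 2 * gMock (x ^ 3) (x ^ 7) + 5 / 7 * (J₂ 2 7 x ^ 2 / J₁ 1 x),
      -3 / 7 * (J₁ 7 x ^ 2 / J₂ 2 7 x), 2 / 7 * (J₁ 7 x ^ 2 / J₂ 3 7 x), 0,
      3 / 7 * (J₂ 1 7 x ^ 2 / J₁ 1 x)],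
    ![-1 / 7 * (J₂ 3 7 x ^ 2 / J₁ 1 x), -1 / 7 * (J₁ 7 x ^ 2 / J₂ 1 7 x),
      -(x ^ 2 * gMock (x ^ 3) (x ^ 7)) - 2 / 7 * (J₂ 2 7 x ^ 2 / J₁ 1 x),
      4 / 7 * (J₁ 7 x ^ 2 / J₂ 2 7 x), -5 / 7 * (J₁ 7 x ^ 2 / J₂ 3 7 x), 0,
      x * gMock (x ^ 2) (x ^ 7) + 3 / 7 * (J₂ 1 7 x ^ 2 / J₁ 1 x)],
    ![-1 / 7 * (J₂ 3 7 x ^ 2 / J₁ 1 x), -1 / 7 * (J₁ 7 x ^ 2 / J₂ 1 7 x),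
      -2 / 7 * (J₂ 2 7 x ^ 2 / J₁ 1 x), -3 / 7 * (J₁ 7 x ^ 2 / J₂ 2 7 x),
      2 / 7 * (J₁ 7 x ^ 2 / J₂ 3 7 x), 0,
      -(x * gMock (x ^ 2) (x ^ 7)) - 4 / 7 * (J₂ 1 7 x ^ 2 / J₁ 1 x)]]

/-- With x = q⁷, the prefactors of g are q⁷ = x, q¹³ = q⁶x and q¹⁶ = q²x², which places the three
mock theta terms in the classes 0, 6 and 2. -/
theorem rankDeviation_eq_sum_deviationClass {q : ℂ} (hq0 : q ≠ 0) (hq : ‖q‖ < 1) (a : Fin 4) :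
    rankDeviation a 7 q = ∑ c : Fin 7, q ^ (c : ℕ) * deviationClass (q ^ 7) a c := by
  have e1 : J₂ 7 49 q = J₂ 1 7 (q ^ 7) := by simp only [J₂, ← pow_mul]
  have e2 : J₂ 14 49 q = J₂ 2 7 (q ^ 7) := by simp only [J₂, ← pow_mul]
  have e3 : J₂ 21 49 q = J₂ 3 7 (q ^ 7) := by simp only [J₂, ← pow_mul]
  have e4 : J₁ 49 q = J₁ 7 (q ^ 7) := by simp only [J₁, ← pow_mul]
  have e5 : J₁ 7 q = J₁ 1 (q ^ 7) := by simp only [J₁, ← pow_mul]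
  have p2 : (q ^ 7) ^ 2 = q ^ 14 := by rw [← pow_mul]
  have p3 : (q ^ 7) ^ 3 = q ^ 21 := by rw [← pow_mul]
  have p7 : (q ^ 7) ^ 7 = q ^ 49 := by rw [← pow_mul]
  rw [Fin.sum_univ_seven]
  fin_cases a
  · change rankDeviation 0 7 q = _
    rw [rankDeviation_zero_seven hq0 hq, e1, e2, e3, e4, e5]
    simp [deviationClass, p2, p3, p7]
    ring
  · change rankDeviation 1 7 q = _
    rw [rankDeviation_one_seven hq0 hq, e1, e2, e3, e4, e5]
    simp [deviationClass, p2, p3, p7]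
    ring
  · change rankDeviation 2 7 q = _
    rw [rankDeviation_two_seven hq0 hq, e1, e2, e3, e4, e5]
    simp [deviationClass, p2, p3, p7]
    ring
  · change rankDeviation 3 7 q = _
    rw [rankDeviation_three_seven hq0 hq, e1, e2, e3, e4, e5]
    simp [deviationClass, p2, p3, p7]
    ring

/-- Fix a seventh root q of x. The formula for the difference of deviations holds at zq for every z⁷
= 1, always with the same x, so the root of unity filter separates the powers q^c. The term p(n)/7
cancels in the difference. -/
theorem rankDifference_eq {x : ℂ} (hx0 : x ≠ 0) (hx : ‖x‖ < 1) (a b : Fin 4) (c : Fin 7) :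
    rankDifference a b 7 c 7 x = deviationClass x a c - deviationClass x b c := by
  obtain ⟨q, hq⟩ := IsAlgClosed.exists_pow_nat_eq x (by norm_num : 0 < 7)
  have hq0 : q ≠ 0 := fun h => hx0 (by rw [← hq, h]; norm_num)
  have hq1 : ‖q‖ < 1 := by
    by_contra! h
    exact absurd (one_le_pow₀ h (n := 7)) (not_le.2 (by rwa [← norm_pow, hq]))
  have h := eq_zero_of_forall_root_of_unity (u := fun c => q ^ (c : ℕ) *
    (rankDifference a b 7 c 7 x - (deviationClass x a c - deviationClass x b c))) (fun z hz => ?_) c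
  · exact sub_eq_zero.1 ((mul_eq_zero.1 h).resolve_left (pow_ne_zero _ hq0))
  have hz0 : z ≠ 0 := fun h => by simp [h] at hz
  have hn : ‖z * q‖ < 1 := by rwa [norm_mul, norm_eq_one_of_pow_seven hz, one_mul]
  have h1 := rankDeviation_sub hn a b
  have h7 : (z * q) ^ 7 = x := by rw [mul_pow, hz, one_mul, hq]
  rw [rankDeviation_eq_sum_deviationClass (mul_ne_zero hz0 hq0) hn,
    rankDeviation_eq_sum_deviationClass (mul_ne_zero hz0 hq0) hn, h7, ← Finset.sum_sub_distrib] at h1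
  rw [← sub_eq_zero.2 h1.symm, ← Finset.sum_sub_distrib]
  exact Finset.sum_congr rfl fun c _ => by rw [mul_pow]; ring

/-- The hypothesis makes a power series vanish on the punctured disc, so its coefficients vanish. -/
theorem rankCount_add_eq_of_deviationClass {a b a' b' : Fin 4} {c : Fin 7}
    (h : ∀ x, deviationClass x a c + deviationClass x a' c =
      deviationClass x b c + deviationClass x b' c) (n : ℕ) :
    rankCount a 7 (7 * n + c) + rankCount a' 7 (7 * n + c) =
      rankCount b 7 (7 * n + c) + rankCount b' 7 (7 * n + c) := by
  have h0 := eq_zero_of_hasSum_mul_pow (u := fun n => rankDifferenceCoeff a b 7 c 7 n +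
    rankDifferenceCoeff a' b' 7 c 7 n) (fun x hx0 hx => by
      refine ((summable_rankDifferenceCoeff hx0 hx a b c).hasSum.add
        (summable_rankDifferenceCoeff hx0 hx a' b' c).hasSum).of_eq (fun n => add_mul _ _ _) ?_
      have h1 := rankDifference_eq hx0 hx a b c
      have h2 := rankDifference_eq hx0 hx a' b' c
      rw [rankDifference] at h1 h2
      rw [h1, h2]
      linear_combination -h x) n
  simp only [rankDifferenceCoeff] at h0
  have : ((rankCount a 7 (7 * n + c) + rankCount a' 7 (7 * n + c) : ℕ) : ℂ) =
      (rankCount b 7 (7 * n + c) + rankCount b' 7 (7 * n + c) : ℕ) := by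
    push_cast
    linear_combination h0
  exact_mod_cast this

theorem rankCount_eq_of_deviationClass {a b : Fin 4} {c : Fin 7}
    (h : ∀ x, deviationClass x a c = deviationClass x b c) (n : ℕ) :
    rankCount a 7 (7 * n + c) = rankCount b 7 (7 * n + c) :=
  Nat.add_right_cancel (rankCount_add_eq_of_deviationClass (a' := a) (b' := a)
    (fun x => by rw [h x]) n)

theorem summable_gTerm_pow {q : ℂ} (hq0 : q ≠ 0) (hq : ‖q‖ < 1) {k m : ℕ} (hk : 0 < k)
    (hkm : k < m) : Summable (gTerm (q ^ k) (q ^ m)) := by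
  refine summable_gTerm (pow_ne_zero m hq0) (norm_pow_lt_one hq (by omega)) (pow_ne_zero k hq0)
    fun n h => ?_
  rw [pow_zpow, ← zpow_natCast, ← zpow_add₀ hq0] at h
  have h0 := zpow_injective_of_norm_lt_one hq0 hq (h.trans (zpow_zero q).symm)
  have h1 : (m : ℤ) ∣ k := ⟨-n, by linear_combination h0⟩
  exact absurd (Int.le_of_dvd (by exact_mod_cast hk) h1) (by omega)

end

/-! ### Deviations, Dyson's conjectures and rank differences modulo seven -/

theorem mainTheorem4 :
    -- the explicit formulas for the deviations modulo `7`
    (∀ q : ℂ, 0 < ‖q‖ → ‖q‖ < 1 →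
      (∀ a : ℕ, a < 7 → Summable fun n : ℕ => deviationCoeff a 7 n * q ^ n) ∧
      (∀ k : ℕ, 1 ≤ k → k ≤ 3 → Summable (gTerm (q ^ (7 * k)) (q ^ 49))) ∧
      rankDeviation 0 7 q =
        2 + 2 * q ^ 7 * gMock (q ^ 7) (q ^ 49)
        - 8 / 7 * (J₂ 21 49 q ^ 2 / J₁ 7 q)
        + 6 / 7 * q * (J₁ 49 q ^ 2 / J₂ 7 49 q)
        - 2 / 7 * q ^ 2 * (J₂ 14 49 q ^ 2 / J₁ 7 q)
        + 4 / 7 * q ^ 3 * (J₁ 49 q ^ 2 / J₂ 14 49 q)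
        + 2 / 7 * q ^ 4 * (J₁ 49 q ^ 2 / J₂ 21 49 q)
        - 4 / 7 * q ^ 6 * (J₂ 7 49 q ^ 2 / J₁ 7 q) ∧
      rankDeviation 1 7 q = rankDeviation 6 7 q ∧
      rankDeviation 1 7 q =
        -1 - q ^ 7 * gMock (q ^ 7) (q ^ 49) + q ^ 16 * gMock (q ^ 21) (q ^ 49)
        + 6 / 7 * (J₂ 21 49 q ^ 2 / J₁ 7 q)
        - 1 / 7 * q * (J₁ 49 q ^ 2 / J₂ 7 49 q)
        + 5 / 7 * q ^ 2 * (J₂ 14 49 q ^ 2 / J₁ 7 q)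
        - 3 / 7 * q ^ 3 * (J₁ 49 q ^ 2 / J₂ 14 49 q)
        + 2 / 7 * q ^ 4 * (J₁ 49 q ^ 2 / J₂ 21 49 q)
        + 3 / 7 * q ^ 6 * (J₂ 7 49 q ^ 2 / J₁ 7 q) ∧
      rankDeviation 2 7 q = rankDeviation 5 7 q ∧
      rankDeviation 2 7 q =
        q ^ 13 * gMock (q ^ 14) (q ^ 49) - q ^ 16 * gMock (q ^ 21) (q ^ 49)
        - 1 / 7 * (J₂ 21 49 q ^ 2 / J₁ 7 q)
        - 1 / 7 * q * (J₁ 49 q ^ 2 / J₂ 7 49 q)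
        - 2 / 7 * q ^ 2 * (J₂ 14 49 q ^ 2 / J₁ 7 q)
        + 4 / 7 * q ^ 3 * (J₁ 49 q ^ 2 / J₂ 14 49 q)
        - 5 / 7 * q ^ 4 * (J₁ 49 q ^ 2 / J₂ 21 49 q)
        + 3 / 7 * q ^ 6 * (J₂ 7 49 q ^ 2 / J₁ 7 q) ∧
      rankDeviation 3 7 q = rankDeviation 4 7 q ∧
      rankDeviation 3 7 q =
        -(q ^ 13 * gMock (q ^ 14) (q ^ 49))
        - 1 / 7 * (J₂ 21 49 q ^ 2 / J₁ 7 q)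
        - 1 / 7 * q * (J₁ 49 q ^ 2 / J₂ 7 49 q)
        - 2 / 7 * q ^ 2 * (J₂ 14 49 q ^ 2 / J₁ 7 q)
        - 3 / 7 * q ^ 3 * (J₁ 49 q ^ 2 / J₂ 14 49 q)
        + 2 / 7 * q ^ 4 * (J₁ 49 q ^ 2 / J₂ 21 49 q)
        - 4 / 7 * q ^ 6 * (J₂ 7 49 q ^ 2 / J₁ 7 q)) ∧
    -- Dyson's conjectures modulo `7`
    (∀ n : ℕ,
      rankCount 2 7 (7 * n) = rankCount 3 7 (7 * n) ∧
      (rankCount 1 7 (7 * n + 1) = rankCount 2 7 (7 * n + 1) ∧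
        rankCount 2 7 (7 * n + 1) = rankCount 3 7 (7 * n + 1)) ∧
      rankCount 0 7 (7 * n + 2) = rankCount 3 7 (7 * n + 2) ∧
      (rankCount 0 7 (7 * n + 3) = rankCount 2 7 (7 * n + 3) ∧
        rankCount 1 7 (7 * n + 3) = rankCount 3 7 (7 * n + 3)) ∧
      (rankCount 0 7 (7 * n + 4) = rankCount 1 7 (7 * n + 4) ∧
        rankCount 1 7 (7 * n + 4) = rankCount 3 7 (7 * n + 4)) ∧
      (rankCount 0 7 (7 * n + 5) = rankCount 1 7 (7 * n + 5) ∧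
        rankCount 1 7 (7 * n + 5) = rankCount 2 7 (7 * n + 5) ∧
        rankCount 2 7 (7 * n + 5) = rankCount 3 7 (7 * n + 5)) ∧
      rankCount 0 7 (7 * n + 6) + rankCount 1 7 (7 * n + 6) =
        rankCount 2 7 (7 * n + 6) + rankCount 3 7 (7 * n + 6)) ∧
    -- the Atkin–Swinnerton-Dyer evaluation of the rank-differences modulo `7`
    (∀ q : ℂ, 0 < ‖q‖ → ‖q‖ < 1 →
      (∀ a b c : ℕ, a < 7 → b < 7 → c < 7 →
        Summable fun n : ℕ => rankDifferenceCoeff a b 7 c 7 n * q ^ n) ∧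
      (∀ k : ℕ, 1 ≤ k → k ≤ 3 → Summable (gTerm (q ^ k) (q ^ 7))) ∧
      -- `c = 0`
      rankDifference 2 3 7 0 7 q = 0 ∧
      rankDifference 0 2 7 0 7 q + rankDifference 1 2 7 0 7 q = 1 + q * gMock q (q ^ 7) ∧
      rankDifference 0 2 7 0 7 q + 2 * rankDifference 1 2 7 0 7 q = J₂ 3 7 q ^ 2 / J₁ 1 q ∧
      -- `c = 1`
      rankDifference 1 2 7 1 7 q = 0 ∧
      rankDifference 2 3 7 1 7 q = 0 ∧
      rankDifference 0 1 7 1 7 q = J₁ 7 q ^ 2 / J₂ 1 7 q ∧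
      -- `c = 2`
      rankDifference 0 3 7 2 7 q = 0 ∧
      rankDifference 2 3 7 2 7 q = -(q ^ 2 * gMock (q ^ 3) (q ^ 7)) ∧
      rankDifference 1 3 7 2 7 q + rankDifference 2 3 7 2 7 q = J₂ 2 7 q ^ 2 / J₁ 1 q ∧
      -- `c = 3`
      rankDifference 0 2 7 3 7 q = 0 ∧
      rankDifference 1 3 7 3 7 q = 0 ∧
      rankDifference 0 1 7 3 7 q = J₁ 7 q ^ 2 / J₂ 2 7 q ∧
      -- `c = 4`
      rankDifference 0 1 7 4 7 q = 0 ∧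
      rankDifference 0 3 7 4 7 q = 0 ∧
      rankDifference 0 2 7 4 7 q = J₁ 7 q ^ 2 / J₂ 3 7 q ∧
      -- `c = 5`
      rankDifference 0 1 7 5 7 q = 0 ∧
      rankDifference 0 2 7 5 7 q = 0 ∧
      rankDifference 0 3 7 5 7 q = 0 ∧
      -- `c = 6`
      rankDifference 0 2 7 6 7 q + rankDifference 1 3 7 6 7 q = 0 ∧
      rankDifference 0 3 7 6 7 q = q * gMock (q ^ 2) (q ^ 7) ∧
      rankDifference 0 1 7 6 7 q = -(J₂ 1 7 q ^ 2 / J₁ 1 q)) := by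
  refine ⟨fun q h0 hq => ?_, fun n => ?_, fun q h0 hq => ?_⟩
  · have hq0 : q ≠ 0 := norm_pos_iff.1 h0
    have hE := qPochInf_self_ne_zero hq
    refine ⟨fun a _ => summable_deviationCoeff hq a 7,
      fun k h1 h3 => summable_gTerm_pow hq0 hq (by omega) (by omega),
      rankDeviation_zero_seven hq0 hq, mul_left_cancel₀ hE ?_, rankDeviation_one_seven hq0 hq,
      mul_left_cancel₀ hE ?_, rankDeviation_two_seven hq0 hq, mul_left_cancel₀ hE ?_,
      rankDeviation_three_seven hq0 hq⟩
    · rw [qPochInf_mul_rankDeviation_one hq0 hq, qPochInf_mul_rankDeviation_six hq0 hq]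
    · rw [qPochInf_mul_rankDeviation_two hq0 hq, qPochInf_mul_rankDeviation_five hq0 hq]
    · rw [qPochInf_mul_rankDeviation_three hq0 hq, qPochInf_mul_rankDeviation_four hq0 hq]
  · have h : ∀ (a b : Fin 4) (c : Fin 7), (∀ x, deviationClass x a c = deviationClass x b c) →
        rankCount a 7 (7 * n + c) = rankCount b 7 (7 * n + c) := fun a b c h =>
      rankCount_eq_of_deviationClass h n
    refine ⟨h 2 3 0 ?_, ⟨h 1 2 1 ?_, h 2 3 1 ?_⟩, h 0 3 2 ?_, ⟨h 0 2 3 ?_, h 1 3 3 ?_⟩,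
      ⟨h 0 1 4 ?_, h 1 3 4 ?_⟩, ⟨h 0 1 5 ?_, h 1 2 5 ?_, h 2 3 5 ?_⟩,
      rankCount_add_eq_of_deviationClass (a := 0) (a' := 1) (b := 2) (b' := 3) (c := 6) ?_ n⟩
    all_goals intro x
    -- The compared entries of the table are identical expressions; only the class 6, where g
    -- cancels between the two sides, needs arithmetic.
    all_goals simp [deviationClass]
    ring
  · have hq0 : q ≠ 0 := norm_pos_iff.1 h0
    have h := rankDifference_eq hq0 hq
    refine ⟨fun a b c _ _ _ => summable_rankDifferenceCoeff hq0 hq a b c,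
      fun k h1 h3 => summable_gTerm_pow hq0 hq (by omega) (by omega),
      (h 2 3 0).trans ?_, (congrArg₂ _ (h 0 2 0) (h 1 2 0)).trans ?_,
      (congrArg₂ _ (h 0 2 0) (congrArg _ (h 1 2 0))).trans ?_,
      (h 1 2 1).trans ?_, (h 2 3 1).trans ?_, (h 0 1 1).trans ?_,
      (h 0 3 2).trans ?_, (h 2 3 2).trans ?_, (congrArg₂ _ (h 1 3 2) (h 2 3 2)).trans ?_,
      (h 0 2 3).trans ?_, (h 1 3 3).trans ?_, (h 0 1 3).trans ?_,
      (h 0 1 4).trans ?_, (h 0 3 4).trans ?_, (h 0 2 4).trans ?_,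
      (h 0 1 5).trans ?_, (h 0 2 5).trans ?_, (h 0 3 5).trans ?_,
      (congrArg₂ _ (h 0 2 6) (h 1 3 6)).trans ?_, (h 0 3 6).trans ?_, (h 0 1 6).trans ?_⟩
    all_goals simp [deviationClass]
    all_goals ring
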